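/- Let $N\ge 1$ and let $\Lambda=\Lambda_{2N}$ be any $2$-graph with vertices $v,u_1,\dots,u_N,w_1,\dots,w_N$ which has, in each of the two colours red and blue, exactly one edge from $v$ to each $u_j$ and to each $w_j$, exactly one edge from each $u_j$ and from each $w_j$ to $v$, and no other edges (the factorization rules are arbitrary). Give the infinite path space $\Lambda^\infty$ the topology generated by the cylinder sets $Z(\lambda)=\{x\in\Lambda^\infty : x(0,d(\lambda))=\lambda\}$, and its Borel $\sigma$-algebra. Let $(\delta^j_i)_{i\in\mathbb N}$, $j=1,\dots,N$, be real sequences with $|\delta^j_i|<1$ for all $i,j$ and $\sum_i|\delta^j_i|<\infty$ for all $j$. For a path $\eta$ of degree $(n,n)$, $n \ge 0$, let $Q_0,Q_1,\dots,Q_{2n}$ be the vertices which $\eta$ passes through when it is written, starting from its range, as an alternating string of red and blue edges beginning with a red edge, and put $\alpha_i=\delta^j_i$ if $Q_i=u_j$ and $\alpha_i=-\delta^j_i$ if $Q_i=w_j$. Let $M$ denote the Perron--Frobenius measure on $\Lambda^\infty$, $M(Z(\lambda))=\rho_1^{-d(\lambda)_1}\rho_2^{-d(\lambda)_2}\,\kappa_{s(\lambda)}$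 for all $\lambda\in\Lambda$, where $\rho_i$ is the spectral radius of the vertex matrix $A_i$ and $\kappa$ is the unique positive vector with $\sum_x\kappa_x=1$ and $A_i\kappa=\rho_i\kappa$ for $i=1,2$. The measure $M$ exists and is unique, and the following hold. (1) There is a unique Borel measure $\mu_{2N}$ on $\Lambda^\infty$ such that for all $n\ge 0$ and all $\eta$ of degree $(n,n)$ $$\mu_{2N}(Z(\eta))=\begin{cases}\prod_{i=1}^{n}\frac{1+\alpha_{2i-1}}{2N}, & r(\eta)=v,\\[2pt] \prod_{i=0}^{n}\frac{1+\alpha_{2i}}{2N}, & r(\eta)\neq v,\end{cases}$$ and $\mu_{2N}$ is equivalent to $M$, that is, $\mu_{2N}\ll M\ll\mu_{2N}$. (2) The standard prefixing maps $\sigma_\lambda: Z(s(\lambda))\to \Lambda^\infty$, $x\mapsto\lambda x$, and coding maps $\sigma^n(x)(p,q)=x(p+n,q+n)$ make $(\Lambda^\infty,\mu_{2N})$ into a $\Lambda$-semibranching function system, and likewise $(\Lambda^\infty,M)$. Here a $\Lambda$-semibranching function system on a measure space $(X,\mu)$ consists of measurable sets $D_\lambda\subseteq X$, measurable maps $\tau_\lambda:D_\lambda\to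 X$ ($\lambda\in\Lambda$) with ranges $R_\lambda=\tau_\lambda(D_\lambda)$, and measurable maps $\tau^m:X\to X$ ($m\in\mathbb N^2$) such that: for each $m$, the sets $R_\lambda$ with $d(\lambda)=m$ cover $X$ and are pairwise disjoint up to null sets, and for $d(\lambda)=m$ the Radon--Nikodym derivative $\frac{d(\mu\circ\tau_\lambda)}{d\mu}$ exists and is positive a.e. on $D_\lambda$, and $\tau^m\circ\tau_\lambda=\mathrm{id}_{D_\lambda}$; for each vertex $x$, $\tau_x=\mathrm{id}$ and $\mu(D_x)>0$; if $s(\lambda)=r(\nu)$ then, up to null sets, $R_\nu\subseteq D_\lambda$, $D_{\lambda\nu}=D_\nu$ and $\tau_\lambda\tau_\nu=\tau_{\lambda\nu}$; and $\tau^m\circ\tau^n=\tau^{m+n}$. In (2), $D_\lambda=Z(s(\lambda))$, $\tau_\lambda=\sigma_\lambda$ and $\tau^m=\sigma^m$. $C^*(\Lambda)$ is the universal C*-algebra generated by a Cuntz--Krieger $\Lambda$-family $(t_\lambda)_{\lambda\in\Lambda}$. (3) For $\mu\in\{\mu_{2N},M\}$ there is a unique representation $\pi_\mu$ of $C^*(\Lambda)$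 on $L^2(\Lambda^\infty,\mu)$ with $$\pi_\mu(t_\lambda)\xi(x)=\chi_{Z(\lambda)}(x)\,\Big(\frac{d(\mu\circ\sigma_\lambda)}{d\mu}\big(\sigma^{d(\lambda)}(x)\big)\Big)^{-1/2}\xi\big(\sigma^{d(\lambda)}(x)\big),\qquad \lambda\in\Lambda,$$ where the $t_\lambda$ are the canonical generators of $C^*(\Lambda)$, and $\pi_{\mu_{2N}}$ is unitarily equivalent to $\pi_M$. -/

import Mathlib

open MeasureTheory Set
open scoped ENNReal

noncomputable section

/-! ### Higher-rank graphs -/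

/-- A `k`-graph with vertex set `V` and set of paths (morphisms) `P`: a countable small category,
presented by its arrows, with a degree functor `d` to `ℕᵏ` that has the factorization property.
A path `a` goes from its source `s a` to its range `r a`; the product `a b` is defined when
`s a = r b`, and is written `comp a b h`. -/
structure KGraph (k : ℕ) (V : Type*) (P : Type*) where
  r : P → V
  s : P → V
  d : P → (Fin k → ℕ)
  idp : V → P
  comp : (a b : P) → s a = r b → P
  r_idp : ∀ v, r (idp v) = v
  s_idp : ∀ v, s (idp v) = v
  r_comp : ∀ a b h, r (comp a b h) = r a
  s_comp : ∀ a b h, s (comp a b h) = s b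
  idp_comp : ∀ a, comp (idp (r a)) a (s_idp (r a)) = a
  comp_idp : ∀ a, comp a (idp (s a)) (r_idp (s a)).symm = a
  comp_assoc : ∀ a b c (hab : s a = r b) (hbc : s b = r c),
    comp (comp a b hab) c ((s_comp a b hab).trans hbc)
      = comp a (comp b c hbc) (hab.trans (r_comp b c hbc).symm)
  d_idp : ∀ v, d (idp v) = 0
  d_comp : ∀ a b h, d (comp a b h) = d a + d b
  factorization : ∀ (a : P) (m n : Fin k → ℕ), d a = m + n →
    ∃! bc : P × P, (∃ h : s bc.1 = r bc.2, comp bc.1 bc.2 h = a) ∧ d bc.1 = m ∧ d bc.2 = n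
  countable : Countable P

namespace KGraph

variable {k : ℕ} {V P : Type*} (Λ : KGraph k V P)

theorem exists_factor (a : P) (p : Fin k → ℕ) (hp : p ≤ Λ.d a) :
    ∃ bc : P × P, (∃ h : Λ.s bc.1 = Λ.r bc.2, Λ.comp bc.1 bc.2 h = a) ∧ Λ.d bc.1 = p :=
  let ⟨bc, hbc, _⟩ := Λ.factorization a p (Λ.d a - p) (add_tsub_cancel_of_le hp).symm
  ⟨bc, hbc.1, hbc.2.1⟩

open Classical in
/-- The initial piece `a(0, p)` of degree `p` of a path `a` with `p ≤ d a` (and `a` itself if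
not `p ≤ d a`). -/
def head (a : P) (p : Fin k → ℕ) : P :=
  if hp : p ≤ Λ.d a then (Λ.exists_factor a p hp).choose.1 else a

open Classical in
/-- The remaining piece `a(p, d a)` of a path `a` with `p ≤ d a` (and `a` itself if
not `p ≤ d a`). -/
def tail (a : P) (p : Fin k → ℕ) : P :=
  if hp : p ≤ Λ.d a then (Λ.exists_factor a p hp).choose.2 else a

/-- The vertex `a(p, p)` that the path `a` passes through at position `p ≤ d a`. -/
def vertexAt (a : P) (p : Fin k → ℕ) : V := Λ.s (Λ.head a p)

theorem head_tail (a : P) (p : Fin k → ℕ) (hp : p ≤ Λ.d a) :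
    (∃ h : Λ.s (Λ.head a p) = Λ.r (Λ.tail a p), Λ.comp (Λ.head a p) (Λ.tail a p) h = a) ∧
      Λ.d (Λ.head a p) = p := by
  have := (Λ.exists_factor a p hp).choose_spec
  simpa only [head, tail, dif_pos hp] using this

theorem comp_inj {a b a' b' : P} (h : Λ.s a = Λ.r b) (h' : Λ.s a' = Λ.r b')
    (e : Λ.comp a b h = Λ.comp a' b' h') (hd : Λ.d a = Λ.d a') : a = a' ∧ b = b' := by
  have hdb : Λ.d b = Λ.d b' := by
    have := congrArg Λ.d e
    rw [Λ.d_comp, Λ.d_comp, hd] at this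
    exact add_left_cancel this
  have := (Λ.factorization (Λ.comp a b h) _ _ (Λ.d_comp a b h)).unique
    (y₁ := (a, b)) (y₂ := (a', b')) ⟨⟨h, rfl⟩, rfl, rfl⟩ ⟨⟨h', e.symm⟩, hd.symm, hdb.symm⟩
  exact ⟨congrArg Prod.fst this, congrArg Prod.snd this⟩

theorem tail_comp (a b : P) (h : Λ.s a = Λ.r b) : Λ.tail (Λ.comp a b h) (Λ.d a) = b := by
  obtain ⟨⟨h1, h2⟩, h3⟩ := Λ.head_tail (Λ.comp a b h) (Λ.d a)
    (by rw [Λ.d_comp]; exact le_self_add)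
  exact (Λ.comp_inj h1 h h2 h3).2

theorem head_comp (a b : P) (h : Λ.s a = Λ.r b) : Λ.head (Λ.comp a b h) (Λ.d a) = a := by
  obtain ⟨⟨h1, h2⟩, h3⟩ := Λ.head_tail (Λ.comp a b h) (Λ.d a)
    (by rw [Λ.d_comp]; exact le_self_add)
  exact (Λ.comp_inj h1 h h2 h3).1

theorem comp_congr {a b a' b' : P} (ha : a = a') (hb : b = b') (h : Λ.s a = Λ.r b)
    (h' : Λ.s a' = Λ.r b') : Λ.comp a b h = Λ.comp a' b' h' := by
  subst ha hb; rfl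

theorem eq_idp {a : P} (h : Λ.d a = 0) : a = Λ.idp (Λ.r a) :=
  (Λ.comp_inj (Λ.r_idp _).symm (Λ.s_idp _)
    ((Λ.comp_idp a).trans (Λ.idp_comp a).symm) (h.trans (Λ.d_idp _).symm)).1

/-! ### Infinite paths -/

/-- An infinite path in `Λ`: a degree-preserving functor from `Ωₖ` to `Λ`, where `Ωₖ` has object
set `ℕᵏ` and exactly one morphism `(p, q)`, with range `p`, source `q` and degree `q - p`, for each
pair `p ≤ q`. -/
@[ext]
structure InfPath where
  obj : (Fin k → ℕ) → V
  map : (p q : Fin k → ℕ) → p ≤ q → P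
  r_map : ∀ p q h, Λ.r (map p q h) = obj p
  s_map : ∀ p q h, Λ.s (map p q h) = obj q
  d_map : ∀ p q h, Λ.d (map p q h) = q - p
  map_self : ∀ p, map p p le_rfl = Λ.idp (obj p)
  map_comp : ∀ p q m (h : p ≤ q) (h' : q ≤ m),
    Λ.comp (map p q h) (map q m h') ((s_map p q h).trans (r_map q m h').symm)
      = map p m (h.trans h')

variable {Λ}

/-- The shift `σᵐ`, `σᵐ(x)(p, q) = x(p + m, q + m)`. -/
def InfPath.shift (m : Fin k → ℕ) (x : Λ.InfPath) : Λ.InfPath where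
  obj p := x.obj (p + m)
  map p q h := x.map (p + m) (q + m) (add_le_add_left h m)
  r_map _ _ _ := x.r_map _ _ _
  s_map _ _ _ := x.s_map _ _ _
  d_map p q h := by rw [x.d_map, add_tsub_add_eq_tsub_right]
  map_self _ := x.map_self _
  map_comp _ _ _ _ _ := x.map_comp _ _ _ _ _

/-- The infinite path with initial pieces `I q`, `q ∈ ℕᵏ`. -/
def InfPath.ofHeads (I : (Fin k → ℕ) → P) (hd : ∀ q, Λ.d (I q) = q)
    (hI : ∀ p q, p ≤ q → ∃ c, ∃ h : Λ.s (I p) = Λ.r c, Λ.comp (I p) c h = I q) :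
    Λ.InfPath :=
  have key : ∀ p q, p ≤ q → ∃ h : Λ.s (I p) = Λ.r (Λ.tail (I q) p),
      Λ.comp (I p) (Λ.tail (I q) p) h = I q := by
    intro p q hpq
    obtain ⟨c, h, e⟩ := hI p q hpq
    have : Λ.tail (I q) p = c := by
      have := Λ.tail_comp (I p) c h
      rwa [e, hd] at this
    rw [this]; exact ⟨h, e⟩
  { obj := fun p => Λ.s (I p)
    map := fun p q _ => Λ.tail (I q) p
    r_map := fun p q h => (key p q h).1.symm
    s_map := fun p q h => by
      obtain ⟨h1, h2⟩ := key p q h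
      rw [← Λ.s_comp _ _ h1, h2]
    d_map := fun p q h => by
      obtain ⟨h1, h2⟩ := key p q h
      have := congrArg Λ.d h2
      rw [Λ.d_comp, hd, hd] at this
      exact eq_tsub_of_add_eq ((add_comm _ _).trans this)
    map_self := fun p => by
      have := Λ.tail_comp (I p) (Λ.idp (Λ.s (I p))) (Λ.r_idp _).symm
      rwa [Λ.comp_idp, hd] at this
    map_comp := fun p q m h h' => by
      obtain ⟨h1, e1⟩ := key p q h
      obtain ⟨h2, e2⟩ := key q m h'
      obtain ⟨h3, e3⟩ := key p m (h.trans h')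
      have hs : Λ.s (Λ.tail (I q) p) = Λ.r (Λ.tail (I m) q) := by
        rw [← Λ.s_comp _ _ h1, e1]; exact h2
      refine (Λ.comp_inj (h1.trans (Λ.r_comp _ _ hs).symm) h3 ?_ rfl).2
      rw [← Λ.comp_assoc _ _ _ h1 hs, e3]
      exact (Λ.comp_congr e1 rfl _ h2).trans e2 }

/-- The infinite path `λ x`, for a path `λ` and an infinite path `x` with range `s(λ)`: its
initial piece of degree `q` is that of the finite path `λ x(0, q)`. -/
def InfPath.cons (a : P) (x : Λ.InfPath) (hx : x.obj 0 = Λ.s a) : Λ.InfPath :=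
  InfPath.ofHeads
    (fun q => Λ.head (Λ.comp a (x.map 0 q zero_le) ((x.r_map _ _ _).trans hx).symm) q)
    (fun q => (Λ.head_tail _ q (by
      rw [Λ.d_comp, x.d_map, tsub_zero]; exact le_add_self)).2)
    (by
      intro p q hpq
      have hA : ∀ q, Λ.s a = Λ.r (x.map 0 q zero_le) :=
        fun q => ((x.r_map _ _ _).trans hx).symm
      have hle : ∀ q, q ≤ Λ.d (Λ.comp a (x.map 0 q zero_le) (hA q)) := fun q => by
        rw [Λ.d_comp, x.d_map, tsub_zero]; exact le_add_self
      change ∃ c, ∃ h : Λ.s (Λ.head (Λ.comp a (x.map 0 p zero_le) (hA p)) p) = Λ.r c,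
        Λ.comp _ c h = Λ.head (Λ.comp a (x.map 0 q zero_le) (hA q)) q
      have hm := x.map_comp 0 p q zero_le hpq
      obtain ⟨⟨u1, u2⟩, u3⟩ := Λ.head_tail _ p (hle p)
      obtain ⟨⟨w1, w2⟩, w3⟩ := Λ.head_tail _ q (hle q)
      obtain ⟨⟨z1, z2⟩, z3⟩ := Λ.head_tail
        (Λ.head (Λ.comp a (x.map 0 q zero_le) (hA q)) q) p (by rw [w3]; exact hpq)
      generalize hI : Λ.head (Λ.comp a (x.map 0 q zero_le) (hA q)) q = Iq at *
      generalize hT : Λ.tail (Λ.comp a (x.map 0 q zero_le) (hA q)) q = Tq at *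
      generalize hJ : Λ.head (Λ.comp a (x.map 0 p zero_le) (hA p)) p = Ip at *
      generalize hU : Λ.tail (Λ.comp a (x.map 0 p zero_le) (hA p)) p = Tp at *
      have hs : Λ.s (x.map 0 p zero_le) = Λ.r (x.map p q hpq) :=
        (x.s_map _ _ _).trans (x.r_map _ _ _).symm
      have hs2 : Λ.s Tp = Λ.r (x.map p q hpq) := by
        rw [← Λ.s_comp _ _ u1, u2, Λ.s_comp]; exact hs
      have hs3 : Λ.s (Λ.tail Iq p) = Λ.r Tq := by
        rw [← Λ.s_comp _ _ z1, z2]; exact w1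
      have e1 : Λ.comp Ip (Λ.comp Tp (x.map p q hpq) hs2) (u1.trans (Λ.r_comp _ _ hs2).symm)
          = Λ.comp a (x.map 0 q zero_le) (hA q) := by
        rw [← Λ.comp_assoc _ _ _ u1 hs2]
        refine (Λ.comp_congr u2 rfl _ ((Λ.s_comp _ _ _).trans hs)).trans ?_
        rw [Λ.comp_assoc _ _ _ (hA p) hs]
        exact Λ.comp_congr rfl hm _ _
      have e2 : Λ.comp (Λ.head Iq p) (Λ.comp (Λ.tail Iq p) Tq hs3)
          (z1.trans (Λ.r_comp _ _ hs3).symm)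
          = Λ.comp a (x.map 0 q zero_le) (hA q) := by
        rw [← Λ.comp_assoc _ _ _ z1 hs3]
        exact (Λ.comp_congr z2 rfl _ w1).trans w2
      have e3 := (Λ.comp_inj _ _ (e1.trans e2.symm) (u3.trans z3.symm)).1
      rw [e3]
      exact ⟨_, z1, z2⟩)

/-- The initial piece of `λ x` of degree `d(λ)` is `λ`. -/
theorem InfPath.cons_map (a : P) (x : Λ.InfPath) (hx : x.obj 0 = Λ.s a) :
    (x.cons a hx).map 0 (Λ.d a) zero_le = a := by
  have h0 : ∀ b c : P, (∃ h : Λ.s b = Λ.r c, Λ.comp b c h = a) → Λ.d b = 0 → c = a := by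
    rintro b c ⟨h, e⟩ hb
    exact (Λ.comp_inj h (Λ.s_idp _) (e.trans (Λ.idp_comp a).symm) (hb.trans (Λ.d_idp _).symm)).2
  have h1 : Λ.head (Λ.comp a (x.map 0 (Λ.d a) zero_le) ((x.r_map _ _ _).trans hx).symm) (Λ.d a)
      = a := Λ.head_comp _ _ _
  change Λ.tail (Λ.head (Λ.comp a (x.map 0 (Λ.d a) zero_le) _) (Λ.d a)) 0 = a
  rw [h1]
  obtain ⟨h2, h3⟩ := Λ.head_tail a 0 zero_le
  exact h0 _ _ h2 h3

/-- Shifting `λ x` by `d(λ)` gives back `x`. -/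
theorem InfPath.shift_cons (a : P) (x : Λ.InfPath) (hx : x.obj 0 = Λ.s a) :
    (x.cons a hx).shift (Λ.d a) = x := by
  have hA : ∀ q, Λ.s a = Λ.r (x.map 0 q zero_le) := fun q => ((x.r_map _ _ _).trans hx).symm
  have hH : ∀ q, Λ.head (Λ.comp a (x.map 0 (q + Λ.d a) zero_le) (hA _)) (q + Λ.d a)
      = Λ.comp a (x.map 0 q zero_le) (hA q) := by
    intro q
    have hqq : q ≤ q + Λ.d a := le_self_add
    have hs : Λ.s (x.map 0 q zero_le) = Λ.r (x.map q (q + Λ.d a) hqq) :=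
        (x.s_map _ _ _).trans (x.r_map _ _ _).symm
    have e : Λ.comp (Λ.comp a (x.map 0 q zero_le) (hA q)) (x.map q (q + Λ.d a) hqq)
      ((Λ.s_comp _ _ _).trans hs) = Λ.comp a (x.map 0 (q + Λ.d a) zero_le) (hA _) := by
      rw [Λ.comp_assoc _ _ _ (hA q) hs]
      exact Λ.comp_congr rfl (x.map_comp 0 q _ zero_le hqq) _ _
    have := Λ.head_comp (Λ.comp a (x.map 0 q zero_le) (hA q)) (x.map q (q + Λ.d a) hqq) ((Λ.s_comp _ _ _).trans hs)
    rw [e, Λ.d_comp, x.d_map, tsub_zero, add_comm (Λ.d a) q] at this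
    exact this
  have hm : ∀ p q h, ((x.cons a hx).shift (Λ.d a)).map p q h = x.map p q h := by
    intro p q h
    change Λ.tail (Λ.head (Λ.comp a (x.map 0 (q + Λ.d a) zero_le) _) (q + Λ.d a)) (p + Λ.d a) = _
    rw [hH]
    have hs : Λ.s (x.map 0 p zero_le) = Λ.r (x.map p q h) :=
        (x.s_map _ _ _).trans (x.r_map _ _ _).symm
    have e : Λ.comp (Λ.comp a (x.map 0 p zero_le) (hA p)) (x.map p q h)
      ((Λ.s_comp _ _ _).trans hs) = Λ.comp a (x.map 0 q zero_le) (hA _) := by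
      rw [Λ.comp_assoc _ _ _ (hA p) hs]
      exact Λ.comp_congr rfl (x.map_comp 0 p _ zero_le h) _ _
    have := Λ.tail_comp (Λ.comp a (x.map 0 p zero_le) (hA p)) (x.map p q h) ((Λ.s_comp _ _ _).trans hs)
    rw [e, Λ.d_comp, x.d_map, tsub_zero, add_comm] at this
    exact this
  ext p q h
  · rw [← InfPath.r_map _ p p le_rfl, hm, x.r_map]
  · exact hm p q h

variable (Λ)

/-- The cylinder set `Z(λ)` of all infinite paths with initial piece `λ`. -/
def cylinder (a : P) : Set Λ.InfPath := {x | x.map 0 (Λ.d a) zero_le = a}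

/-- The topology of `Λ^∞`, generated by the cylinder sets. -/
instance : TopologicalSpace Λ.InfPath := .generateFrom (range Λ.cylinder)

/-- `Λ^∞` carries its Borel σ-algebra. -/
instance : MeasurableSpace Λ.InfPath := borel _

instance : BorelSpace Λ.InfPath := ⟨rfl⟩

variable {Λ}

theorem InfPath.obj_zero_of_mem {v : V} {x : Λ.InfPath} (hx : x ∈ Λ.cylinder (Λ.idp v)) :
    x.obj 0 = v := by
  have h : x.map 0 (Λ.d (Λ.idp v)) zero_le = Λ.idp v := hx
  rw [← x.r_map 0 _ zero_le, h, Λ.r_idp]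

variable (Λ)

/-- The standard prefixing map `σ_λ : Z(s(λ)) → Λ^∞`, `σ_λ(x) = λ x`. -/
def stdPrefix (a : P) (x : Λ.cylinder (Λ.idp (Λ.s a))) : Λ.InfPath :=
  InfPath.cons a x.1 (InfPath.obj_zero_of_mem x.2)

/-! ### The Perron-Frobenius measure -/

/-- The `i`-th vertex matrix `A_i(v, w) = |v Λ^{e_i} w|` (of a finite `k`-graph). -/
def vertexMatrix (i : Fin k) : Matrix V V ℕ :=
  fun v w => Nat.card {a : P // Λ.d a = Pi.single i 1 ∧ Λ.r a = v ∧ Λ.s a = w}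

/-- `ρ_i`, the spectral radius of the `i`-th vertex matrix. -/
def rho [Fintype V] [DecidableEq V] (i : Fin k) : ℝ :=
  (spectralRadius ℂ ((Λ.vertexMatrix i).map (Nat.cast : ℕ → ℂ))).toReal

/-- `κ` is the unimodular Perron-Frobenius eigenvector of `Λ`. -/
def IsPerronFrobeniusVector [Fintype V] [DecidableEq V] (κ : V → ℝ) : Prop :=
  (∀ v, 0 < κ v) ∧ ∑ v, κ v = 1 ∧
    ∀ i, ((Λ.vertexMatrix i).map (Nat.cast : ℕ → ℝ)).mulVec κ = Λ.rho i • κ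

/-- `M` is the Perron-Frobenius measure on `Λ^∞`: `M(Z(λ)) = ρ(Λ)^{-d(λ)} κ_{s(λ)}` for all
paths `λ`. -/
def IsPerronFrobeniusMeasure [Fintype V] [DecidableEq V] (M : Measure Λ.InfPath) : Prop :=
  ∃ κ : V → ℝ, Λ.IsPerronFrobeniusVector κ ∧
    ∀ a, M (Λ.cylinder a) = ENNReal.ofReal ((∏ i, (Λ.rho i)⁻¹ ^ Λ.d a i) * κ (Λ.s a))

end KGraph

/-! ### Semibranching function systems -/

section Semibranching

variable {X : Type*} [MeasurableSpace X]

/-- The measure `μ ∘ τ` on `X`, `E ↦ μ (τ (E ∩ D))`, for an injective map `τ : D → X` that sends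
measurable sets to measurable sets. -/
def compMeasure (μ : Measure X) (D : Set X) (τ : D → X) : Measure X :=
  (μ.comap τ).map Subtype.val

/-- The Radon-Nikodym derivative `Φ_τ = d(μ ∘ τ)/dμ`. -/
def prefixDeriv (μ : Measure X) (D : Set X) (τ : D → X) : X → ℝ≥0∞ :=
  (compMeasure μ D τ).rnDeriv μ

/-- The family of maps `τ i : D i → X` is a semibranching function system on `(X, μ)`.
The conditions `injective` and `measurableSet_image` say that `μ ∘ τ i` makes sense as a measure,
and `hasDeriv` that it has a Radon-Nikodym derivative. -/
structure IsSemibranching {ι : Type*} (μ : Measure X) (D : ι → Set X) (τ : ∀ i, D i → X) :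
    Prop where
  measurableSet_dom : ∀ i, MeasurableSet (D i)
  measurable : ∀ i, Measurable (τ i)
  injective : ∀ i, Function.Injective (τ i)
  measurableSet_image : ∀ i (E : Set (D i)), MeasurableSet E → MeasurableSet (τ i '' E)
  cover : μ (⋃ i, range (τ i))ᶜ = 0
  disjoint : ∀ i j, i ≠ j → μ (range (τ i) ∩ range (τ j)) = 0
  hasDeriv : ∀ i, compMeasure μ (D i) (τ i) = μ.withDensity (prefixDeriv μ (D i) (τ i))
  deriv_pos : ∀ i, ∀ᵐ x ∂μ, x ∈ D i →
    0 < prefixDeriv μ (D i) (τ i) x ∧ prefixDeriv μ (D i) (τ i) x < ∞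

/-- `T` is a coding map for the family `τ i : D i → X`. -/
def IsCodingMap {ι : Type*} (D : ι → Set X) (τ : ∀ i, D i → X) (T : X → X) : Prop :=
  Measurable T ∧ ∀ i (x : D i), T (τ i x) = x

variable {k : ℕ} {V P : Type*}

/-- The sets `D a`, prefixing maps `τ a : D a → X` (for the paths `a` of `Λ`) and coding maps `T m`
(for `m ∈ ℕᵏ`) form a `Λ`-semibranching function system on `(X, μ)`. -/
structure IsLambdaSemibranching (Λ : KGraph k V P) (μ : Measure X) (D : P → Set X)
    (τ : ∀ a, D a → X) (T : (Fin k → ℕ) → X → X) : Prop where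
  semibranching : ∀ m : Fin k → ℕ,
    IsSemibranching μ (fun a : {a : P // Λ.d a = m} => D a) (fun a => τ a)
  coding : ∀ m : Fin k → ℕ,
    IsCodingMap (fun a : {a : P // Λ.d a = m} => D a) (fun a => τ a) (T m)
  vertex_id : ∀ v (x : D (Λ.idp v)), τ (Λ.idp v) x = x
  vertex_pos : ∀ v, 0 < μ (D (Λ.idp v))
  range_subset : ∀ a b, Λ.s a = Λ.r b → μ (range (τ b) \ D a) = 0
  dom_comp : ∀ a b (h : Λ.s a = Λ.r b), D (Λ.comp a b h) =ᵐ[μ] D b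
  prefix_comp : ∀ a b (h : Λ.s a = Λ.r b), ∀ᵐ x ∂μ, ∀ hx : x ∈ D b,
    ∃ (h₁ : τ b ⟨x, hx⟩ ∈ D a) (h₂ : x ∈ D (Λ.comp a b h)),
      τ a ⟨τ b ⟨x, hx⟩, h₁⟩ = τ (Λ.comp a b h) ⟨x, h₂⟩
  coding_add : ∀ m n, T m ∘ T n = T (m + n)

end Semibranching

/-! ### The C*-algebra of a higher-rank graph -/

namespace KGraph

variable {k : ℕ} {V : Type*} {P : Type*} (Λ : KGraph k V P)

/-- Cuntz-Krieger `Λ`-families in a C*-algebra, for a row-finite `k`-graph `Λ` with no sources. -/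
structure IsCuntzKrieger {B : Type*} [NonUnitalCStarAlgebra B] (t : P → B) : Prop where
  partial_isometry : ∀ a, t a * star (t a) * t a = t a
  ck1_proj : ∀ v, IsStarProjection (t (Λ.idp v))
  ck1_orth : ∀ v w, v ≠ w → t (Λ.idp v) * t (Λ.idp w) = 0
  ck2 : ∀ a b (h : Λ.s a = Λ.r b), t a * t b = t (Λ.comp a b h)
  ck3 : ∀ a, star (t a) * t a = t (Λ.idp (Λ.s a))
  /-- Here `F` is the (finite) set `v Λⁿ`. -/
  ck4 : ∀ (v : V) (n : Fin k → ℕ) (F : Finset P), (∀ a, a ∈ F ↔ Λ.r a = v ∧ Λ.d a = n) →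
    t (Λ.idp v) = ∑ a ∈ F, t a * star (t a)

end KGraph

universe u v

/-- A Cuntz-Krieger `Λ`-family together with the C*-algebra in which it lives. -/
structure CKFamily {k : ℕ} {V : Type v} {P : Type u} (Λ : KGraph k V P) : Type (max (u + 1) v) where
  alg : Type u
  [cstar : NonUnitalCStarAlgebra alg]
  t : P → alg
  isCK : Λ.IsCuntzKrieger t

attribute [instance] CKFamily.cstar

namespace KGraph

variable {k : ℕ} {V : Type v} {P : Type u} (Λ : KGraph k V P)

theorem IsCuntzKrieger.norm_le_one {Λ : KGraph k V P} {B : Type*} [NonUnitalCStarAlgebra B]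
    {t : P → B} (ht : Λ.IsCuntzKrieger t) (a : P) : ‖t a‖ ≤ 1 := by
  have h1 : ‖star (t a) * t a‖ ≤ 1 := by
    rw [ht.ck3]
    have hp := ht.ck1_proj (Λ.s a)
    have : ‖t (Λ.idp (Λ.s a))‖ * ‖t (Λ.idp (Λ.s a))‖ = ‖t (Λ.idp (Λ.s a))‖ := by
      rw [← CStarRing.norm_star_mul_self, hp.isSelfAdjoint.star_eq, hp.isIdempotentElem.eq]
    nlinarith [norm_nonneg (t (Λ.idp (Λ.s a)))]
  rw [CStarRing.norm_star_mul_self] at h1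
  nlinarith [norm_nonneg (t a)]

/-- The family `λ ↦ (t_λ)_t` in the `ℓ^∞`-product over all Cuntz-Krieger families `t`. -/
def productFamily (a : P) : lp (fun F : CKFamily Λ => F.alg) ∞ :=
  ⟨fun F => F.t a, memℓp_infty ⟨1, by rintro _ ⟨F, rfl⟩; exact F.isCK.norm_le_one a⟩⟩

/-- `C*(Λ)`, the universal C*-algebra generated by a Cuntz-Krieger `Λ`-family, realised as the
C*-algebra generated by the product of all Cuntz-Krieger families. -/
def cstar : NonUnitalStarSubalgebra ℂ (lp (fun F : CKFamily Λ => F.alg) ∞) :=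
  (NonUnitalStarAlgebra.adjoin ℂ (range Λ.productFamily)).topologicalClosure

instance : IsClosed (Λ.cstar : Set (lp (fun F : CKFamily Λ => F.alg) ∞)) :=
  NonUnitalStarSubalgebra.isClosed_topologicalClosure _

/-- The canonical generators `t_λ` of `C*(Λ)`. -/
def gen (a : P) : Λ.cstar :=
  ⟨Λ.productFamily a, NonUnitalStarSubalgebra.le_topologicalClosure _
    (NonUnitalStarAlgebra.subset_adjoin ℂ _ ⟨a, rfl⟩)⟩

/-- The coordinate projections of the product. -/
def evalFamily (F : CKFamily Λ) : lp (fun F : CKFamily Λ => F.alg) ∞ →⋆ₙₐ[ℂ] F.alg where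
  toFun c := c F
  map_smul' _ _ := rfl
  map_zero' := rfl
  map_add' _ _ := rfl
  map_mul' _ _ := rfl
  map_star' _ := rfl

/-- The generators of `C*(Λ)` form a Cuntz-Krieger family. -/
theorem isCuntzKrieger_gen : Λ.IsCuntzKrieger Λ.gen where
  partial_isometry a := Subtype.ext <| lp.ext <| funext fun F => F.isCK.partial_isometry a
  ck1_proj v := ⟨Subtype.ext <| lp.ext <| funext fun F => (F.isCK.ck1_proj v).isIdempotentElem,
    Subtype.ext <| lp.ext <| funext fun F => (F.isCK.ck1_proj v).isSelfAdjoint⟩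
  ck1_orth v w h := Subtype.ext <| lp.ext <| funext fun F => F.isCK.ck1_orth v w h
  ck2 a b h := Subtype.ext <| lp.ext <| funext fun F => F.isCK.ck2 a b h
  ck3 a := Subtype.ext <| lp.ext <| funext fun F => F.isCK.ck3 a
  ck4 v n S hS := Subtype.ext <| lp.ext <| funext fun F => by
    have h := F.isCK.ck4 v n S hS
    have e := map_sum ((Λ.evalFamily F).comp (NonUnitalStarSubalgebraClass.subtype Λ.cstar))
      (fun a => Λ.gen a * star (Λ.gen a)) S
    exact h.trans e.symm

/-- The universal property of `C*(Λ)`. -/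
theorem existsUnique_lift {B : Type u} [NonUnitalCStarAlgebra B] {t : P → B}
    (ht : Λ.IsCuntzKrieger t) : ∃! π : Λ.cstar →⋆ₙₐ[ℂ] B, ∀ a, π (Λ.gen a) = t a := by
  refine ⟨(Λ.evalFamily ⟨B, t, ht⟩).comp (NonUnitalStarSubalgebraClass.subtype Λ.cstar),
    fun a => rfl, fun π hπ => ?_⟩
  set π' := (Λ.evalFamily ⟨B, t, ht⟩).comp (NonUnitalStarSubalgebraClass.subtype Λ.cstar)
  have h1 : ∀ x (_ : x ∈ NonUnitalStarAlgebra.adjoin ℂ (range Λ.productFamily))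
      (h : x ∈ Λ.cstar), π ⟨x, h⟩ = π' ⟨x, h⟩ := by
    have hle := NonUnitalStarSubalgebra.le_topologicalClosure
      (NonUnitalStarAlgebra.adjoin ℂ (range Λ.productFamily))
    intro x hx
    induction hx using NonUnitalStarAlgebra.adjoin_induction with
    | mem x hx => obtain ⟨a, rfl⟩ := hx; exact fun _ => hπ a
    | add x y hx hy ihx ihy =>
      intro _
      have := congrArg₂ (· + ·) (ihx (hle hx)) (ihy (hle hy))
      simp only [← map_add] at this
      exact this
    | zero => exact fun _ => (map_zero π).trans (map_zero π').symm
    | mul x y hx hy ihx ihy =>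
      intro _
      have := congrArg₂ (· * ·) (ihx (hle hx)) (ihy (hle hy))
      simp only [← map_mul] at this
      exact this
    | smul r x hx ih =>
      intro _
      have := congrArg (r • ·) (ih (hle hx))
      simp only [← map_smul] at this
      exact this
    | star x hx ih =>
      intro _
      have := congrArg star (ih (hle hx))
      simp only [← map_star] at this
      exact this
  ext c
  obtain ⟨y, hy, hlim⟩ := mem_closure_iff_seq_limit.1 (show c.1 ∈ closure _ from c.2)
  have hy' : ∀ n, y n ∈ Λ.cstar := fun n => subset_closure (hy n)
  have hl : Filter.Tendsto (fun n => (⟨y n, hy' n⟩ : Λ.cstar)) Filter.atTop (nhds c) :=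
    tendsto_subtype_rng.2 hlim
  have hc : ∀ φ : Λ.cstar →⋆ₙₐ[ℂ] B, Continuous φ := fun φ =>
    AddMonoidHomClass.continuous_of_bound φ 1 fun z => by
      rw [one_mul]; exact NonUnitalStarAlgHom.norm_apply_le φ z
  have c1 := ((hc π).tendsto c).comp hl
  have c2 := ((hc π').tendsto c).comp hl
  refine tendsto_nhds_unique c1 (c2.congr fun n => (h1 _ (hy n) _).symm)

end KGraph

/-! ### Semibranching representations -/

section Representation

variable {k : ℕ} {V : Type v} {P : Type u} {X : Type*} [MeasurableSpace X]

/-- `π` is the representation of `C*(Λ)` on `L²(X, μ)` associated to a `Λ`-semibranching function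
system: `S_λ = π(t_λ)` is given by
`S_λ ξ (x) = χ_{R_λ}(x) Φ_{τ_λ}(τ^{d(λ)}(x))^{-1/2} ξ(τ^{d(λ)}(x))`. -/
def IsSemibranchingRep (Λ : KGraph k V P) (μ : Measure X) (D : P → Set X)
    (τ : ∀ a, D a → X) (T : (Fin k → ℕ) → X → X)
    (π : Λ.cstar →⋆ₙₐ[ℂ] (Lp ℂ 2 μ →L[ℂ] Lp ℂ 2 μ)) : Prop :=
  ∀ (a : P) (ξ : Lp ℂ 2 μ), π (Λ.gen a) ξ =ᵐ[μ] (range (τ a)).indicator fun x =>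
    ((prefixDeriv μ (D a) (τ a) (T (Λ.d a) x)).toReal ^ (-(1 / 2 : ℝ)) : ℝ) • ξ (T (Λ.d a) x)

/-- Unitary equivalence of two representations of `C*(Λ)`. -/
def UnitarilyEquivalent {Λ : KGraph k V P} {H K : Type*}
    [NormedAddCommGroup H] [InnerProductSpace ℂ H] [CompleteSpace H]
    [NormedAddCommGroup K] [InnerProductSpace ℂ K] [CompleteSpace K]
    (π : Λ.cstar →⋆ₙₐ[ℂ] (H →L[ℂ] H)) (ρ : Λ.cstar →⋆ₙₐ[ℂ] (K →L[ℂ] K)) : Prop :=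
  ∃ U : H ≃ₗᵢ[ℂ] K, ∀ c ξ, U (π c ξ) = ρ c (U ξ)

end Representation

namespace KGraph

variable {k : ℕ} {V : Type v} {P : Type u} (Λ : KGraph k V P)

/-- The standard prefixing and coding maps make `(Λ^∞, μ)` a `Λ`-semibranching function system. -/
def StandardSemibranching (μ : Measure Λ.InfPath) : Prop :=
  IsLambdaSemibranching Λ μ (fun a => Λ.cylinder (Λ.idp (Λ.s a))) Λ.stdPrefix InfPath.shift

/-- `π` is the `Λ`-semibranching representation of `C*(Λ)` on `L²(Λ^∞, μ)` that is associated to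
the standard prefixing and coding maps. -/
def IsStandardRep (μ : Measure Λ.InfPath)
    (π : Λ.cstar →⋆ₙₐ[ℂ] (Lp ℂ 2 μ →L[ℂ] Lp ℂ 2 μ)) : Prop :=
  IsSemibranchingRep Λ μ (fun a => Λ.cylinder (Λ.idp (Λ.s a))) Λ.stdPrefix InfPath.shift π

end KGraph

/-! ### The 2-graphs `Λ_{2N}` and the product measures -/

/-- The vertices `v, u_1, …, u_N, w_1, …, w_N`. -/
inductive StarVertex (N : ℕ) : Type
  | v : StarVertex N
  | u : Fin N → StarVertex N
  | w : Fin N → StarVertex N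
  deriving DecidableEq, Fintype

/-- `Λ` is a 2-graph `Λ_{2N}` (for some choice of factorization rules): in each of the two colours
there is exactly one edge from `v` to each `u_i` and each `w_i`, exactly one edge back, and no
other edge. -/
def IsLambda2N {N : ℕ} {P : Type u} (Λ : KGraph 2 (StarVertex N) P) : Prop :=
  ∀ (i : Fin 2) (a b : StarVertex N),
    (Xor (a = .v) (b = .v) → ∃! e : P, Λ.d e = Pi.single i 1 ∧ Λ.r e = a ∧ Λ.s e = b) ∧
    ((∃ e : P, Λ.d e = Pi.single i 1 ∧ Λ.r e = a ∧ Λ.s e = b) → Xor (a = .v) (b = .v))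

/-- The position reached after `l` edges of an alternating red-blue string of edges that starts
with a red edge; blue is the colour `0` and red is the colour `1`. -/
def altPos (l : ℕ) : Fin 2 → ℕ := ![l / 2, (l + 1) / 2]

/-- `α_i = δ^j_i` if `Q_i = u_j` and `α_i = -δ^j_i` if `Q_i = w_j` (and, immaterially, `0` at
the vertex `v`). -/
def alphaAt {N : ℕ} (δ : Fin N → ℕ → ℝ) (i : ℕ) : StarVertex N → ℝ
  | .v => 0
  | .u j => δ j i
  | .w j => -δ j i

/-- The number assigned to `Z(η)`, where `d(η) = (n, n)` and `η` passes through the vertices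
`Q_0, Q_1, …, Q_{2n}`. -/
def productWeight {N : ℕ} {P : Type u} (Λ : KGraph 2 (StarVertex N) P) (δ : Fin N → ℕ → ℝ)
    (n : ℕ) (η : P) : ℝ :=
  if Λ.r η = .v then
    ∏ i ∈ Finset.Icc 1 n,
      (1 + alphaAt δ (2 * i - 1) (Λ.vertexAt η (altPos (2 * i - 1)))) / (2 * N)
  else
    ∏ i ∈ Finset.Icc 0 n, (1 + alphaAt δ (2 * i) (Λ.vertexAt η (altPos (2 * i)))) / (2 * N)

/-- `μ` is the product measure `μ_{2N}` associated to the sequences `δ`. -/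
def IsProductMeasure {N : ℕ} {P : Type u} (Λ : KGraph 2 (StarVertex N) P) (δ : Fin N → ℕ → ℝ)
    (μ : Measure Λ.InfPath) : Prop :=
  ∀ (n : ℕ) (η : P), Λ.d η = (fun _ => n) →
    μ (Λ.cylinder η) = ENNReal.ofReal (productWeight Λ δ n η)

end

/-!
An infinite path of `Λ_{2N}`, read as an alternating string of red and blue edges, is determined by
the vertices it passes through, and these form a walk on a star: every second vertex is `v`, and
the remaining ones are arbitrary. So `Λ_{2N}^∞` is two copies, one for each parity, of a space of
sequences in the set of the `2N` outer vertices, and on each copy `μ_{2N}` and `M` are images of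
infinite product measures, `M` of the uniform one up to a constant factor. The densities of the
factors lie within `1 ± max_j |δ^j_i|`, which is summable in `i`, so the product of the densities
converges and bounds each product measure by a multiple of the other.

Prefixing by `λ` multiplies the `M`-measure of a cylinder by `ρ(Λ)^{-d(λ)}`, so its Radon-Nikodym
derivative is a positive constant and `M` makes `Λ_{2N}^∞` a semibranching function system. That
property passes to equivalent measures, by the chain rule for Radon-Nikodym derivatives, and so
does the representation: multiplication by `(dμ/dM)^{1/2}` is the intertwining unitary.
-/

noncomputable section

open scoped NNReal

/-! ### Weighted composition operators -/

section WeightedComposition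

variable {X Y Z : Type*} [MeasurableSpace X] [MeasurableSpace Y] [MeasurableSpace Z]

/-- The condition on the weight `w` and the map `φ` under which the weighted composition operator
`ξ ↦ w · (ξ ∘ φ)` is a well-defined contraction from `L²(ν₁)` to `L²(ν₂)`. -/
structure IsContractiveWeight (ν₁ : Measure Y) (ν₂ : Measure X) (w : X → ℝ≥0) (φ : X → Y) :
    Prop where
  measurable_weight : Measurable w
  measurable_map : Measurable φ
  map_withDensity_le : (ν₂.withDensity fun x => (w x : ℝ≥0∞) ^ 2).map φ ≤ ν₁

namespace IsContractiveWeight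

variable {ν₁ : Measure Y} {ν₂ : Measure X} {w : X → ℝ≥0} {φ : X → Y}
  (H : IsContractiveWeight ν₁ ν₂ w φ)

include H

theorem measurable_weight_sq : Measurable fun x => (w x : ℝ≥0∞) ^ 2 :=
  H.measurable_weight.coe_nnreal_ennreal.pow_const 2

theorem ae_comp {p : Y → Prop} (hp : ∀ᵐ y ∂ν₁, p y) : ∀ᵐ x ∂ν₂, w x ≠ 0 → p (φ x) := by
  have hmap := ae_of_ae_map H.measurable_map.aemeasurable
    ((Measure.absolutelyContinuous_of_le H.map_withDensity_le).ae_le hp)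
  rw [ae_withDensity_iff H.measurable_weight_sq] at hmap
  filter_upwards [hmap] with x hx hw
  exact hx (by simpa using hw)

theorem eLpNorm_smul_comp_le {f : Y → ℂ} (hf : StronglyMeasurable f) :
    eLpNorm (fun x => (w x : ℝ) • f (φ x)) 2 ν₂ ≤ eLpNorm f 2 ν₁ := by
  rw [eLpNorm_eq_lintegral_rpow_enorm_toReal two_ne_zero ENNReal.ofNat_ne_top,
    eLpNorm_eq_lintegral_rpow_enorm_toReal two_ne_zero ENNReal.ofNat_ne_top]
  refine ENNReal.rpow_le_rpow ?_ (by positivity)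
  simp only [ENNReal.toReal_ofNat, ENNReal.rpow_ofNat]
  have hm : Measurable fun y => ‖f y‖ₑ ^ 2 := hf.measurable.enorm.pow_const 2
  calc ∫⁻ x, ‖(w x : ℝ) • f (φ x)‖ₑ ^ 2 ∂ν₂
      = ∫⁻ x, ((w x : ℝ≥0∞) ^ 2) * ‖f (φ x)‖ₑ ^ 2 ∂ν₂ := by
        refine lintegral_congr fun x => ?_
        rw [enorm_smul, mul_pow, Real.enorm_of_nonneg (w x).coe_nonneg, ENNReal.ofReal_coe_nnreal]
    _ = ∫⁻ y, ‖f y‖ₑ ^ 2 ∂((ν₂.withDensity fun x => (w x : ℝ≥0∞) ^ 2).map φ) := by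
        rw [lintegral_map hm H.measurable_map]
        exact (lintegral_withDensity_eq_lintegral_mul _ H.measurable_weight_sq
          (hm.comp H.measurable_map)).symm
    _ ≤ ∫⁻ y, ‖f y‖ₑ ^ 2 ∂ν₁ := lintegral_mono' H.map_withDensity_le le_rfl

theorem memLp (ξ : Lp ℂ 2 ν₁) : MemLp (fun x => (w x : ℝ) • ξ (φ x)) 2 ν₂ :=
  ⟨(H.measurable_weight.coe_nnreal_real.stronglyMeasurable.smul
      ((Lp.stronglyMeasurable ξ).comp_measurable H.measurable_map)).aestronglyMeasurable,
    (H.eLpNorm_smul_comp_le (Lp.stronglyMeasurable ξ)).trans_lt (Lp.memLp ξ).2⟩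

/-- The weighted composition operator `ξ ↦ w · (ξ ∘ φ)`. -/
def op : Lp ℂ 2 ν₁ →L[ℂ] Lp ℂ 2 ν₂ :=
  LinearMap.mkContinuous
    { toFun := fun ξ => (H.memLp ξ).toLp _
      map_add' := fun ξ η => by
        refine Lp.ext ?_
        filter_upwards [(H.memLp (ξ + η)).coeFn_toLp, Lp.coeFn_add ((H.memLp ξ).toLp _)
          ((H.memLp η).toLp _), (H.memLp ξ).coeFn_toLp, (H.memLp η).coeFn_toLp,
          H.ae_comp (Lp.coeFn_add ξ η)] with x h1 h2 h3 h4 h5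
        rw [h1, h2, Pi.add_apply, h3, h4]
        rcases eq_or_ne (w x) 0 with h | h
        · simp [h]
        · rw [h5 h, Pi.add_apply, smul_add]
      map_smul' := fun c ξ => by
        refine Lp.ext ?_
        filter_upwards [(H.memLp (c • ξ)).coeFn_toLp, Lp.coeFn_smul c ((H.memLp ξ).toLp _),
          (H.memLp ξ).coeFn_toLp, H.ae_comp (Lp.coeFn_smul c ξ)] with x h1 h2 h3 h4
        rw [h1, RingHom.id_apply, h2, Pi.smul_apply, h3]
        rcases eq_or_ne (w x) 0 with h | h
        · simp [h]
        · rw [h4 h, Pi.smul_apply, smul_comm] }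
    1 fun ξ => by
      rw [one_mul]
      change ‖(H.memLp ξ).toLp _‖ ≤ _
      rw [Lp.norm_toLp, Lp.norm_def]
      exact ENNReal.toReal_mono (Lp.memLp ξ).2.ne
        (H.eLpNorm_smul_comp_le (Lp.stronglyMeasurable ξ))

theorem coeFn_op (ξ : Lp ℂ 2 ν₁) : H.op ξ =ᵐ[ν₂] fun x => (w x : ℝ) • ξ (φ x) :=
  (H.memLp ξ).coeFn_toLp

theorem norm_op_le : ‖H.op‖ ≤ 1 :=
  LinearMap.mkContinuous_norm_le _ zero_le_one _

variable {ν₃ : Measure Z} {w' : Y → ℝ≥0} {ψ : Y → Z} (H' : IsContractiveWeight ν₃ ν₁ w' ψ)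

theorem coeFn_op_op (ξ : Lp ℂ 2 ν₃) :
    H.op (H'.op ξ) =ᵐ[ν₂] fun x => ((w x * w' (φ x) : ℝ≥0) : ℝ) • ξ (ψ (φ x)) := by
  filter_upwards [H.coeFn_op (H'.op ξ), H.ae_comp (H'.coeFn_op ξ)] with x hx hφx
  rw [hx, NNReal.coe_mul, mul_smul]
  rcases eq_or_ne (w x) 0 with h | h
  · simp [h]
  · rw [hφx h]

theorem op_comp_op {w'' : X → ℝ≥0} {φ'' : X → Z} (H'' : IsContractiveWeight ν₃ ν₂ w'' φ'')
    (hw : ∀ᵐ x ∂ν₂, w x * w' (φ x) = w'' x) (hφ : ∀ᵐ x ∂ν₂, w'' x ≠ 0 → ψ (φ x) = φ'' x) :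
    H.op ∘L H'.op = H''.op := by
  ext1 ξ
  refine Lp.ext ?_
  filter_upwards [H.coeFn_op_op H' ξ, H''.coeFn_op ξ, hw, hφ] with x hx hx'' hwx hφx
  rw [ContinuousLinearMap.comp_apply, hx, hx'', hwx]
  rcases eq_or_ne (w'' x) 0 with h | h
  · simp [h]
  · rw [hφx h]

end IsContractiveWeight

theorem isContractiveWeight_indicator (ν : Measure X) {A : Set X} (hA : MeasurableSet A) :
    IsContractiveWeight ν ν (A.indicator 1) id where
  measurable_weight := measurable_one.indicator hA
  measurable_map := measurable_id
  map_withDensity_le := by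
    have hsq : (fun x => ((A.indicator 1 x : ℝ≥0) : ℝ≥0∞) ^ 2) = A.indicator 1 := by
      ext x
      by_cases hx : x ∈ A <;> simp [hx]
    rw [Measure.map_id, hsq, withDensity_indicator_one hA]
    exact Measure.restrict_le_self

/-- Multiplication by the indicator function of `A`, as an operator on `L²(ν)`. -/
def indicatorOp (ν : Measure X) {A : Set X} (hA : MeasurableSet A) : Lp ℂ 2 ν →L[ℂ] Lp ℂ 2 ν :=
  (isContractiveWeight_indicator ν hA).op

theorem coeFn_indicatorOp (ν : Measure X) {A : Set X} (hA : MeasurableSet A) (ξ : Lp ℂ 2 ν) :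
    indicatorOp ν hA ξ =ᵐ[ν] A.indicator ξ := by
  filter_upwards [(isContractiveWeight_indicator ν hA).coeFn_op ξ] with x hx
  rw [indicatorOp, hx]
  by_cases h : x ∈ A <;> simp [h]

theorem indicatorOp_congr {ν : Measure X} {A B : Set X} (hA : MeasurableSet A)
    (hB : MeasurableSet B) (h : A =ᵐ[ν] B) : indicatorOp ν hA = indicatorOp ν hB := by
  ext1 ξ
  exact Lp.ext ((coeFn_indicatorOp ν hA ξ).trans
    ((indicator_ae_eq_of_ae_eq_set h).trans (coeFn_indicatorOp ν hB ξ).symm))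

theorem indicatorOp_mul_indicatorOp (ν : Measure X) {A B : Set X} (hA : MeasurableSet A)
    (hB : MeasurableSet B) :
    indicatorOp ν hA * indicatorOp ν hB = indicatorOp ν (hA.inter hB) :=
  IsContractiveWeight.op_comp_op _ _ _
    (.of_forall fun x => (congrFun inter_indicator_one x).symm)
    (.of_forall fun _ _ => rfl)

theorem indicatorOp_eq_zero {ν : Measure X} {A : Set X} (hA : MeasurableSet A) (h : ν A = 0) :
    indicatorOp ν hA = 0 := by
  ext1 ξ
  refine Lp.ext ((coeFn_indicatorOp ν hA ξ).trans ?_)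
  refine (indicator_meas_zero h).trans ?_
  exact (Lp.coeFn_zero ℂ 2 ν).symm

theorem indicatorOp_univ (ν : Measure X) : indicatorOp ν .univ = 1 := by
  ext1 ξ
  exact Lp.ext ((coeFn_indicatorOp ν .univ ξ).trans (by rw [indicator_univ]; rfl))

theorem star_indicatorOp (ν : Measure X) {A : Set X} (hA : MeasurableSet A) :
    star (indicatorOp ν hA) = indicatorOp ν hA := by
  rw [ContinuousLinearMap.star_eq_adjoint]
  refine ((ContinuousLinearMap.eq_adjoint_iff _ _).2 fun ξ η => ?_).symm
  rw [L2.inner_def, L2.inner_def]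
  refine integral_congr_ae ?_
  filter_upwards [coeFn_indicatorOp ν hA ξ, coeFn_indicatorOp ν hA η] with x h1 h2
  rw [h1, h2]
  by_cases h : x ∈ A <;> simp [h]

theorem isStarProjection_indicatorOp (ν : Measure X) {A : Set X} (hA : MeasurableSet A) :
    IsStarProjection (indicatorOp ν hA) :=
  ⟨(indicatorOp_mul_indicatorOp ν hA hA).trans (by simp only [inter_self]), star_indicatorOp ν hA⟩

theorem indicatorOp_eq_sum {ν : Measure X} {ι : Type*} {A : ι → Set X}
    (hA : ∀ i, MeasurableSet (A i)) {B : Set X} (hB : MeasurableSet B) (F : Finset ι)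
    (h : ∀ᵐ x ∂ν, B.indicator (1 : X → ℂ) x = ∑ i ∈ F, (A i).indicator 1 x) :
    indicatorOp ν hB = ∑ i ∈ F, indicatorOp ν (hA i) := by
  ext1 ξ
  refine Lp.ext ?_
  have hsum : ∀ G : Finset ι, ⇑(∑ i ∈ G, indicatorOp ν (hA i) ξ)
      =ᵐ[ν] fun x => ∑ i ∈ G, (A i).indicator ξ x := by
    classical
    refine fun G => G.induction_on ?_ fun i G hi ih => ?_
    · simp only [Finset.sum_empty]
      exact Lp.coeFn_zero ℂ 2 ν
    · simp only [Finset.sum_insert hi]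
      exact (Lp.coeFn_add _ _).trans ((coeFn_indicatorOp ν (hA i) ξ).add ih)
  rw [sum_apply]
  filter_upwards [coeFn_indicatorOp ν hB ξ, hsum F, h] with x h1 h2 hx
  have hmul : ∀ C : Set X, C.indicator ξ x = C.indicator 1 x * ξ x := fun C => by
    by_cases hC : x ∈ C <;> simp [hC]
  rw [h1, h2, hmul, hx, Finset.sum_mul, Finset.sum_congr rfl fun i _ => (hmul (A i)).symm]

end WeightedComposition

section Contractions

variable {H : Type*} [NormedAddCommGroup H] [InnerProductSpace ℂ H] [CompleteSpace H]

theorem star_mul_self_eq_of_norm_apply_eq {S T : H →L[ℂ] H} (h : ∀ ξ, ‖S ξ‖ = ‖T ξ‖) :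
    star S * S = star T * T := by
  have hinner : ∀ (R : H →L[ℂ] H) ξ, inner ℂ ((star R * R) ξ) ξ = (‖R ξ‖ : ℂ) ^ 2 := fun R ξ => by
    rw [mul_apply_eq_comp, ContinuousLinearMap.star_eq_adjoint,
      ContinuousLinearMap.adjoint_inner_left, inner_self_eq_norm_sq_to_K]
    rfl
  refine ContinuousLinearMap.coe_injective ((ext_inner_map _ _).1 fun ξ => ?_)
  exact (hinner S ξ).trans ((congrArg (fun r : ℝ => (r : ℂ) ^ 2) (h ξ)).trans (hinner T ξ).symm)

theorem star_eq_of_contractions {S T : H →L[ℂ] H} (hS : ‖S‖ ≤ 1) (hT : ‖T‖ ≤ 1)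
    (hTS : IsStarProjection (T * S)) (hST : IsStarProjection (S * T)) (hSTS : S * T * S = S)
    (hTST : T * S * T = T) : star S = T := by
  have hnorm : ∀ ξ, ‖S ξ‖ = ‖(T * S) ξ‖ := fun ξ => by
    refine le_antisymm ?_ ((T.le_of_opNorm_le hT (S ξ)).trans_eq (one_mul _))
    calc ‖S ξ‖ = ‖S ((T * S) ξ)‖ := by rw [← mul_apply_eq_comp, ← mul_assoc, hSTS]
      _ ≤ ‖(T * S) ξ‖ := (S.le_of_opNorm_le hS _).trans_eq (one_mul _)
  have hSS : star S * S = T * S := by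
    rw [star_mul_self_eq_of_norm_apply_eq hnorm, hTS.isSelfAdjoint.star_eq,
      hTS.isIdempotentElem.eq]
  calc star S = star (S * T * S) := by rw [hSTS]
    _ = star S * S * T := by rw [star_mul, hST.isSelfAdjoint.star_eq, mul_assoc]
    _ = T := by rw [hSS, hTST]

variable {K : Type*} [NormedAddCommGroup K] [InnerProductSpace ℂ K]

omit [CompleteSpace H] in
theorem norm_apply_eq_of_contractions {S : H →L[ℂ] K} {T : K →L[ℂ] H} (hS : ‖S‖ ≤ 1)
    (hT : ‖T‖ ≤ 1) (hTS : T ∘L S = 1) (ξ : H) : ‖S ξ‖ = ‖ξ‖ := by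
  refine le_antisymm ((S.le_of_opNorm_le hS ξ).trans_eq (one_mul _)) ?_
  calc ‖ξ‖ = ‖T (S ξ)‖ := by rw [← ContinuousLinearMap.comp_apply, hTS, one_apply_eq_self]
    _ ≤ ‖S ξ‖ := (T.le_of_opNorm_le hT _).trans_eq (one_mul _)

/-- A pair of mutually inverse contractions, as an isometric isomorphism. -/
def isometryEquivOfContractions {S : H →L[ℂ] K} {T : K →L[ℂ] H} (hS : ‖S‖ ≤ 1)
    (hT : ‖T‖ ≤ 1) (hTS : T ∘L S = 1) (hST : S ∘L T = 1) : H ≃ₗᵢ[ℂ] K where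
  toLinearEquiv := (ContinuousLinearEquiv.equivOfInverse S T (DFunLike.congr_fun hTS)
    (DFunLike.congr_fun hST)).toLinearEquiv
  norm_map' := norm_apply_eq_of_contractions hS hT hTS

end Contractions

/-! ### Branches of semibranching function systems -/

section Branch

variable {X : Type*} [MeasurableSpace X]

theorem inv_toNNReal_mul_le_one (c : ℝ≥0∞) : ((c.toNNReal⁻¹ : ℝ≥0) : ℝ≥0∞) * c ≤ 1 := by
  rcases eq_or_ne c ∞ with rfl | hc
  · simp
  · rw [← ENNReal.coe_toNNReal hc, ← ENNReal.coe_mul]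
    exact ENNReal.coe_le_one_iff.2 inv_mul_le_one

theorem map_withDensity_comp {Y : Type*} [MeasurableSpace Y] {μ : Measure X} {f : X → Y}
    (hf : Measurable f) {g : Y → ℝ≥0∞} (hg : Measurable g) :
    (μ.withDensity (g ∘ f)).map f = (μ.map f).withDensity g := by
  ext E hE
  rw [Measure.map_apply hf hE, withDensity_apply _ (hf hE), withDensity_apply _ hE,
    setLIntegral_map hE hg hf]
  rfl

/-- `τ : D → X` is a measurable embedding of a measurable set `D ⊆ X`, and the measurable map
`T : X → X` is a left inverse of it: the part of the notion of a branch of a semibranching function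
system that does not refer to a measure. -/
structure IsCodedEmbedding (D : Set X) (τ : D → X) (T : X → X) : Prop where
  measurableSet_dom : MeasurableSet D
  measurableEmbedding : MeasurableEmbedding τ
  measurable_coding : Measurable T
  coding_apply : ∀ x, T (τ x) = x

/-- A single branch of a semibranching function system on `(X, μ)`, together with a coding map
for it. -/
structure IsBranch (μ : Measure X) (D : Set X) (τ : D → X) (T : X → X) : Prop
    extends IsCodedEmbedding D τ T where
  hasDeriv : compMeasure μ D τ = μ.withDensity (prefixDeriv μ D τ)
  deriv_pos : ∀ᵐ x ∂μ, x ∈ D → 0 < prefixDeriv μ D τ x ∧ prefixDeriv μ D τ x < ∞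

open Classical in
/-- The map `τ : D → X`, extended to `X` by the identity. -/
def extendById (D : Set X) (τ : D → X) (x : X) : X := if hx : x ∈ D then τ ⟨x, hx⟩ else x

omit [MeasurableSpace X] in
theorem extendById_of_mem {D : Set X} (τ : D → X) {x : X} (hx : x ∈ D) :
    extendById D τ x = τ ⟨x, hx⟩ :=
  dif_pos hx

theorem measurable_prefixDeriv (μ : Measure X) (D : Set X) (τ : D → X) :
    Measurable (prefixDeriv μ D τ) :=
  Measure.measurable_rnDeriv _ _

namespace IsCodedEmbedding

variable {D : Set X} {τ : D → X} {T : X → X} (H : IsCodedEmbedding D τ T)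

include H

theorem measurableSet_range : MeasurableSet (range τ) :=
  H.measurableEmbedding.measurableSet_range

theorem measurable_extendById : Measurable (extendById D τ) := by
  classical
  exact H.measurableEmbedding.measurable.dite measurable_subtype_coe H.measurableSet_dom

theorem coding_mem {x : X} (hx : x ∈ range τ) : T x ∈ D := by
  obtain ⟨y, rfl⟩ := hx
  rw [H.coding_apply]
  exact y.2

theorem extendById_coding {x : X} (hx : x ∈ range τ) : extendById D τ (T x) = x := by
  obtain ⟨y, rfl⟩ := hx
  rw [H.coding_apply, extendById_of_mem τ y.2]

theorem coding_extendById {x : X} (hx : x ∈ D) : T (extendById D τ x) = x := by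
  rw [extendById_of_mem τ hx, H.coding_apply]

theorem compMeasure_eq_map_restrict (μ : Measure X) :
    compMeasure μ D τ = (μ.restrict (range τ)).map T := by
  ext E hE
  have himage : τ '' (Subtype.val ⁻¹' E) = T ⁻¹' E ∩ range τ := by
    ext x
    constructor
    · rintro ⟨y, hy, rfl⟩
      exact ⟨by rwa [mem_preimage, H.coding_apply], mem_range_self y⟩
    · rintro ⟨hx, y, rfl⟩
      exact ⟨y, by rwa [mem_preimage, H.coding_apply] at hx, rfl⟩
  rw [compMeasure, Measure.map_apply measurable_subtype_coe hE,
    H.measurableEmbedding.comap_apply, himage, Measure.map_apply H.measurable_coding hE,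
    Measure.restrict_apply (H.measurable_coding hE)]

theorem map_extendById_compMeasure (μ : Measure X) :
    (compMeasure μ D τ).map (extendById D τ) = μ.restrict (range τ) := by
  rw [compMeasure, Measure.map_map H.measurable_extendById measurable_subtype_coe,
    show extendById D τ ∘ Subtype.val = τ from funext fun x => extendById_of_mem τ x.2,
    H.measurableEmbedding.map_comap]

theorem compMeasure_withDensity (μ : Measure X) {f : X → ℝ≥0∞} (hf : Measurable f) :
    compMeasure (μ.withDensity f) D τ
      = (compMeasure μ D τ).withDensity (f ∘ extendById D τ) := by
  have hf' := hf.comp H.measurable_extendById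
  ext E hE
  have hTE := H.measurable_coding hE
  rw [H.compMeasure_eq_map_restrict, H.compMeasure_eq_map_restrict,
    restrict_withDensity H.measurableSet_range, Measure.map_apply H.measurable_coding hE,
    withDensity_apply _ hTE, withDensity_apply _ hE,
    setLIntegral_map hE hf' H.measurable_coding, Measure.restrict_restrict hTE]
  refine setLIntegral_congr_fun (hTE.inter H.measurableSet_range) fun x hx => ?_
  rw [Function.comp_apply, H.extendById_coding hx.2]

theorem compMeasure_absolutelyContinuous {μ ν : Measure X} (h : μ ≪ ν) :
    compMeasure μ D τ ≪ compMeasure ν D τ := by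
  rw [H.compMeasure_eq_map_restrict, H.compMeasure_eq_map_restrict]
  exact (h.restrict _).map H.measurable_coding

theorem sigmaFinite_compMeasure (μ : Measure X) [SigmaFinite μ] :
    SigmaFinite (compMeasure μ D τ) :=
  SigmaFinite.of_map _ H.measurable_extendById.aemeasurable
    (H.map_extendById_compMeasure μ ▸ inferInstance)

theorem compMeasure_compMeasure (μ : Measure X) {D' D'' : Set X} {τ' : D' → X} {τ'' : D'' → X}
    {T' T'' : X → X} (H' : IsCodedEmbedding D' τ' T') (H'' : IsCodedEmbedding D'' τ'' T'')
    (hT : T' ∘ T = T'') (hr : range τ'' =ᵐ[μ] (range τ ∩ T ⁻¹' range τ' : Set X)) :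
    compMeasure (compMeasure μ D τ) D' τ' = compMeasure μ D'' τ'' := by
  rw [H'.compMeasure_eq_map_restrict, H.compMeasure_eq_map_restrict,
    H''.compMeasure_eq_map_restrict,
    Measure.restrict_map H.measurable_coding H'.measurableSet_range,
    Measure.map_map H'.measurable_coding H.measurable_coding, hT,
    Measure.restrict_restrict (H.measurable_coding H'.measurableSet_range), inter_comm,
    Measure.restrict_congr_set hr]

theorem isBranch {μ : Measure X} [SigmaFinite μ] (hac : compMeasure μ D τ ≪ μ)
    (hac' : μ.restrict D ≪ compMeasure μ D τ) : IsBranch μ D τ T where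
  toIsCodedEmbedding := H
  hasDeriv :=
    have := H.sigmaFinite_compMeasure μ
    (Measure.withDensity_rnDeriv_eq _ _ hac).symm
  deriv_pos := by
    have := H.sigmaFinite_compMeasure μ
    have hpos : ∀ᵐ x ∂compMeasure μ D τ, 0 < prefixDeriv μ D τ x := Measure.rnDeriv_pos hac
    filter_upwards [Measure.rnDeriv_lt_top (compMeasure μ D τ) μ,
      (ae_restrict_iff' H.measurableSet_dom).1 (hac'.ae_le hpos)] with x hlt hpos hx
    exact ⟨hpos hx, hlt⟩

end IsCodedEmbedding

namespace IsBranch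

variable {μ : Measure X} {D : Set X} {τ : D → X} {T : X → X} (H : IsBranch μ D τ T)

include H

theorem compMeasure_absolutelyContinuous_self : compMeasure μ D τ ≪ μ := by
  rw [H.hasDeriv]
  exact withDensity_absolutelyContinuous _ _

theorem restrict_absolutelyContinuous_compMeasure : μ.restrict D ≪ compMeasure μ D τ := by
  refine (withDensity_absolutelyContinuous' (measurable_prefixDeriv μ D τ).aemeasurable
    ?_).trans (?_ : _ ≪ (compMeasure μ D τ).restrict D) |>.trans
      Measure.restrict_le_self.absolutelyContinuous
  · rw [ae_restrict_iff' H.measurableSet_dom]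
    filter_upwards [H.deriv_pos] with x hx hxD using (hx hxD).1.ne'
  · conv_rhs => rw [H.hasDeriv]
    rw [restrict_withDensity H.measurableSet_dom]

theorem congr_measure {ν : Measure X} [SigmaFinite ν] (hνμ : ν ≪ μ) (hμν : μ ≪ ν) :
    IsBranch ν D τ T :=
  H.isBranch
    ((H.compMeasure_absolutelyContinuous hνμ).trans
      (H.compMeasure_absolutelyContinuous_self.trans hμν))
    ((hνμ.restrict D).trans (H.restrict_absolutelyContinuous_compMeasure.trans
      (H.compMeasure_absolutelyContinuous hμν)))

theorem ae_coding {p : X → Prop} (hp : ∀ᵐ x ∂μ, p x) : ∀ᵐ x ∂μ, x ∈ range τ → p (T x) := by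
  rw [← ae_restrict_iff' H.measurableSet_range]
  refine ae_of_ae_map H.measurable_coding.aemeasurable ?_
  rw [← H.compMeasure_eq_map_restrict]
  exact H.compMeasure_absolutelyContinuous_self.ae_le hp

theorem prefixDeriv_comp_ae_eq [SigmaFinite μ] {D' D'' : Set X} {τ' : D' → X} {τ'' : D'' → X}
    {T' T'' : X → X} (H' : IsBranch μ D' τ' T') (H'' : IsBranch μ D'' τ'' T'') (hT : T' ∘ T = T'')
    (hr : range τ'' =ᵐ[μ] (range τ ∩ T ⁻¹' range τ' : Set X)) :
    prefixDeriv μ D'' τ''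
      =ᵐ[μ] prefixDeriv μ D' τ' * prefixDeriv μ D τ ∘ extendById D' τ' := by
  have hΦ := measurable_prefixDeriv μ D τ
  have hΦ' := (measurable_prefixDeriv μ D' τ').mul (hΦ.comp H'.measurable_extendById)
  refine (withDensity_eq_iff_of_sigmaFinite (measurable_prefixDeriv μ D'' τ'').aemeasurable
    hΦ'.aemeasurable).1 ?_
  rw [← H''.hasDeriv,
    ← H.compMeasure_compMeasure μ H'.toIsCodedEmbedding H''.toIsCodedEmbedding hT hr,
    congrArg (fun ν => compMeasure ν D' τ') H.hasDeriv, H'.compMeasure_withDensity μ hΦ,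
    congrArg (Measure.withDensity · _) H'.hasDeriv]
  exact (withDensity_mul _ (measurable_prefixDeriv μ D' τ')
    (hΦ.comp H'.measurable_extendById)).symm

theorem density_mul_prefixDeriv_ae_eq [SigmaFinite μ] {ν : Measure X} (Hν : IsBranch ν D τ T)
    {h : X → ℝ≥0∞} (hh : Measurable h) (hν : ν = μ.withDensity h) :
    h * prefixDeriv ν D τ =ᵐ[μ] prefixDeriv μ D τ * h ∘ extendById D τ := by
  have hh' := hh.comp H.measurable_extendById
  have hΦ := measurable_prefixDeriv μ D τ
  have hΦν := measurable_prefixDeriv ν D τ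
  refine (withDensity_eq_iff_of_sigmaFinite (hh.mul hΦν).aemeasurable
    (hΦ.mul hh').aemeasurable).1 ?_
  rw [withDensity_mul _ hh hΦν, withDensity_mul _ hΦ hh', ← hν, ← Hν.hasDeriv, ← H.hasDeriv, hν,
    H.compMeasure_withDensity μ hh]

/-! ### The operators of a branch on `L²` -/

theorem isContractiveWeight_creation : IsContractiveWeight μ μ
    ((range τ).indicator fun x => (NNReal.sqrt (prefixDeriv μ D τ (T x)).toNNReal)⁻¹) T where
  measurable_weight :=
    (NNReal.continuous_sqrt.measurable.comp
      ((measurable_prefixDeriv μ D τ).comp H.measurable_coding).ennreal_toNNReal).inv.indicator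
        H.measurableSet_range
  measurable_map := H.measurable_coding
  map_withDensity_le := by
    set g : X → ℝ≥0∞ := fun x => ((prefixDeriv μ D τ x).toNNReal⁻¹ : ℝ≥0)
    have hg : Measurable g :=
      (measurable_prefixDeriv μ D τ).ennreal_toNNReal.inv.coe_nnreal_ennreal
    have hsq : (fun x => (((range τ).indicator
        (fun x => (NNReal.sqrt (prefixDeriv μ D τ (T x)).toNNReal)⁻¹) x : ℝ≥0) : ℝ≥0∞) ^ 2)
          = (range τ).indicator (g ∘ T) := by
      ext x
      by_cases hx : x ∈ range τ
      · rw [indicator_of_mem hx, indicator_of_mem hx, ← ENNReal.coe_pow, inv_pow, NNReal.sq_sqrt]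
        rfl
      · simp [hx]
    calc (μ.withDensity _).map T
        = (((μ.restrict (range τ)).withDensity (g ∘ T))).map T := by
          rw [hsq, withDensity_indicator H.measurableSet_range]
      _ = (compMeasure μ D τ).withDensity g := by
          rw [H.compMeasure_eq_map_restrict, map_withDensity_comp H.measurable_coding hg]
      _ = μ.withDensity (g * prefixDeriv μ D τ) := by
          conv_lhs => rw [H.hasDeriv]
          rw [mul_comm, withDensity_mul _ (measurable_prefixDeriv μ D τ) hg]
      _ ≤ μ.withDensity 1 := withDensity_mono (.of_forall fun x => inv_toNNReal_mul_le_one _)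
      _ = μ := withDensity_one

theorem isContractiveWeight_annihilation : IsContractiveWeight μ μ
    (D.indicator fun x => NNReal.sqrt (prefixDeriv μ D τ x).toNNReal) (extendById D τ) where
  measurable_weight :=
    (NNReal.continuous_sqrt.measurable.comp
      (measurable_prefixDeriv μ D τ).ennreal_toNNReal).indicator H.measurableSet_dom
  measurable_map := H.measurable_extendById
  map_withDensity_le := by
    have hsq : (fun x => ((D.indicator
        (fun x => NNReal.sqrt (prefixDeriv μ D τ x).toNNReal) x : ℝ≥0) : ℝ≥0∞) ^ 2)
          ≤ prefixDeriv μ D τ := fun x => by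
      by_cases hx : x ∈ D
      · simp only [indicator_of_mem hx]
        rw [← ENNReal.coe_pow, NNReal.sq_sqrt]
        exact ENNReal.coe_toNNReal_le_self
      · simp [hx]
    calc (μ.withDensity _).map (extendById D τ)
        ≤ (compMeasure μ D τ).map (extendById D τ) := by
          rw [H.hasDeriv]
          exact Measure.map_mono (withDensity_mono (.of_forall hsq)) H.measurable_extendById
      _ = μ.restrict (range τ) := H.map_extendById_compMeasure μ
      _ ≤ μ := Measure.restrict_le_self

/-- The operator `S ξ = χ_R (Φ ∘ T)^{-1/2} (ξ ∘ T)` of a branch with range `R`, coding map `T` and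
derivative `Φ`. -/
def creation : Lp ℂ 2 μ →L[ℂ] Lp ℂ 2 μ := H.isContractiveWeight_creation.op

/-- The operator `ξ ↦ χ_D Φ^{1/2} (ξ ∘ τ)`, which is the adjoint of `creation`. -/
def annihilation : Lp ℂ 2 μ →L[ℂ] Lp ℂ 2 μ := H.isContractiveWeight_annihilation.op

theorem coeFn_creation (ξ : Lp ℂ 2 μ) :
    H.creation ξ =ᵐ[μ] (range τ).indicator fun x =>
      ((prefixDeriv μ D τ (T x)).toReal ^ (-(1 / 2 : ℝ)) : ℝ) • ξ (T x) := by
  filter_upwards [H.isContractiveWeight_creation.coeFn_op ξ] with x hx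
  rw [creation, hx]
  by_cases hxr : x ∈ range τ
  · rw [indicator_of_mem hxr, indicator_of_mem hxr, Real.rpow_neg ENNReal.toReal_nonneg,
      ← Real.sqrt_eq_rpow, NNReal.coe_inv, Real.coe_sqrt, ENNReal.coe_toNNReal_eq_toReal]
  · simp [hxr]

theorem sqrt_toNNReal_prefixDeriv_ne_zero :
    ∀ᵐ x ∂μ, x ∈ D → NNReal.sqrt (prefixDeriv μ D τ x).toNNReal ≠ 0 := by
  filter_upwards [H.deriv_pos] with x hx hxD
  exact NNReal.sqrt_eq_zero.not.2 (ENNReal.toNNReal_pos (hx hxD).1.ne' (hx hxD).2.ne).ne'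

theorem annihilation_mul_creation :
    H.annihilation * H.creation = indicatorOp μ H.measurableSet_dom := by
  refine IsContractiveWeight.op_comp_op _ _ _ ?_ (.of_forall fun x hx => ?_)
  · filter_upwards [H.sqrt_toNNReal_prefixDeriv_ne_zero] with x hx
    by_cases hxD : x ∈ D
    · have hr : extendById D τ x ∈ range τ := ⟨_, (extendById_of_mem τ hxD).symm⟩
      rw [indicator_of_mem hxD, indicator_of_mem hr, indicator_of_mem hxD, H.coding_extendById hxD,
        mul_inv_cancel₀ (hx hxD), Pi.one_apply]
    · simp [hxD]
  · exact H.coding_extendById (mem_of_indicator_ne_zero hx)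

theorem creation_mul_annihilation :
    H.creation * H.annihilation = indicatorOp μ H.measurableSet_range := by
  refine IsContractiveWeight.op_comp_op _ _ _ ?_ (.of_forall fun x hx => ?_)
  · filter_upwards [H.ae_coding H.sqrt_toNNReal_prefixDeriv_ne_zero] with x hx
    by_cases hxr : x ∈ range τ
    · have hD := H.coding_mem hxr
      rw [indicator_of_mem hxr, indicator_of_mem hD, indicator_of_mem hxr,
        inv_mul_cancel₀ (hx hxr hD), Pi.one_apply]
    · simp [hxr]
  · exact H.extendById_coding (mem_of_indicator_ne_zero hx)

theorem indicatorOp_range_mul_creation :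
    indicatorOp μ H.measurableSet_range * H.creation = H.creation :=
  IsContractiveWeight.op_comp_op _ _ _
    (.of_forall fun x => by by_cases hx : x ∈ range τ <;> simp [hx]) (.of_forall fun _ _ => rfl)

theorem indicatorOp_dom_mul_annihilation :
    indicatorOp μ H.measurableSet_dom * H.annihilation = H.annihilation :=
  IsContractiveWeight.op_comp_op _ _ _
    (.of_forall fun x => by by_cases hx : x ∈ D <;> simp [hx]) (.of_forall fun _ _ => rfl)

theorem star_creation : star H.creation = H.annihilation := by
  refine star_eq_of_contractions H.isContractiveWeight_creation.norm_op_le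
    H.isContractiveWeight_annihilation.norm_op_le ?_ ?_ ?_ ?_
  · rw [H.annihilation_mul_creation]
    exact isStarProjection_indicatorOp _ _
  · rw [H.creation_mul_annihilation]
    exact isStarProjection_indicatorOp _ _
  · rw [H.creation_mul_annihilation, H.indicatorOp_range_mul_creation]
  · rw [H.annihilation_mul_creation, H.indicatorOp_dom_mul_annihilation]

theorem star_creation_mul_creation :
    star H.creation * H.creation = indicatorOp μ H.measurableSet_dom := by
  rw [H.star_creation, H.annihilation_mul_creation]

theorem creation_mul_star_creation :
    H.creation * star H.creation = indicatorOp μ H.measurableSet_range := by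
  rw [H.star_creation, H.creation_mul_annihilation]

theorem creation_mul_creation [SigmaFinite μ] {D' D'' : Set X} {τ' : D' → X} {τ'' : D'' → X}
    {T' T'' : X → X} (H' : IsBranch μ D' τ' T') (H'' : IsBranch μ D'' τ'' T'') (hT : T' ∘ T = T'')
    (hr : range τ'' =ᵐ[μ] (range τ ∩ T ⁻¹' range τ' : Set X)) :
    H.creation * H'.creation = H''.creation := by
  refine IsContractiveWeight.op_comp_op _ _ _ ?_ (.of_forall fun x _ => congrFun hT x)
  filter_upwards [H''.ae_coding (H.prefixDeriv_comp_ae_eq H' H'' hT hr), hr.mem_iff]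
    with x hchain hxr
  by_cases hx : x ∈ range τ''
  · have hxτ : x ∈ range τ := (hxr.1 hx).1
    have hxτ' : T x ∈ range τ' := (hxr.1 hx).2
    rw [indicator_of_mem hxτ, indicator_of_mem hxτ', indicator_of_mem hx, hchain hx, ← hT,
      Pi.mul_apply, Function.comp_apply, Function.comp_apply, H'.extendById_coding hxτ',
      ENNReal.toNNReal_mul, NNReal.sqrt_mul, mul_inv, mul_comm]
  · rw [indicator_of_notMem hx]
    by_cases hxτ : x ∈ range τ
    · rw [indicator_of_notMem (fun h : T x ∈ range τ' => hx (hxr.2 ⟨hxτ, h⟩)), mul_zero]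
    · rw [indicator_of_notMem hxτ, zero_mul]

end IsBranch

end Branch

/-! ### The representation of a semibranching function system -/

section SemibranchingRepresentation

namespace IsLambdaSemibranching

variable {k : ℕ} {V : Type v} {P : Type u} {X : Type*} [MeasurableSpace X] {Λ : KGraph k V P}
  {μ : Measure X} {D : P → Set X} {τ : ∀ a, D a → X} {T : (Fin k → ℕ) → X → X}
  (H : IsLambdaSemibranching Λ μ D τ T)

include H

theorem isBranch (a : P) : IsBranch μ (D a) (τ a) (T (Λ.d a)) where
  measurableSet_dom := (H.semibranching (Λ.d a)).measurableSet_dom ⟨a, rfl⟩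
  measurableEmbedding :=
    { injective := (H.semibranching (Λ.d a)).injective ⟨a, rfl⟩
      measurable := (H.semibranching (Λ.d a)).measurable ⟨a, rfl⟩
      measurableSet_image' := @((H.semibranching (Λ.d a)).measurableSet_image ⟨a, rfl⟩) }
  measurable_coding := (H.coding (Λ.d a)).1
  coding_apply := (H.coding (Λ.d a)).2 ⟨a, rfl⟩
  hasDeriv := (H.semibranching (Λ.d a)).hasDeriv ⟨a, rfl⟩
  deriv_pos := (H.semibranching (Λ.d a)).deriv_pos ⟨a, rfl⟩

theorem dom_ae_eq (a : P) : D a =ᵐ[μ] D (Λ.idp (Λ.s a)) := by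
  simpa only [Λ.comp_idp] using H.dom_comp a (Λ.idp (Λ.s a)) (Λ.r_idp _).symm

theorem range_idp (v : V) : range (τ (Λ.idp v)) = D (Λ.idp v) := by
  rw [show τ (Λ.idp v) = Subtype.val from funext (H.vertex_id v), Subtype.range_coe]

theorem measure_dom_idp_inter_eq_zero {v w : V} (hvw : v ≠ w) :
    μ (D (Λ.idp v) ∩ D (Λ.idp w)) = 0 := by
  have h := (H.semibranching 0).disjoint ⟨Λ.idp v, Λ.d_idp v⟩ ⟨Λ.idp w, Λ.d_idp w⟩
    fun h => hvw (Λ.r_idp v ▸ Λ.r_idp w ▸ congrArg (fun a => Λ.r a.1) h)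
  rwa [H.range_idp, H.range_idp] at h

theorem range_comp_ae_eq (a b : P) (h : Λ.s a = Λ.r b) :
    range (τ (Λ.comp a b h)) =ᵐ[μ] (range (τ a) ∩ T (Λ.d a) ⁻¹' range (τ b) : Set X) := by
  have hprefix := H.prefix_comp a b h
  refine Filter.eventuallyEq_set.2 ?_
  filter_upwards [(H.isBranch (Λ.comp a b h)).ae_coding
      (hprefix.and (H.dom_comp a b h).mem_iff),
    (H.isBranch a).ae_coding ((H.isBranch b).ae_coding hprefix)] with x hxab hxa
  constructor
  · rintro ⟨z, rfl⟩
    have hz := hxab (mem_range_self z)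
    rw [(H.isBranch _).coding_apply z] at hz
    obtain ⟨h₁, _, e⟩ := hz.1 (hz.2.1 z.2)
    replace e : τ a ⟨τ b ⟨z, _⟩, h₁⟩ = τ (Λ.comp a b h) z := e
    rw [← e, mem_inter_iff, mem_preimage, (H.isBranch a).coding_apply]
    exact ⟨mem_range_self _, mem_range_self _⟩
  · rintro ⟨⟨y, rfl⟩, hy⟩
    have hz := hxa (mem_range_self y)
    rw [mem_preimage, (H.isBranch a).coding_apply y] at hy
    rw [(H.isBranch a).coding_apply y] at hz
    obtain ⟨z, hzy⟩ := hy
    specialize hz ⟨z, hzy⟩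
    rw [← hzy, (H.isBranch b).coding_apply z] at hz
    obtain ⟨h₁, h₂, e⟩ := hz z.2
    exact ⟨⟨z, h₂⟩, e.symm.trans (congrArg (τ a) (Subtype.ext hzy))⟩

theorem measure_range_pos (a : P) : 0 < μ (range (τ a)) := by
  refine pos_iff_ne_zero.2 fun h0 => (H.vertex_pos (Λ.s a)).ne' ?_
  rw [← measure_congr (H.dom_ae_eq a), ← Measure.restrict_eq_zero,
    ← Measure.absolutelyContinuous_zero_iff]
  refine (H.isBranch a).restrict_absolutelyContinuous_compMeasure.trans ?_
  rw [(H.isBranch a).compMeasure_eq_map_restrict, Measure.restrict_eq_zero.2 h0, Measure.map_zero]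

theorem countable_degree [SigmaFinite μ] (m : Fin k → ℕ) : Countable {a : P // Λ.d a = m} := by
  rw [← countable_univ_iff]
  refine (Measure.countable_meas_pos_of_disjoint_iUnion₀
    (As := fun a : {a : P // Λ.d a = m} => range (τ a))
    (fun a => (H.isBranch a).measurableSet_range.nullMeasurableSet)
    (H.semibranching m).disjoint).mono fun a _ => H.measure_range_pos a

theorem creation_mul_creation [SigmaFinite μ] (a b : P) (h : Λ.s a = Λ.r b) :
    (H.isBranch a).creation * (H.isBranch b).creation
      = (H.isBranch (Λ.comp a b h)).creation :=
  (H.isBranch a).creation_mul_creation (H.isBranch b) (H.isBranch _)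
    (by rw [H.coding_add, Λ.d_comp, add_comm]) (H.range_comp_ae_eq a b h)

theorem creation_idp [SigmaFinite μ] (v : V) :
    (H.isBranch (Λ.idp v)).creation = indicatorOp μ (H.isBranch (Λ.idp v)).measurableSet_dom := by
  set S := (H.isBranch (Λ.idp v)).creation
  have hSS : S * S = S :=
    (H.creation_mul_creation _ _ ((Λ.s_idp v).trans (Λ.r_idp v).symm)).trans <|
      congrArg (fun a => (H.isBranch a).creation) <|
        (Λ.comp_congr rfl (by rw [Λ.s_idp]) _ _).trans (Λ.comp_idp (Λ.idp v))
  have hR : indicatorOp μ (H.isBranch (Λ.idp v)).measurableSet_dom * S = S := by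
    simpa only [H.range_idp] using (H.isBranch (Λ.idp v)).indicatorOp_range_mul_creation
  rw [← hR, ← (H.isBranch (Λ.idp v)).star_creation_mul_creation, mul_assoc, hSS]

theorem ae_indicator_dom_eq_sum [SigmaFinite μ] (v : V) (n : Fin k → ℕ) {F : Finset P}
    (hF : ∀ a, a ∈ F ↔ Λ.r a = v ∧ Λ.d a = n) :
    ∀ᵐ x ∂μ, (D (Λ.idp v)).indicator (1 : X → ℂ) x
      = ∑ a ∈ F, (range (τ a)).indicator 1 x := by
  have := H.countable_degree n
  have hdisj : ∀ a : {a : P // Λ.d a = n}, ∀ᵐ x ∂μ, ∀ b : {b : P // Λ.d b = n}, a ≠ b →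
      x ∈ range (τ a) → x ∉ range (τ b) := fun a => ae_all_iff.2 fun b => by
    by_cases hab : a = b
    · simp [hab]
    · filter_upwards [measure_eq_zero_iff_ae_notMem.1 ((H.semibranching n).disjoint a b hab)]
        with x hx _ hxa hxb using hx ⟨hxa, hxb⟩
  have hrange : ∀ a : {a : P // Λ.d a = n}, ∀ᵐ x ∂μ, x ∈ range (τ a) → x ∈ D (Λ.idp (Λ.r a)) :=
    fun a => by
      filter_upwards [measure_eq_zero_iff_ae_notMem.1 (H.range_subset (Λ.idp (Λ.r a)) a
        (Λ.s_idp _))] with x hx hxa using by_contra fun h => hx ⟨hxa, h⟩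
  have hvertex : ∀ a : {a : P // Λ.d a = n}, ∀ᵐ x ∂μ, Λ.r a ≠ v →
      x ∈ D (Λ.idp (Λ.r a)) → x ∉ D (Λ.idp v) := fun a => by
    by_cases hav : Λ.r a = v
    · simp [hav]
    · filter_upwards [measure_eq_zero_iff_ae_notMem.1 (H.measure_dom_idp_inter_eq_zero hav)]
        with x hx _ hxa hxv using hx ⟨hxa, hxv⟩
  filter_upwards [mem_ae_iff.2 (H.semibranching n).cover, ae_all_iff.2 hdisj,
    ae_all_iff.2 hrange, ae_all_iff.2 hvertex] with x hcover hdisj hrange hvertex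
  by_cases hx : x ∈ D (Λ.idp v)
  · obtain ⟨a, ha⟩ := mem_iUnion.1 hcover
    have hav : Λ.r a = v := by_contra fun h => hvertex a h (hrange a ha) hx
    rw [Finset.sum_eq_single_of_mem a.1 ((hF a).2 ⟨hav, a.2⟩) fun b hb hba =>
      indicator_of_notMem (hdisj a ⟨b, ((hF b).1 hb).2⟩ (fun h => hba (congrArg Subtype.val h).symm)
        ha) _, indicator_of_mem hx, indicator_of_mem ha]
  · rw [indicator_of_notMem hx, Finset.sum_eq_zero fun b hb => indicator_of_notMem ?_ _]
    obtain ⟨rfl, hbn⟩ := (hF b).1 hb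
    exact fun hxb => hx (hrange ⟨b, hbn⟩ hxb)

theorem isCuntzKrieger [SigmaFinite μ] :
    Λ.IsCuntzKrieger fun a => (H.isBranch a).creation where
  partial_isometry a := by
    rw [(H.isBranch a).creation_mul_star_creation, (H.isBranch a).indicatorOp_range_mul_creation]
  ck1_proj v := by
    rw [H.creation_idp]
    exact isStarProjection_indicatorOp _ _
  ck1_orth v w hvw := by
    rw [H.creation_idp, H.creation_idp, indicatorOp_mul_indicatorOp]
    exact indicatorOp_eq_zero _ (H.measure_dom_idp_inter_eq_zero hvw)
  ck2 := H.creation_mul_creation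
  ck3 a := by
    rw [(H.isBranch a).star_creation_mul_creation, H.creation_idp]
    exact indicatorOp_congr _ _ (H.dom_ae_eq a)
  ck4 v n F hF := by
    simp only [(H.isBranch _).creation_mul_star_creation, H.creation_idp]
    exact indicatorOp_eq_sum _ _ F (H.ae_indicator_dom_eq_sum v n hF)

theorem isSemibranchingRep_iff {π : Λ.cstar →⋆ₙₐ[ℂ] (Lp ℂ 2 μ →L[ℂ] Lp ℂ 2 μ)} :
    IsSemibranchingRep Λ μ D τ T π ↔ ∀ a, π (Λ.gen a) = (H.isBranch a).creation := by
  refine forall_congr' fun a => ⟨fun h => ?_, fun h ξ => ?_⟩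
  · ext1 ξ
    exact Lp.ext ((h ξ).trans ((H.isBranch a).coeFn_creation ξ).symm)
  · rw [h]
    exact (H.isBranch a).coeFn_creation ξ

theorem congr_measure {ν : Measure X} [SigmaFinite ν] (hνμ : ν ≪ μ) (hμν : μ ≪ ν) :
    IsLambdaSemibranching Λ ν D τ T where
  semibranching m :=
    { H.semibranching m with
      cover := hνμ (H.semibranching m).cover
      disjoint := fun a b hab => hνμ ((H.semibranching m).disjoint a b hab)
      hasDeriv := fun a => ((H.isBranch a).congr_measure hνμ hμν).hasDeriv
      deriv_pos := fun a => ((H.isBranch a).congr_measure hνμ hμν).deriv_pos }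
  coding := H.coding
  vertex_id := H.vertex_id
  vertex_pos v := pos_iff_ne_zero.2 fun h => (H.vertex_pos v).ne' (hμν h)
  range_subset a b h := hνμ (H.range_subset a b h)
  dom_comp a b h := hνμ.ae_le (H.dom_comp a b h)
  prefix_comp a b h := hνμ.ae_le (H.prefix_comp a b h)
  coding_add := H.coding_add

end IsLambdaSemibranching

end SemibranchingRepresentation

section SqrtDensity

variable {X : Type*} [MeasurableSpace X] {μ ν : Measure X} [SigmaFinite μ] [SigmaFinite ν]

theorem isContractiveWeight_sqrt_rnDeriv (hνμ : ν ≪ μ) :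
    IsContractiveWeight ν μ (fun x => NNReal.sqrt (ν.rnDeriv μ x).toNNReal) id where
  measurable_weight :=
    NNReal.continuous_sqrt.measurable.comp (Measure.measurable_rnDeriv ν μ).ennreal_toNNReal
  measurable_map := measurable_id
  map_withDensity_le := by
    conv_rhs => rw [← Measure.withDensity_rnDeriv_eq ν μ hνμ]
    rw [Measure.map_id]
    refine withDensity_mono (.of_forall fun x => ?_)
    dsimp only
    rw [← ENNReal.coe_pow, NNReal.sq_sqrt]
    exact ENNReal.coe_toNNReal_le_self

theorem isContractiveWeight_inv_sqrt_rnDeriv (hνμ : ν ≪ μ) :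
    IsContractiveWeight μ ν (fun x => (NNReal.sqrt (ν.rnDeriv μ x).toNNReal)⁻¹) id where
  measurable_weight := (isContractiveWeight_sqrt_rnDeriv hνμ).measurable_weight.inv
  measurable_map := measurable_id
  map_withDensity_le := by
    have hm := Measure.measurable_rnDeriv ν μ
    have hm' : Measurable fun x => (((ν.rnDeriv μ x).toNNReal⁻¹ : ℝ≥0) : ℝ≥0∞) :=
      hm.ennreal_toNNReal.inv.coe_nnreal_ennreal
    calc (ν.withDensity _).map id
        = (μ.withDensity (ν.rnDeriv μ)).withDensity
            fun x => (((ν.rnDeriv μ x).toNNReal⁻¹ : ℝ≥0) : ℝ≥0∞) := by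
          simp only [← ENNReal.coe_pow, inv_pow, NNReal.sq_sqrt, Measure.map_id,
            Measure.withDensity_rnDeriv_eq ν μ hνμ]
      _ ≤ μ.withDensity 1 := by
          rw [← withDensity_mul _ hm hm', mul_comm]
          exact withDensity_mono (.of_forall fun x => inv_toNNReal_mul_le_one _)
      _ = μ := withDensity_one

theorem sqrt_toNNReal_rnDeriv_ne_zero (hνμ : ν ≪ μ) :
    ∀ᵐ x ∂ν, NNReal.sqrt (ν.rnDeriv μ x).toNNReal ≠ 0 := by
  filter_upwards [Measure.rnDeriv_pos hνμ, hνμ.ae_le (Measure.rnDeriv_lt_top ν μ)] with x h0 htop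
  exact NNReal.sqrt_eq_zero.not.2 (ENNReal.toNNReal_pos h0.ne' htop.ne).ne'

/-- Multiplication by `(dν/dμ)^{1/2}`, as a unitary from `L²(ν)` onto `L²(μ)` for equivalent
measures `μ` and `ν`. -/
def sqrtDensityEquiv (hνμ : ν ≪ μ) (hμν : μ ≪ ν) : Lp ℂ 2 ν ≃ₗᵢ[ℂ] Lp ℂ 2 μ :=
  isometryEquivOfContractions (isContractiveWeight_sqrt_rnDeriv hνμ).norm_op_le
    (isContractiveWeight_inv_sqrt_rnDeriv hνμ).norm_op_le
    ((IsContractiveWeight.op_comp_op _ _ (isContractiveWeight_indicator ν .univ)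
      ((sqrt_toNNReal_rnDeriv_ne_zero hνμ).mono fun x hx => by simp [hx])
      (.of_forall fun _ _ => rfl)).trans (indicatorOp_univ ν))
    ((IsContractiveWeight.op_comp_op _ _ (isContractiveWeight_indicator μ .univ)
      (((sqrt_toNNReal_rnDeriv_ne_zero hνμ).filter_mono hμν.ae_le).mono fun x hx => by simp [hx])
      (.of_forall fun _ _ => rfl)).trans (indicatorOp_univ μ))

theorem sqrtDensityEquiv_creation (hνμ : ν ≪ μ) (hμν : μ ≪ ν) {D : Set X} {τ : D → X} {T : X → X}
    (H : IsBranch μ D τ T) (Hν : IsBranch ν D τ T) (ξ : Lp ℂ 2 ν) :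
    sqrtDensityEquiv hνμ hμν (Hν.creation ξ) = H.creation (sqrtDensityEquiv hνμ hμν ξ) := by
  refine Lp.ext ?_
  refine ((isContractiveWeight_sqrt_rnDeriv hνμ).coeFn_op_op Hν.isContractiveWeight_creation
    ξ).trans ?_
  filter_upwards [H.isContractiveWeight_creation.coeFn_op_op
      (isContractiveWeight_sqrt_rnDeriv hνμ) ξ,
    H.ae_coding (H.density_mul_prefixDeriv_ae_eq Hν (Measure.measurable_rnDeriv ν μ)
      (Measure.withDensity_rnDeriv_eq ν μ hνμ).symm),
    H.ae_coding H.sqrt_toNNReal_prefixDeriv_ne_zero,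
    hμν.ae_le (Hν.ae_coding Hν.sqrt_toNNReal_prefixDeriv_ne_zero)] with x hx hdens hΦ hΦν
  refine Eq.trans ?_ hx.symm
  by_cases hxr : x ∈ range τ
  · have hD := H.coding_mem hxr
    have hroot := congrArg (fun c => NNReal.sqrt c.toNNReal) (hdens hxr)
    simp only [Pi.mul_apply, Function.comp_apply, ENNReal.toNNReal_mul, NNReal.sqrt_mul,
      H.extendById_coding hxr] at hroot
    simp only [id_eq, indicator_of_mem hxr]
    congr 2
    rw [← div_eq_mul_inv, mul_comm, ← div_eq_mul_inv, div_eq_div_iff (hΦν hxr hD) (hΦ hxr hD),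
      mul_comm, ← hroot]
  · simp [hxr]

end SqrtDensity

section Uniqueness

variable {k : ℕ} {V : Type v} {P : Type u} {X : Type u} [MeasurableSpace X] {Λ : KGraph k V P}
  {μ : Measure X} [SigmaFinite μ] {D : P → Set X} {τ : ∀ a, D a → X} {T : (Fin k → ℕ) → X → X}

namespace IsLambdaSemibranching

theorem existsUnique_rep (H : IsLambdaSemibranching Λ μ D τ T) :
    ∃! π : Λ.cstar →⋆ₙₐ[ℂ] (Lp ℂ 2 μ →L[ℂ] Lp ℂ 2 μ), IsSemibranchingRep Λ μ D τ T π := by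
  simpa only [H.isSemibranchingRep_iff] using Λ.existsUnique_lift H.isCuntzKrieger

theorem unitarilyEquivalent (H : IsLambdaSemibranching Λ μ D τ T) {ν : Measure X} [SigmaFinite ν]
    (hνμ : ν ≪ μ) (hμν : μ ≪ ν) {π : Λ.cstar →⋆ₙₐ[ℂ] (Lp ℂ 2 ν →L[ℂ] Lp ℂ 2 ν)}
    {ρ : Λ.cstar →⋆ₙₐ[ℂ] (Lp ℂ 2 μ →L[ℂ] Lp ℂ 2 μ)} (hπ : IsSemibranchingRep Λ ν D τ T π)
    (hρ : IsSemibranchingRep Λ μ D τ T ρ) : UnitarilyEquivalent π ρ := by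
  have Hν := H.congr_measure hνμ hμν
  set U := sqrtDensityEquiv hνμ hμν
  let conj := NonUnitalStarAlgHomClass.toNonUnitalStarAlgHom (R := ℂ) U.conjStarAlgEquiv
  have hgen : ∀ a, (conj.comp π) (Λ.gen a) = (H.isBranch a).creation := fun a => by
    ext1 ξ
    change U (π (Λ.gen a) (U.symm ξ)) = _
    rw [Hν.isSemibranchingRep_iff.1 hπ, sqrtDensityEquiv_creation, U.apply_symm_apply]
  have hconj : conj.comp π = ρ :=
    (Λ.existsUnique_lift H.isCuntzKrieger).unique hgen (H.isSemibranchingRep_iff.1 hρ)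
  refine ⟨U, fun c ξ => ?_⟩
  rw [← hconj]
  exact congrArg (fun η => U (π c η)) (U.symm_apply_apply ξ).symm

end IsLambdaSemibranching

end Uniqueness

/-! ### Path spaces -/

namespace KGraph

variable {k : ℕ} {V P : Type*} {Λ : KGraph k V P}

theorem tail_zero (a : P) : Λ.tail a 0 = a := by
  obtain ⟨⟨h, e⟩, hd⟩ := Λ.head_tail a 0 zero_le
  exact (Λ.comp_inj h (Λ.s_idp _) (e.trans (Λ.idp_comp a).symm) (hd.trans (Λ.d_idp _).symm)).2

theorem r_head {a : P} {p : Fin k → ℕ} (hp : p ≤ Λ.d a) : Λ.r (Λ.head a p) = Λ.r a := by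
  obtain ⟨⟨h, e⟩, -⟩ := Λ.head_tail a p hp
  rw [← Λ.r_comp _ _ h, e]

theorem head_eq_of_comp {a b c : P} {p : Fin k → ℕ} (h : Λ.s a = Λ.r b)
    (e : Λ.comp a b h = c) (hp : Λ.d a = p) : Λ.head c p = a := by
  subst e hp; exact Λ.head_comp a b h

theorem tail_eq_of_comp {a b c : P} {p : Fin k → ℕ} (h : Λ.s a = Λ.r b)
    (e : Λ.comp a b h = c) (hp : Λ.d a = p) : Λ.tail c p = b := by
  subst e hp; exact Λ.tail_comp a b h

theorem head_head {a : P} {p q : Fin k → ℕ} (hpq : p ≤ q) (hq : q ≤ Λ.d a) :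
    Λ.head (Λ.head a q) p = Λ.head a p := by
  obtain ⟨⟨h, e⟩, hd⟩ := Λ.head_tail a q hq
  obtain ⟨⟨h', e'⟩, hd'⟩ := Λ.head_tail (Λ.head a q) p (hpq.trans hd.ge)
  have h'' : Λ.s (Λ.tail (Λ.head a q) p) = Λ.r (Λ.tail a q) := by
    rw [← Λ.s_comp _ _ h', e', h]
  refine (Λ.head_eq_of_comp (b := Λ.comp _ _ h'') (h'.trans (Λ.r_comp _ _ _).symm) ?_ hd').symm
  rw [← Λ.comp_assoc _ _ _ h' h'', Λ.comp_congr e' rfl _ h, e]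

theorem head_d (a : P) : Λ.head a (Λ.d a) = a :=
  Λ.head_eq_of_comp (Λ.r_idp _).symm (Λ.comp_idp a) rfl

namespace InfPath

theorem map_congr (x : Λ.InfPath) {p q p' q' : Fin k → ℕ} (hp : p = p') (hq : q = q')
    (h : p ≤ q) (h' : p' ≤ q') : x.map p q h = x.map p' q' h' := by
  subst hp hq; rfl

theorem comp_map (x : Λ.InfPath) {p q : Fin k → ℕ} (h : p ≤ q) :
    Λ.comp (x.map 0 p zero_le) (x.map p q h) ((x.s_map _ _ _).trans (x.r_map _ _ _).symm)
      = x.map 0 q zero_le := x.map_comp 0 p q zero_le h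

theorem d_map_zero (x : Λ.InfPath) (p : Fin k → ℕ) : Λ.d (x.map 0 p zero_le) = p := by
  rw [x.d_map, tsub_zero]

theorem head_map (x : Λ.InfPath) {p q : Fin k → ℕ} (h : p ≤ q) :
    Λ.head (x.map 0 q zero_le) p = x.map 0 p zero_le :=
  Λ.head_eq_of_comp _ (x.comp_map h) (x.d_map_zero p)

theorem tail_map (x : Λ.InfPath) {p q : Fin k → ℕ} (h : p ≤ q) :
    Λ.tail (x.map 0 q zero_le) p = x.map p q h :=
  Λ.tail_eq_of_comp _ (x.comp_map h) (x.d_map_zero p)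

theorem vertexAt_map (x : Λ.InfPath) {p q : Fin k → ℕ} (h : p ≤ q) :
    Λ.vertexAt (x.map 0 q zero_le) p = x.obj p := by
  rw [vertexAt, x.head_map h, x.s_map]

theorem ext_map_zero {x y : Λ.InfPath} (h : ∀ p, x.map 0 p zero_le = y.map 0 p zero_le) :
    x = y := by
  have hm : ∀ p q hpq, x.map p q hpq = y.map p q hpq := fun p q hpq => by
    rw [← x.tail_map, ← y.tail_map, h]
  ext p q hpq
  · rw [← x.r_map p p le_rfl, hm, y.r_map]
  · exact hm p q hpq

theorem shift_map_zero (x : Λ.InfPath) (m q : Fin k → ℕ) :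
    (x.shift m).map 0 q zero_le = x.map m (q + m) le_add_self :=
  x.map_congr (zero_add m) rfl _ _

theorem shift_obj_zero (x : Λ.InfPath) (m : Fin k → ℕ) : (x.shift m).obj 0 = x.obj m :=
  congrArg x.obj (zero_add m)

theorem shift_shift (x : Λ.InfPath) (m n : Fin k → ℕ) :
    (x.shift n).shift m = x.shift (m + n) := by
  ext p q h
  · exact congrArg x.obj (add_assoc p m n)
  · exact x.map_congr (add_assoc _ _ _) (add_assoc _ _ _) _ _

theorem shift_zero (x : Λ.InfPath) : x.shift 0 = x :=
  ext_map_zero fun p => (x.shift_map_zero 0 p).trans (x.map_congr rfl (add_zero p) _ _)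

theorem eq_of_shift_eq {x y : Λ.InfPath} (m : Fin k → ℕ)
    (h : x.map 0 m zero_le = y.map 0 m zero_le) (hs : x.shift m = y.shift m) : x = y := by
  refine ext_map_zero fun q => ?_
  have e : x.map 0 (q + m) zero_le = y.map 0 (q + m) zero_le := by
    rw [← x.comp_map (p := m) le_add_self, ← y.comp_map (p := m) le_add_self]
    refine Λ.comp_congr h ?_ _ _
    rw [← x.shift_map_zero, ← y.shift_map_zero, hs]
  rw [← x.head_map (q := q + m) le_self_add, ← y.head_map (q := q + m) le_self_add, e]

theorem cons_map_zero (a : P) (x : Λ.InfPath) (hx : x.obj 0 = Λ.s a) (q : Fin k → ℕ) :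
    (x.cons a hx).map 0 q zero_le
      = Λ.head (Λ.comp a (x.map 0 q zero_le) ((x.r_map _ _ _).trans hx).symm) q :=
  Λ.tail_zero _

end InfPath

theorem mem_cylinder_iff {a : P} {m : Fin k → ℕ} (h : Λ.d a = m) {x : Λ.InfPath} :
    x ∈ Λ.cylinder a ↔ x.map 0 m zero_le = a := by
  subst h; rfl

theorem mem_cylinder_idp {w : V} {x : Λ.InfPath} : x ∈ Λ.cylinder (Λ.idp w) ↔ x.obj 0 = w := by
  refine ⟨InfPath.obj_zero_of_mem, ?_⟩
  rintro rfl
  rw [mem_cylinder_iff (Λ.d_idp _), x.map_self]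

theorem InfPath.mem_cylinder_map (x : Λ.InfPath) (q : Fin k → ℕ) :
    x ∈ Λ.cylinder (x.map 0 q zero_le) :=
  (mem_cylinder_iff (x.d_map_zero q)).2 rfl

theorem obj_zero_of_mem_cylinder {a : P} {x : Λ.InfPath} (hx : x ∈ Λ.cylinder a) :
    x.obj 0 = Λ.r a := by
  rw [← x.r_map 0 (Λ.d a) zero_le, show x.map 0 (Λ.d a) zero_le = a from hx]

theorem obj_d_of_mem_cylinder {a : P} {x : Λ.InfPath} (hx : x ∈ Λ.cylinder a) :
    x.obj (Λ.d a) = Λ.s a := by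
  rw [← x.s_map 0 (Λ.d a) zero_le, show x.map 0 (Λ.d a) zero_le = a from hx]

theorem mem_cylinder_comp {a b : P} (h : Λ.s a = Λ.r b) {x : Λ.InfPath} :
    x ∈ Λ.cylinder (Λ.comp a b h) ↔ x ∈ Λ.cylinder a ∧ x.shift (Λ.d a) ∈ Λ.cylinder b := by
  have hd : Λ.d (Λ.comp a b h) = Λ.d b + Λ.d a := by rw [Λ.d_comp, add_comm]
  rw [mem_cylinder_iff hd, mem_cylinder_iff rfl, mem_cylinder_iff rfl, x.shift_map_zero,
    ← x.comp_map (p := Λ.d a) le_add_self]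
  constructor
  · intro e
    exact Λ.comp_inj _ _ e (x.d_map_zero _)
  · rintro ⟨e1, e2⟩
    exact Λ.comp_congr e1 e2 _ _

theorem shift_mem_of_mem_cylinder {a : P} {x : Λ.InfPath} (hx : x ∈ Λ.cylinder a) :
    x.shift (Λ.d a) ∈ Λ.cylinder (Λ.idp (Λ.s a)) := by
  rw [mem_cylinder_idp, x.shift_obj_zero, obj_d_of_mem_cylinder hx]

theorem disjoint_cylinder {a b : P} (hd : Λ.d a = Λ.d b) (hab : a ≠ b) :
    Disjoint (Λ.cylinder a) (Λ.cylinder b) := by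
  refine Set.disjoint_left.2 fun x ha hb => hab ?_
  exact ((mem_cylinder_iff hd).1 ha).symm.trans ((mem_cylinder_iff rfl).1 hb)

theorem iUnion_cylinder (Λ : KGraph k V P) (m : Fin k → ℕ) :
    ⋃ a : {a : P // Λ.d a = m}, Λ.cylinder a = univ :=
  eq_univ_of_forall fun x => mem_iUnion.2
    ⟨⟨x.map 0 m zero_le, x.d_map_zero m⟩, x.mem_cylinder_map m⟩

theorem isOpen_cylinder (a : P) : IsOpen (Λ.cylinder a) :=
  TopologicalSpace.isOpen_generateFrom_of_mem ⟨a, rfl⟩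

theorem measurableSet_cylinder (a : P) : MeasurableSet (Λ.cylinder a) :=
  (isOpen_cylinder a).measurableSet

theorem borel_eq_generateFrom (Λ : KGraph k V P) :
    (inferInstance : MeasurableSpace Λ.InfPath) = .generateFrom (range Λ.cylinder) := by
  have := Λ.countable
  have : SecondCountableTopology Λ.InfPath := ⟨range Λ.cylinder, countable_range _, rfl⟩
  exact borel_eq_generateFrom_of_subbasis rfl

theorem measurableSet_map_mem (q : Fin k → ℕ) (S : Set P) :
    MeasurableSet {x : Λ.InfPath | x.map 0 q zero_le ∈ S} := by
  have := Λ.countable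
  have : {x : Λ.InfPath | x.map 0 q zero_le ∈ S}
      = ⋃ a ∈ S ∩ {a | Λ.d a = q}, Λ.cylinder a := by
    ext x
    simp only [mem_ofPred_eq, mem_iUnion, exists_prop]
    constructor
    · intro h
      exact ⟨_, ⟨h, x.d_map_zero q⟩, x.mem_cylinder_map q⟩
    · rintro ⟨a, ⟨ha, hd⟩, hx⟩
      rw [(mem_cylinder_iff hd).1 hx]; exact ha
  rw [this]
  exact MeasurableSet.biUnion (to_countable _) fun a _ => measurableSet_cylinder a

theorem measurable_of_cylinder {X : Type*} [MeasurableSpace X] {f : X → Λ.InfPath}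
    (hf : ∀ a, MeasurableSet (f ⁻¹' Λ.cylinder a)) : Measurable f := by
  refine (measurable_generateFrom (s := range Λ.cylinder) ?_).mono le_rfl
    (borel_eq_generateFrom Λ).le
  rintro _ ⟨a, rfl⟩
  exact hf a

theorem measurable_shift (m : Fin k → ℕ) :
    Measurable (InfPath.shift m : Λ.InfPath → Λ.InfPath) := by
  refine measurable_of_cylinder fun a => ?_
  have : InfPath.shift m ⁻¹' Λ.cylinder a
      = {x : Λ.InfPath | x.map 0 (Λ.d a + m) zero_le ∈ {c | Λ.tail c m = a}} := by
    ext x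
    simp only [mem_preimage, mem_cylinder_iff rfl, x.shift_map_zero, mem_ofPred_eq]
    rw [x.tail_map]
  rw [this]
  exact measurableSet_map_mem _ _

/-- The cylinder sets of the paths whose degree is a multiple of `(1, …, 1)`; unlike the family of
all cylinder sets, they form a π-system. -/
def diagonalCylinders (Λ : KGraph k V P) : Set (Set Λ.InfPath) :=
  {S | ∃ (n : ℕ) (a : P), Λ.d a = (fun _ => n) ∧ Λ.cylinder a = S}

theorem isPiSystem_diagonalCylinders (Λ : KGraph k V P) : IsPiSystem Λ.diagonalCylinders := by
  have key : ∀ (m n : ℕ) (a b : P), m ≤ n → Λ.d a = (fun _ => m) → Λ.d b = (fun _ => n) →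
      (Λ.cylinder a ∩ Λ.cylinder b).Nonempty → Λ.cylinder b ⊆ Λ.cylinder a := by
    rintro m n a b hmn ha hb ⟨x, hxa, hxb⟩ y hy
    have hmn' : (fun _ => m : Fin k → ℕ) ≤ fun _ => n := fun _ => hmn
    rw [mem_cylinder_iff ha] at hxa ⊢
    rw [mem_cylinder_iff hb] at hxb hy
    rw [← y.head_map hmn', hy, ← hxb, x.head_map hmn', hxa]
  rintro _ ⟨m, a, ha, rfl⟩ _ ⟨n, b, hb, rfl⟩ hne
  rcases le_total m n with h | h
  · exact ⟨n, b, hb, (inter_eq_right.2 (key m n a b h ha hb hne)).symm⟩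
  · exact ⟨m, a, ha, (inter_eq_left.2 (key n m b a h hb ha (inter_comm _ _ ▸ hne))).symm⟩

theorem generateFrom_diagonalCylinders (Λ : KGraph k V P) :
    (inferInstance : MeasurableSpace Λ.InfPath) = .generateFrom Λ.diagonalCylinders := by
  have := Λ.countable
  apply le_antisymm
  · rw [borel_eq_generateFrom Λ]
    refine MeasurableSpace.generateFrom_le ?_
    rintro _ ⟨a, rfl⟩
    set n := ∑ i, Λ.d a i
    have hn : Λ.d a ≤ fun _ => n := fun i => Finset.single_le_sum (f := Λ.d a)
      (fun _ _ => Nat.zero_le _) (Finset.mem_univ i)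
    have : Λ.cylinder a
        = ⋃ b ∈ {b | Λ.d b = (fun _ => n) ∧ Λ.head b (Λ.d a) = a}, Λ.cylinder b := by
      ext x
      simp only [mem_iUnion, exists_prop, mem_ofPred_eq]
      constructor
      · intro h
        refine ⟨_, ⟨x.d_map_zero _, ?_⟩, x.mem_cylinder_map _⟩
        rw [x.head_map hn]; exact h
      · rintro ⟨b, ⟨hb, hba⟩, hx⟩
        rw [mem_cylinder_iff rfl, ← x.head_map hn, (mem_cylinder_iff hb).1 hx, hba]
    rw [this]
    exact MeasurableSet.biUnion (to_countable _) fun b hb =>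
      MeasurableSpace.measurableSet_generateFrom ⟨n, b, hb.1, rfl⟩
  · refine MeasurableSpace.generateFrom_le ?_
    rintro _ ⟨n, a, -, rfl⟩
    exact measurableSet_cylinder a

theorem countable_vertex (Λ : KGraph k V P) : Countable V :=
  have := Λ.countable
  (Function.LeftInverse.injective Λ.r_idp).countable

theorem measure_ext {μ ν : Measure Λ.InfPath}
    (hfin : ∀ w, μ (Λ.cylinder (Λ.idp w)) ≠ ∞)
    (h : ∀ (n : ℕ) (a : P), Λ.d a = (fun _ => n) → μ (Λ.cylinder a) = ν (Λ.cylinder a)) :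
    μ = ν := by
  have := Λ.countable_vertex
  refine Measure.ext_of_generateFrom_of_cover_subset (T := range fun w => Λ.cylinder (Λ.idp w))
    (generateFrom_diagonalCylinders Λ) (isPiSystem_diagonalCylinders Λ) ?_ (countable_range _) ?_
    ?_ ?_
  · rintro _ ⟨w, rfl⟩
    exact ⟨0, _, Λ.d_idp w, rfl⟩
  · exact eq_univ_of_forall fun x =>
      ⟨_, ⟨x.obj 0, rfl⟩, mem_cylinder_idp.2 rfl⟩
  · rintro _ ⟨w, rfl⟩
    exact hfin w
  · rintro _ ⟨n, a, ha, rfl⟩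
    exact h n a ha

theorem stdPrefix_mem_cylinder (a : P) (x : Λ.cylinder (Λ.idp (Λ.s a))) :
    Λ.stdPrefix a x ∈ Λ.cylinder a :=
  InfPath.cons_map a x.1 _

theorem shift_stdPrefix (a : P) (x : Λ.cylinder (Λ.idp (Λ.s a))) :
    (Λ.stdPrefix a x).shift (Λ.d a) = x :=
  InfPath.shift_cons a x.1 _

theorem stdPrefix_shift {a : P} {x : Λ.InfPath} (hx : x ∈ Λ.cylinder a) :
    Λ.stdPrefix a ⟨x.shift (Λ.d a), shift_mem_of_mem_cylinder hx⟩ = x :=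
  InfPath.eq_of_shift_eq (Λ.d a) ((stdPrefix_mem_cylinder a _).trans hx.symm) (shift_stdPrefix a _)

theorem range_stdPrefix (a : P) : range (Λ.stdPrefix a) = Λ.cylinder a :=
  (range_subset_iff.2 (stdPrefix_mem_cylinder a)).antisymm fun _ hx => ⟨_, stdPrefix_shift hx⟩

theorem image_stdPrefix_preimage_val (a : P) (E : Set Λ.InfPath) :
    Λ.stdPrefix a '' (Subtype.val ⁻¹' E) = Λ.cylinder a ∩ InfPath.shift (Λ.d a) ⁻¹' E := by
  ext x
  constructor
  · rintro ⟨y, hy, rfl⟩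
    exact ⟨stdPrefix_mem_cylinder a y, by rwa [mem_preimage, shift_stdPrefix]⟩
  · rintro ⟨hx, hE⟩
    exact ⟨_, hE, stdPrefix_shift hx⟩

theorem measurable_stdPrefix (a : P) : Measurable (Λ.stdPrefix a) := by
  refine measurable_of_cylinder fun b => ?_
  refine ⟨{x | x.map 0 (Λ.d b) zero_le ∈ {c | ∃ h, Λ.head (Λ.comp a c h) (Λ.d b) = b}},
    measurableSet_map_mem _ _, ?_⟩
  ext x
  have hx : Λ.s a = Λ.r (x.1.map 0 (Λ.d b) zero_le) :=
    ((x.1.r_map _ _ _).trans (mem_cylinder_idp.1 x.2)).symm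
  rw [mem_preimage, mem_preimage, mem_cylinder_iff rfl, stdPrefix, InfPath.cons_map_zero]
  exact exists_prop_of_true hx

theorem isCodedEmbedding_stdPrefix (a : P) :
    IsCodedEmbedding (Λ.cylinder (Λ.idp (Λ.s a))) (Λ.stdPrefix a) (InfPath.shift (Λ.d a)) where
  measurableSet_dom := measurableSet_cylinder _
  measurableEmbedding :=
    { injective := fun x y h => Subtype.ext <| by
        rw [← shift_stdPrefix a x, ← shift_stdPrefix a y, h]
      measurable := measurable_stdPrefix a
      measurableSet_image' := by
        rintro _ ⟨E, hE, rfl⟩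
        rw [image_stdPrefix_preimage_val]
        exact (measurableSet_cylinder a).inter (measurable_shift _ hE) }
  measurable_coding := measurable_shift _
  coding_apply := shift_stdPrefix a

theorem stdPrefix_idp (w : V) (x : Λ.cylinder (Λ.idp (Λ.s (Λ.idp w)))) :
    Λ.stdPrefix (Λ.idp w) x = x := by
  have h := shift_stdPrefix (Λ.idp w) x
  rwa [Λ.d_idp, InfPath.shift_zero] at h

theorem stdPrefix_comp {a b : P} (h : Λ.s a = Λ.r b) {x : Λ.InfPath}
    (hb : x ∈ Λ.cylinder (Λ.idp (Λ.s b)))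
    (ha : Λ.stdPrefix b ⟨x, hb⟩ ∈ Λ.cylinder (Λ.idp (Λ.s a)))
    (hab : x ∈ Λ.cylinder (Λ.idp (Λ.s (Λ.comp a b h)))) :
    Λ.stdPrefix a ⟨_, ha⟩ = Λ.stdPrefix (Λ.comp a b h) ⟨x, hab⟩ := by
  have hmem : Λ.stdPrefix a ⟨_, ha⟩ ∈ Λ.cylinder (Λ.comp a b h) :=
    (mem_cylinder_comp h).2 ⟨stdPrefix_mem_cylinder a _,
      (shift_stdPrefix a _).symm ▸ stdPrefix_mem_cylinder b _⟩
  refine InfPath.eq_of_shift_eq _ (hmem.trans (stdPrefix_mem_cylinder _ _).symm) ?_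
  rw [shift_stdPrefix, Λ.d_comp, add_comm, ← InfPath.shift_shift, shift_stdPrefix, shift_stdPrefix]

theorem cylinder_subset_cylinder_idp {a : P} {w : V} (h : w = Λ.r a) :
    Λ.cylinder a ⊆ Λ.cylinder (Λ.idp w) := fun x hx => by
  rw [mem_cylinder_idp, obj_zero_of_mem_cylinder hx, h]

/-! ### Quasi-invariant measures on path spaces -/

theorem standardSemibranching_of_isBranch {μ : Measure Λ.InfPath}
    (hpos : ∀ w, 0 < μ (Λ.cylinder (Λ.idp w)))
    (h : ∀ a, IsBranch μ (Λ.cylinder (Λ.idp (Λ.s a))) (Λ.stdPrefix a) (InfPath.shift (Λ.d a))) :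
    Λ.StandardSemibranching μ where
  semibranching m :=
    { measurableSet_dom := fun _ => measurableSet_cylinder _
      measurable := fun a => measurable_stdPrefix a.1
      injective := fun a => (isCodedEmbedding_stdPrefix a.1).measurableEmbedding.injective
      measurableSet_image := fun a _ hE =>
        (isCodedEmbedding_stdPrefix a.1).measurableEmbedding.measurableSet_image.2 hE
      cover := by
        simp only [range_stdPrefix]
        rw [iUnion_cylinder, compl_univ, measure_empty]
      disjoint := fun a b hab => by
        rw [range_stdPrefix, range_stdPrefix, (disjoint_cylinder (a.2.trans b.2.symm)
          (Subtype.coe_ne_coe.2 hab)).inter_eq, measure_empty]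
      hasDeriv := fun a => (h a).hasDeriv
      deriv_pos := fun a => (h a).deriv_pos }
  coding m := by
    refine ⟨measurable_shift m, ?_⟩
    rintro ⟨a, rfl⟩ x
    exact shift_stdPrefix a x
  vertex_id := stdPrefix_idp
  vertex_pos w := by simpa only [Λ.s_idp] using hpos w
  range_subset a b hab := by
    rw [range_stdPrefix, sdiff_eq_empty.2 (cylinder_subset_cylinder_idp hab), measure_empty]
  dom_comp a b hab := by rw [Λ.s_comp]; rfl
  prefix_comp a b hab := .of_forall fun x hx =>
    have ha := cylinder_subset_cylinder_idp hab (stdPrefix_mem_cylinder b ⟨x, hx⟩)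
    have hx' : x ∈ Λ.cylinder (Λ.idp (Λ.s (Λ.comp a b hab))) := by rwa [Λ.s_comp]
    ⟨ha, hx', stdPrefix_comp hab hx ha hx'⟩
  coding_add m n := funext fun x => x.shift_shift m n

section Scaling

variable {M : Measure Λ.InfPath} [IsFiniteMeasure M] {a : P} {c : ℝ≥0∞}

theorem compMeasure_stdPrefix
    (h : ∀ b hab, M (Λ.cylinder (Λ.comp a b hab)) = c * M (Λ.cylinder b)) :
    compMeasure M (Λ.cylinder (Λ.idp (Λ.s a))) (Λ.stdPrefix a)
      = c • M.restrict (Λ.cylinder (Λ.idp (Λ.s a))) := by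
  rw [(isCodedEmbedding_stdPrefix a).compMeasure_eq_map_restrict, range_stdPrefix]
  refine measure_ext (fun w => measure_ne_top _ _) fun n b _ => ?_
  rw [Measure.map_apply (measurable_shift _) (measurableSet_cylinder b),
    Measure.restrict_apply (measurable_shift _ (measurableSet_cylinder b)), Measure.smul_apply,
    Measure.restrict_apply (measurableSet_cylinder b), smul_eq_mul]
  by_cases hab : Λ.s a = Λ.r b
  · rw [inter_eq_left.2 (cylinder_subset_cylinder_idp hab), ← h b hab, inter_comm]
    congr 1
    ext x
    exact (mem_cylinder_comp hab).symm
  · have hdisj : Disjoint (Λ.cylinder b) (Λ.cylinder (Λ.idp (Λ.s a))) :=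
      disjoint_left.2 fun x hb ha => hab <| by
        rw [← mem_cylinder_idp.1 ha, obj_zero_of_mem_cylinder hb]
    have hempty : InfPath.shift (Λ.d a) ⁻¹' Λ.cylinder b ∩ Λ.cylinder a = ∅ :=
      eq_empty_of_forall_notMem fun x hx =>
        disjoint_left.1 hdisj hx.1 (shift_mem_of_mem_cylinder hx.2)
    rw [hempty, hdisj.inter_eq, measure_empty, mul_zero]

theorem isBranch_stdPrefix (hc : c ≠ 0)
    (h : ∀ b hab, M (Λ.cylinder (Λ.comp a b hab)) = c * M (Λ.cylinder b)) :
    IsBranch M (Λ.cylinder (Λ.idp (Λ.s a))) (Λ.stdPrefix a) (InfPath.shift (Λ.d a)) := by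
  refine (isCodedEmbedding_stdPrefix a).isBranch ?_ ?_
  · rw [compMeasure_stdPrefix h]
    exact Measure.smul_absolutelyContinuous.trans Measure.restrict_le_self.absolutelyContinuous
  · rw [compMeasure_stdPrefix h]
    exact Measure.absolutelyContinuous_smul hc

end Scaling

end KGraph

/-! ### Absolute continuity of infinite product measures -/

section InfiniteProduct

open scoped symmDiff

theorem measure_le_of_isSetAlgebra {X : Type*} [mX : MeasurableSpace X] {μ ν : Measure X}
    [IsFiniteMeasure μ] [IsFiniteMeasure ν] {𝒜 : Set (Set X)} (h𝒜 : IsSetAlgebra 𝒜)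
    (hgen : mX = MeasurableSpace.generateFrom 𝒜) (hle : ∀ s ∈ 𝒜, μ s ≤ ν s) : μ ≤ ν := by
  refine Measure.le_iff.2 fun s hs => ENNReal.le_of_forall_pos_le_add fun ε hε _ => ?_
  obtain ⟨t, ht, hst⟩ := (Measure.MeasureDense.of_generateFrom_isSetAlgebra_finite (μ + ν) h𝒜
    hgen).approx s hs (measure_ne_top _ s) ε hε
  have hs_le : μ s ≤ μ t + μ (s \ t) :=
    (measure_mono fun x hx => by by_cases hxt : x ∈ t <;> simp [hx, hxt]).trans
      (measure_union_le t (s \ t))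
  have ht_le : ν t ≤ ν s + ν (t \ s) :=
    (measure_mono fun x hx => by by_cases hxs : x ∈ s <;> simp [hx, hxs]).trans
      (measure_union_le s (t \ s))
  calc μ s ≤ ν s + ν (t \ s) + μ (s \ t) := by grw [hs_le, hle t ht, ht_le]
    _ ≤ ν s + (μ + ν) (s ∆ t) := by
      rw [add_assoc, add_comm (ν _) (μ _)]
      exact add_le_add le_rfl (add_le_add (measure_mono subset_union_left)
        (measure_mono subset_union_right))
    _ ≤ ν s + ε := by grw [hst, ENNReal.ofReal_coe_nnreal]

theorem pi_le_smul_pi {ι : Type*} [Fintype ι] {X : ι → Type*} [∀ i, MeasurableSpace (X i)]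
    {μ ν : ∀ i, Measure (X i)} [∀ i, SigmaFinite (μ i)] [∀ i, SigmaFinite (ν i)] {c : ι → ℝ≥0}
    (h : ∀ i, μ i ≤ c i • ν i) : Measure.pi μ ≤ (∏ i, c i) • Measure.pi ν := by
  have hc : Measure.pi (fun i => c i • ν i) = (∏ i, c i) • Measure.pi ν :=
    Measure.pi_eq fun s _ => by
      simp only [Measure.smul_apply, Measure.pi_pi, ENNReal.smul_def, smul_eq_mul,
        ENNReal.ofNNReal_finsetProd, Finset.prod_mul_distrib]
  have hle : (Measure.pi μ).toOuterMeasure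
      ≤ OuterMeasure.pi fun i => (c i • ν i).toOuterMeasure :=
    OuterMeasure.le_pi.2 fun s _ =>
      (Measure.pi_pi μ s).trans_le (Finset.prod_le_prod' fun i _ => h i (s i))
  rw [← hc]
  refine Measure.le_iff.2 fun s hs => (hle s).trans_eq ?_
  rw [Measure.pi, toMeasure_apply _ _ hs]

variable {ι : Type*} {X : ι → Type*} [∀ i, MeasurableSpace (X i)]
  {μ ν : ∀ i, Measure (X i)} [∀ i, IsProbabilityMeasure (μ i)] [∀ i, IsProbabilityMeasure (ν i)]
  {c : ι → ℝ≥0} {C : ℝ≥0}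

theorem infinitePi_le_smul_infinitePi (h : ∀ i, μ i ≤ c i • ν i)
    (hC : ∀ s : Finset ι, ∏ i ∈ s, c i ≤ C) :
    Measure.infinitePi μ ≤ C • Measure.infinitePi ν := by
  refine measure_le_of_isSetAlgebra isSetAlgebra_measurableCylinders
    generateFrom_measurableCylinders.symm fun t ht => ?_
  obtain ⟨s, S, hS, rfl⟩ := (mem_measurableCylinders t).1 ht
  rw [Measure.smul_apply, Measure.infinitePi_cylinder μ hS, Measure.infinitePi_cylinder ν hS]
  refine (pi_le_smul_pi (c := fun i : s => c i) (fun i => h i) S).trans ?_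
  rw [Measure.smul_apply, Finset.prod_coe_sort s c]
  gcongr
  exact hC s

theorem infinitePi_absolutelyContinuous (h : ∀ i, μ i ≤ c i • ν i)
    (hC : ∀ s : Finset ι, ∏ i ∈ s, c i ≤ C) :
    Measure.infinitePi μ ≪ Measure.infinitePi ν :=
  (infinitePi_le_smul_infinitePi h hC).absolutelyContinuous.trans
    Measure.smul_absolutelyContinuous

theorem exists_prod_inv_one_sub_le {d : ι → ℝ} (h0 : ∀ i, 0 ≤ d i) (h1 : ∀ i, d i < 1)
    (hd : Summable d) : ∃ C : ℝ≥0, ∀ s : Finset ι, ∏ i ∈ s, (1 - d i)⁻¹.toNNReal ≤ C := by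
  have hpos : ∀ i, 0 < 1 - d i := fun i => sub_pos.2 (h1 i)
  have hlog : Summable fun i => -Real.log (1 - d i) := by
    simpa only [sub_eq_add_neg] using
      (Real.summable_log_one_add_of_summable hd.neg).neg
  refine ⟨(Real.exp (∑' i, -Real.log (1 - d i))).toNNReal, fun s => ?_⟩
  rw [← Real.toNNReal_prod_of_nonneg fun i _ => (inv_pos.2 (hpos i)).le]
  refine Real.toNNReal_le_toNNReal ?_
  calc ∏ i ∈ s, (1 - d i)⁻¹ = Real.exp (∑ i ∈ s, -Real.log (1 - d i)) := by
        simp only [Real.exp_sum, Real.exp_neg, Real.exp_log (hpos _)]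
    _ ≤ _ := Real.exp_le_exp.2 (hlog.sum_le_tsum s fun i _ =>
        neg_nonneg.2 (Real.log_nonpos (hpos i).le (sub_le_self _ (h0 i))))

end InfiniteProduct

/-! ### Vertices of paths -/

namespace KGraph

variable {k : ℕ} {V P : Type*} {Λ : KGraph k V P}

theorem vertexAt_zero (a : P) : Λ.vertexAt a 0 = Λ.r a := by
  obtain ⟨-, hd⟩ := Λ.head_tail a 0 zero_le
  rw [vertexAt, Λ.eq_idp hd, Λ.s_idp, Λ.r_head zero_le]

theorem vertexAt_d (a : P) : Λ.vertexAt a (Λ.d a) = Λ.s a := by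
  rw [vertexAt, Λ.head_d]

theorem vertexAt_head {a : P} {p q : Fin k → ℕ} (hpq : p ≤ q) (hq : q ≤ Λ.d a) :
    Λ.vertexAt (Λ.head a q) p = Λ.vertexAt a p := by
  rw [vertexAt, Λ.head_head hpq hq, vertexAt]

theorem exists_eq_comp_head {a : P} {p q : Fin k → ℕ} (h : Λ.d a = p + q) :
    Λ.d (Λ.head a p) = p ∧
      ∃ b, ∃ hb : Λ.s (Λ.head a p) = Λ.r b, Λ.comp (Λ.head a p) b hb = a ∧ Λ.d b = q := by
  obtain ⟨⟨hb, e⟩, hd⟩ := Λ.head_tail a p (h ▸ le_self_add)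
  have hdb := congrArg Λ.d e
  rw [Λ.d_comp, hd, h] at hdb
  exact ⟨hd, _, hb, e, add_left_cancel hdb⟩

theorem exists_infPath_of_head_eq {q : ℕ → Fin k → ℕ} (hq : Monotone q)
    (hcofinal : ∀ p, ∃ m, p ≤ q m) {H : ℕ → P} (hd : ∀ m, Λ.d (H m) = q m)
    (hH : ∀ m n, m ≤ n → Λ.head (H n) (q m) = H m) :
    ∃ x : Λ.InfPath, ∀ m, x.map 0 (q m) zero_le = H m := by
  choose B hB using hcofinal
  have head_eq : ∀ {p m n}, p ≤ q m → m ≤ n → Λ.head (H n) p = Λ.head (H m) p :=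
    fun {p m n} hp hmn => by
      rw [← hH m n hmn, head_head hp ((hq hmn).trans (hd n).ge)]
  have head_eq_head_B : ∀ {p m}, p ≤ q m → Λ.head (H m) p = Λ.head (H (B p)) p :=
    fun {p m} hp => (le_total m (B p)).elim (fun h => (head_eq hp h).symm) (head_eq (hB p))
  have d_head : ∀ {p m}, p ≤ q m → Λ.d (Λ.head (H m) p) = p :=
    fun {p m} hp => (Λ.head_tail _ _ (hp.trans (hd m).ge)).2
  refine ⟨InfPath.ofHeads (fun p => Λ.head (H (B p)) p) (fun p => d_head (hB p))
    fun p p' hpp => ?_, fun m => (Λ.tail_zero _).trans ?_⟩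
  · obtain ⟨⟨hs, e⟩, -⟩ := Λ.head_tail (Λ.head (H (B p')) p') p (hpp.trans (d_head (hB p')).ge)
    have hpiece : Λ.head (Λ.head (H (B p')) p') p = Λ.head (H (B p)) p := by
      rw [head_head hpp ((hB p').trans (hd _).ge), head_eq_head_B (hpp.trans (hB p'))]
    rw [hpiece] at hs
    exact ⟨_, hs, (Λ.comp_congr hpiece.symm rfl _ _).trans e⟩
  · beta_reduce
    rw [← head_eq_head_B le_rfl, ← hd m, head_d]

end KGraph

/-! ### Walks on the star -/

theorem altPos_zero : altPos 0 = 0 := by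
  ext i; fin_cases i <;> rfl

theorem altPos_two_mul (n : ℕ) : altPos (2 * n) = fun _ => n := by
  ext i; fin_cases i <;> simp [altPos]; omega

theorem exists_altPos_succ (l : ℕ) : ∃ i, altPos (l + 1) = altPos l + Pi.single i 1 := by
  rcases Nat.even_or_odd' l with ⟨n, rfl | rfl⟩
  · refine ⟨1, ?_⟩
    ext i; fin_cases i <;> simp [altPos] <;> omega
  · refine ⟨0, ?_⟩
    ext i; fin_cases i <;> simp [altPos] <;> omega

theorem monotone_altPos : Monotone altPos := fun l m h i => by
  fin_cases i <;> simp [altPos] <;> omega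

theorem exists_le_altPos (p : Fin 2 → ℕ) : ∃ l, p ≤ altPos l :=
  ⟨2 * (p 0 + p 1), fun i => by
    rw [altPos_two_mul]
    fin_cases i <;> simp⟩

/-- A sequence of vertices of the star graph with centre `v` in which consecutive vertices are
adjacent. -/
def IsWalk {N : ℕ} (y : ℕ → StarVertex N) : Prop :=
  ∀ l, Xor (y l = .v) (y (l + 1) = .v)

instance (N : ℕ) : MeasurableSpace (StarVertex N) := ⊤

instance (N : ℕ) : DiscreteMeasurableSpace (StarVertex N) := ⟨fun _ => trivial⟩

theorem measurableSet_isWalk (N : ℕ) : MeasurableSet {y : ℕ → StarVertex N | IsWalk y} := by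
  refine measurableSet_setOfPred.2 (Measurable.forall fun l => ?_)
  have hpair : Measurable fun y : ℕ → StarVertex N => (y l, y (l + 1)) := by fun_prop
  exact (Measurable.of_discrete (f := fun q : StarVertex N × StarVertex N =>
    Xor (q.1 = .v) (q.2 = .v))).comp hpair

namespace IsLambda2N

open KGraph

variable {N : ℕ} {P : Type u} {Λ : KGraph 2 (StarVertex N) P} (hΛ : IsLambda2N Λ)

include hΛ

theorem xor_edge {e : P} {i : Fin 2} (he : Λ.d e = Pi.single i 1) :
    Xor (Λ.r e = .v) (Λ.s e = .v) :=
  (hΛ i _ _).2 ⟨e, he, rfl, rfl⟩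

theorem edge_unique {e e' : P} {i : Fin 2} (he : Λ.d e = Pi.single i 1)
    (he' : Λ.d e' = Pi.single i 1) (hr : Λ.r e = Λ.r e') (hs : Λ.s e = Λ.s e') : e = e' :=
  ((hΛ i _ _).1 (hΛ.xor_edge he')).unique ⟨he, hr, hs⟩ ⟨he', rfl, rfl⟩

theorem eq_of_vertexAt_eq {m : ℕ} {η η' : P} (h : Λ.d η = altPos m) (h' : Λ.d η' = altPos m)
    (hv : ∀ l ≤ m, Λ.vertexAt η (altPos l) = Λ.vertexAt η' (altPos l)) : η = η' := by
  induction m generalizing η η' with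
  | zero =>
    have hr := hv 0 le_rfl
    rw [altPos_zero, vertexAt_zero, vertexAt_zero] at hr
    rw [Λ.eq_idp (h.trans altPos_zero), Λ.eq_idp (h'.trans altPos_zero), hr]
  | succ m ih =>
    obtain ⟨i, hi⟩ := exists_altPos_succ m
    obtain ⟨hd, e, hse, hη, he⟩ := Λ.exists_eq_comp_head (h.trans hi)
    obtain ⟨hd', e', hse', hη', he'⟩ := Λ.exists_eq_comp_head (h'.trans hi)
    have hle : altPos m ≤ altPos (m + 1) := monotone_altPos m.le_succ
    have heads : Λ.head η (altPos m) = Λ.head η' (altPos m) := ih hd hd' fun l hl => by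
      rw [vertexAt_head (monotone_altPos hl) (hle.trans h.ge),
        vertexAt_head (monotone_altPos hl) (hle.trans h'.ge), hv l (hl.trans m.le_succ)]
    have sources : Λ.s e = Λ.s e' := by
      have := hv (m + 1) le_rfl
      rwa [← h, vertexAt_d, h, ← h', vertexAt_d, ← hη, ← hη', Λ.s_comp, Λ.s_comp] at this
    have edges : e = e' := hΛ.edge_unique he he' (by rw [← hse, ← hse', heads]) sources
    rw [← hη, ← hη']
    exact Λ.comp_congr heads edges _ _

theorem xor_vertexAt {m : ℕ} {η : P} (h : Λ.d η = altPos m) {l : ℕ} (hl : l < m) :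
    Xor (Λ.vertexAt η (altPos l) = .v) (Λ.vertexAt η (altPos (l + 1)) = .v) := by
  obtain ⟨i, hi⟩ := exists_altPos_succ l
  have hle : altPos (l + 1) ≤ Λ.d η := (monotone_altPos hl).trans h.ge
  obtain ⟨-, e, hse, hη, he⟩ :=
    Λ.exists_eq_comp_head (((Λ.head_tail η _ hle).2).trans hi)
  have hs : Λ.s e = Λ.vertexAt η (altPos (l + 1)) := by
    rw [vertexAt, ← hη, Λ.s_comp]
  have := hΛ.xor_edge he
  rwa [← hse, hs, head_head (monotone_altPos l.le_succ) hle] at this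

theorem vertexAt_eq_v_iff {m : ℕ} {η : P} (h : Λ.d η = altPos m) {l : ℕ} (hl : l ≤ m) :
    Λ.vertexAt η (altPos l) = .v ↔ (Even l ↔ Λ.r η = .v) := by
  induction l with
  | zero => simp [altPos_zero, vertexAt_zero]
  | succ l ih =>
    have hxor := hΛ.xor_vertexAt h hl
    have hl' := ih (Nat.le_of_succ_le hl)
    rw [Nat.even_add_one]
    unfold Xor at hxor
    tauto

theorem exists_path_of_isWalk {y : ℕ → StarVertex N} (hy : IsWalk y) (m : ℕ) :
    ∃ η, Λ.d η = altPos m ∧ ∀ l ≤ m, Λ.vertexAt η (altPos l) = y l := by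
  induction m with
  | zero =>
    refine ⟨Λ.idp (y 0), by rw [Λ.d_idp, altPos_zero], fun l hl => ?_⟩
    rw [Nat.le_zero.1 hl, altPos_zero, vertexAt_zero, Λ.r_idp]
  | succ m ih =>
    obtain ⟨η, hd, hv⟩ := ih
    obtain ⟨i, hi⟩ := exists_altPos_succ m
    obtain ⟨e, ⟨he, hr, hs⟩, -⟩ := (hΛ i _ _).1 (hy m)
    have hc : Λ.s η = Λ.r e := by
      rw [hr, ← hv m le_rfl, ← hd, vertexAt_d]
    have hdc : Λ.d (Λ.comp η e hc) = altPos (m + 1) := by rw [Λ.d_comp, hd, he, hi]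
    refine ⟨Λ.comp η e hc, hdc, fun l hl => ?_⟩
    rcases Nat.le_succ_iff.1 hl with hlm | rfl
    · rw [← hv l hlm, ← vertexAt_head (monotone_altPos hlm)
        ((monotone_altPos m.le_succ).trans hdc.ge), Λ.head_eq_of_comp hc rfl hd]
    · rw [← hdc, vertexAt_d, Λ.s_comp, hs]

theorem exists_infPath_of_isWalk {y : ℕ → StarVertex N} (hy : IsWalk y) :
    ∃ x : Λ.InfPath, ∀ l, x.obj (altPos l) = y l := by
  choose H hd hv using hΛ.exists_path_of_isWalk hy
  obtain ⟨x, hx⟩ := exists_infPath_of_head_eq monotone_altPos exists_le_altPos hd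
    fun m n hmn => by
      have hle : altPos m ≤ Λ.d (H n) := (monotone_altPos hmn).trans (hd n).ge
      refine hΛ.eq_of_vertexAt_eq (Λ.head_tail _ _ hle).2 (hd m) fun l hl => ?_
      rw [vertexAt_head (monotone_altPos hl) hle, hv n l (hl.trans hmn), hv m l hl]
  refine ⟨x, fun l => ?_⟩
  rw [← hv l l le_rfl, ← hx l, x.vertexAt_map le_rfl]

end IsLambda2N

namespace KGraph

variable {N : ℕ} {P : Type u} {Λ : KGraph 2 (StarVertex N) P}

/-- The vertices that an infinite path passes through when it is written as an alternating string
of edges beginning with a red edge. -/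
def InfPath.vertexSeq (x : Λ.InfPath) (l : ℕ) : StarVertex N := x.obj (altPos l)

theorem measurable_vertexSeq : Measurable (InfPath.vertexSeq (Λ := Λ)) := by
  refine measurable_pi_lambda _ fun l => measurable_to_countable' fun w => ?_
  have : (fun x : Λ.InfPath => x.vertexSeq l) ⁻¹' {w}
      = {x | x.map 0 (altPos l) zero_le ∈ {a | Λ.s a = w}} := by
    ext x
    simp [InfPath.vertexSeq, x.s_map]
  rw [this]
  exact measurableSet_map_mem _ _

end KGraph

namespace IsLambda2N

open KGraph InfPath

variable {N : ℕ} {P : Type u} {Λ : KGraph 2 (StarVertex N) P} (hΛ : IsLambda2N Λ)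

include hΛ

theorem mem_cylinder_iff_vertexSeq {n : ℕ} {η : P} (h : Λ.d η = fun _ => n) {x : Λ.InfPath} :
    x ∈ Λ.cylinder η ↔ ∀ l ∈ Finset.range (2 * n + 1), x.vertexSeq l = Λ.vertexAt η (altPos l) := by
  have h' : Λ.d η = altPos (2 * n) := h.trans (altPos_two_mul n).symm
  simp only [mem_cylinder_iff h', Finset.mem_range, Nat.lt_succ_iff]
  constructor
  · rintro rfl l hl
    exact (x.vertexAt_map (monotone_altPos hl)).symm
  · intro hx
    refine hΛ.eq_of_vertexAt_eq (x.d_map_zero _) h' fun l hl => ?_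
    rw [x.vertexAt_map (monotone_altPos hl), ← hx l hl, vertexSeq]

theorem injective_vertexSeq : Function.Injective (vertexSeq (Λ := Λ)) := fun x x' h => by
  have diagonal : ∀ n : ℕ, x.map 0 (fun _ => n) zero_le = x'.map 0 (fun _ => n) zero_le :=
    fun n => by
      have hn : Λ.d (x'.map 0 (fun _ => n) zero_le) = fun _ => n := x'.d_map_zero _
      rw [← mem_cylinder_iff hn, hΛ.mem_cylinder_iff_vertexSeq hn, h,
        ← hΛ.mem_cylinder_iff_vertexSeq hn]
      exact x'.mem_cylinder_map _
  refine ext_map_zero fun p => ?_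
  obtain ⟨n, hn⟩ : ∃ n : ℕ, p ≤ fun _ => n :=
    ⟨∑ i, p i, fun i => Finset.single_le_sum (fun _ _ => Nat.zero_le _) (Finset.mem_univ i)⟩
  rw [← x.head_map hn, diagonal, x'.head_map hn]

theorem range_vertexSeq : range (vertexSeq (Λ := Λ)) = {y | IsWalk y} := by
  refine subset_antisymm ?_ fun y hy => ?_
  · rintro _ ⟨x, rfl⟩ l
    simp only [vertexSeq, ← x.vertexAt_map (q := altPos (l + 1)) (monotone_altPos l.le_succ),
      ← x.vertexAt_map (q := altPos (l + 1)) le_rfl]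
    exact hΛ.xor_vertexAt (x.d_map_zero _) l.lt_succ_self
  · obtain ⟨x, hx⟩ := hΛ.exists_infPath_of_isWalk hy
    exact ⟨x, funext hx⟩

theorem measurableEmbedding_vertexSeq : MeasurableEmbedding (vertexSeq (Λ := Λ)) := by
  refine MeasurableEmbedding.iff_comap_eq.2 ⟨hΛ.injective_vertexSeq,
    measurable_vertexSeq.comap_le.antisymm ?_, ?_⟩
  · refine (generateFrom_diagonalCylinders Λ).le.trans (MeasurableSpace.generateFrom_le ?_)
    rintro _ ⟨n, η, hη, rfl⟩
    refine ⟨⋂ l ∈ Finset.range (2 * n + 1), (fun y => y l) ⁻¹' {Λ.vertexAt η (altPos l)},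
      Finset.measurableSet_biInter _ fun l _ => measurable_pi_apply l .of_discrete, ?_⟩
    ext x
    simp only [hΛ.mem_cylinder_iff_vertexSeq hη, mem_preimage, mem_iInter, mem_singleton_iff]
  · rw [hΛ.range_vertexSeq]
    exact measurableSet_isWalk N

end IsLambda2N

/-! ### The product measures -/

namespace StarVertex

variable {N : ℕ}

theorem sum_eq {M : Type*} [AddCommMonoid M] (f : StarVertex N → M) :
    ∑ a, f a = f .v + (∑ j, f (.u j) + ∑ j, f (.w j)) := by
  let e : StarVertex N ≃ Option (Fin N ⊕ Fin N) :=
    { toFun := fun | .v => none | .u j => some (.inl j) | .w j => some (.inr j)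
      invFun := fun | none => .v | some (.inl j) => .u j | some (.inr j) => .w j
      left_inv := by rintro (_ | j | j) <;> rfl
      right_inv := by rintro (_ | j | j) <;> rfl }
  rw [← e.symm.sum_comp, Fintype.sum_option, Fintype.sum_sum_type]
  rfl

variable {δ : Fin N → ℕ → ℝ}

/-- The weight of the vertex `a` at position `l` of a walk: the probability of stepping from `v`
to `a` if `a ≠ v`, and that of stepping back, which is `1`, if `a = v`. -/
def vertexWeight (δ : Fin N → ℕ → ℝ) (l : ℕ) (a : StarVertex N) : ℝ :=
  if a = .v then 1 else (1 + alphaAt δ l a) / (2 * N)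

theorem abs_alphaAt_le (δ : Fin N → ℕ → ℝ) (l : ℕ) (a : StarVertex N) :
    |alphaAt δ l a| ≤ ‖fun j => δ j l‖ := by
  rcases a with _ | j | j
  · simp [alphaAt]
  · exact norm_le_pi_norm (fun j => δ j l) j
  · exact (abs_neg _).trans_le (norm_le_pi_norm (fun j => δ j l) j)

theorem vertexWeight_nonneg {l : ℕ} (hδ : ∀ j, |δ j l| < 1) (a : StarVertex N) :
    0 ≤ vertexWeight δ l a := by
  have hα := (abs_alphaAt_le δ l a).trans ((pi_norm_lt_iff one_pos).2 hδ).le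
  unfold vertexWeight
  split_ifs
  · exact zero_le_one
  · exact div_nonneg (neg_le_iff_add_nonneg'.1 (abs_le.1 hα).1) (by positivity)

theorem vertexWeight_zero (l : ℕ) (a : StarVertex N) :
    vertexWeight 0 l a = if a = .v then 1 else 1 / (2 * N : ℝ) := by
  cases a <;> simp [vertexWeight, alphaAt]

theorem vertexWeight_le_mul_vertexWeight_zero {l : ℕ} (hδ : ∀ j, |δ j l| < 1)
    (a : StarVertex N) :
    vertexWeight δ l a ≤ (1 - ‖fun j => δ j l‖)⁻¹ * vertexWeight 0 l a := by
  have hα := (abs_le.1 (abs_alphaAt_le δ l a)).2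
  have hnorm := norm_nonneg fun j => δ j l
  have hpos : 0 < 1 - ‖fun j => δ j l‖ := sub_pos.2 ((pi_norm_lt_iff one_pos).2 hδ)
  rw [vertexWeight_zero, vertexWeight]
  split_ifs
  · rw [mul_one]
    exact (one_le_inv₀ hpos).2 (sub_le_self _ hnorm)
  · rw [← mul_div_assoc, mul_one]
    gcongr
    rw [← one_div, le_div_iff₀ hpos]
    nlinarith

theorem vertexWeight_zero_le_mul_vertexWeight {l : ℕ} (hδ : ∀ j, |δ j l| < 1)
    (a : StarVertex N) :
    vertexWeight 0 l a ≤ (1 - ‖fun j => δ j l‖)⁻¹ * vertexWeight δ l a := by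
  have hα := (abs_le.1 (abs_alphaAt_le δ l a)).1
  have hnorm := norm_nonneg fun j => δ j l
  have hpos : 0 < 1 - ‖fun j => δ j l‖ := sub_pos.2 ((pi_norm_lt_iff one_pos).2 hδ)
  rw [vertexWeight_zero, vertexWeight]
  split_ifs
  · rw [mul_one]
    exact (one_le_inv₀ hpos).2 (sub_le_self _ hnorm)
  · rw [← mul_div_assoc]
    gcongr
    rw [← div_eq_inv_mul, one_le_div₀ hpos]
    linarith

/-- The probability of the vertex `a` at position `l` of a random walk on the star that starts at
`v` if `b` is even and away from `v` if `b` is odd; such a walk is at `v` exactly at the positions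
`l` for which `l + b` is even. -/
def vertexProb (δ : Fin N → ℕ → ℝ) (b l : ℕ) (a : StarVertex N) : ℝ :=
  if Even (l + b) ↔ a = .v then vertexWeight δ l a else 0

theorem vertexProb_nonneg {l : ℕ} (hδ : ∀ j, |δ j l| < 1) (b : ℕ) (a : StarVertex N) :
    0 ≤ vertexProb δ b l a := by
  unfold vertexProb
  split_ifs
  exacts [vertexWeight_nonneg hδ a, le_rfl]

theorem sum_vertexProb (hN : 1 ≤ N) (δ : Fin N → ℕ → ℝ) (b l : ℕ) :
    ∑ a, vertexProb δ b l a = 1 := by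
  have hN' : (N : ℝ) ≠ 0 := Nat.cast_ne_zero.2 (Nat.one_le_iff_ne_zero.1 hN)
  by_cases h : Even (l + b)
  · simp [vertexProb, vertexWeight, h]
  · rw [sum_eq, ← Finset.sum_add_distrib]
    calc vertexProb δ b l .v + ∑ j : Fin N, (vertexProb δ b l (.u j) + vertexProb δ b l (.w j))
        = ∑ _ : Fin N, (N : ℝ)⁻¹ := by
          simp only [vertexProb, vertexWeight, alphaAt, h, reduceCtorEq, if_true, if_false,
            iff_true, zero_add]
          exact Finset.sum_congr rfl fun j _ => by field_simp; ring
      _ = 1 := by simp [hN']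

/-- The law of the vertex at position `l` of the random walk with vertex probabilities
`vertexProb δ b`. -/
def vertexMeasure (δ : Fin N → ℕ → ℝ) (b l : ℕ) : Measure (StarVertex N) :=
  Measure.count.withDensity fun a => ENNReal.ofReal (vertexProb δ b l a)

theorem vertexMeasure_singleton (δ : Fin N → ℕ → ℝ) (b l : ℕ) (a : StarVertex N) :
    vertexMeasure δ b l {a} = ENNReal.ofReal (vertexProb δ b l a) := by
  simp [vertexMeasure, withDensity_apply]

theorem isProbabilityMeasure_vertexMeasure (hN : 1 ≤ N) (hδ : ∀ j i, |δ j i| < 1) (b l : ℕ) :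
    IsProbabilityMeasure (vertexMeasure δ b l) := by
  refine ⟨?_⟩
  rw [vertexMeasure, withDensity_apply _ .univ, Measure.restrict_univ, lintegral_count,
    tsum_fintype,
    ← ENNReal.ofReal_sum_of_nonneg fun a _ => vertexProb_nonneg (fun j => hδ j l) b a,
    sum_vertexProb hN, ENNReal.ofReal_one]

theorem vertexMeasure_le_smul {δ δ' : Fin N → ℕ → ℝ} {l : ℕ} {c : ℝ} (hc : 0 ≤ c)
    (h : ∀ a, vertexWeight δ l a ≤ c * vertexWeight δ' l a) (b : ℕ) :
    vertexMeasure δ b l ≤ c.toNNReal • vertexMeasure δ' b l := by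
  have hprob : ∀ a, vertexProb δ b l a ≤ c * vertexProb δ' b l a := fun a => by
    unfold vertexProb
    split_ifs
    exacts [h a, (mul_zero c).ge]
  rw [vertexMeasure, vertexMeasure, ENNReal.smul_def c.toNNReal, ← withDensity_smul _ .of_discrete]
  refine withDensity_mono (ae_of_all _ fun a => ?_)
  rw [Pi.smul_apply, smul_eq_mul, ← ENNReal.ofReal, ← ENNReal.ofReal_mul hc]
  exact ENNReal.ofReal_le_ofReal (hprob a)

theorem infinitePi_vertexMeasure_equivalent (hN : 1 ≤ N) (hδ : ∀ j i, |δ j i| < 1)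
    (hsum : ∀ j, Summable fun i => |δ j i|) (b : ℕ) :
    Measure.infinitePi (vertexMeasure δ b) ≪ Measure.infinitePi (vertexMeasure 0 b) ∧
      Measure.infinitePi (vertexMeasure 0 b) ≪ Measure.infinitePi (vertexMeasure δ b) := by
  have := isProbabilityMeasure_vertexMeasure hN hδ b
  have := isProbabilityMeasure_vertexMeasure (δ := (0 : Fin N → ℕ → ℝ)) hN (by simp) b
  have hδ' : ∀ l j, |δ j l| < 1 := fun l j => hδ j l
  have hnorm : ∀ l, ‖fun j => δ j l‖ < 1 := fun l => (pi_norm_lt_iff one_pos).2 (hδ' l)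
  have hsummable : Summable fun l => ‖fun j => δ j l‖ :=
    summable_norm_iff.2 (Pi.summable.2 fun j => summable_norm_iff.1 (hsum j))
  have hinv : ∀ l, 0 ≤ (1 - ‖fun j => δ j l‖)⁻¹ := fun l => inv_nonneg.2 (sub_pos.2 (hnorm l)).le
  obtain ⟨C, hC⟩ := exists_prod_inv_one_sub_le (fun l => norm_nonneg _) hnorm hsummable
  exact ⟨infinitePi_absolutelyContinuous (fun l => vertexMeasure_le_smul (hinv l)
      (vertexWeight_le_mul_vertexWeight_zero (hδ' l)) b) hC,
    infinitePi_absolutelyContinuous (fun l => vertexMeasure_le_smul (hinv l)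
      (vertexWeight_zero_le_mul_vertexWeight (hδ' l)) b) hC⟩

theorem ae_isWalk (hN : 1 ≤ N) (hδ : ∀ j i, |δ j i| < 1) (b : ℕ) :
    ∀ᵐ y ∂(Measure.infinitePi (vertexMeasure δ b)), IsWalk y := by
  have := isProbabilityMeasure_vertexMeasure hN hδ b
  have hparity : ∀ᵐ y ∂(Measure.infinitePi (vertexMeasure δ b)),
      ∀ l, Even (l + b) ↔ y l = .v := by
    refine ae_all_iff.2 fun l => ?_
    have hl : ∀ᵐ a ∂(vertexMeasure δ b l), Even (l + b) ↔ a = .v := by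
      refine (ae_withDensity_iff .of_discrete).2 (ae_of_all _ fun a ha => ?_)
      by_contra hne
      simp [vertexProb, hne] at ha
    exact (measurePreserving_eval_infinitePi (vertexMeasure δ b) l).quasiMeasurePreserving.ae hl
  filter_upwards [hparity] with y hy l
  have hl := hy l
  have hsucc := hy (l + 1)
  rw [add_right_comm, Nat.even_add_one] at hsucc
  unfold Xor
  tauto

end StarVertex

theorem prod_range_two_mul_add_one {M : Type*} [CommMonoid M] (f : ℕ → M) (n : ℕ) :
    ∏ l ∈ Finset.range (2 * n + 1), f l
      = (∏ i ∈ Finset.Icc 0 n, f (2 * i)) * ∏ i ∈ Finset.Icc 1 n, f (2 * i - 1) := by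
  induction n with
  | zero => simp
  | succ n ih =>
    rw [show 2 * (n + 1) + 1 = 2 * n + 1 + 1 + 1 by ring, Finset.prod_range_succ,
      Finset.prod_range_succ, ih, Finset.prod_Icc_succ_top (by lia),
      Finset.prod_Icc_succ_top (by lia), show 2 * (n + 1) - 1 = 2 * n + 1 by lia,
      show 2 * (n + 1) = 2 * n + 1 + 1 by ring, mul_mul_mul_comm, mul_assoc,
      mul_comm (f (2 * n + 1))]

namespace IsLambda2N

open KGraph StarVertex InfPath

variable {N : ℕ} {P : Type u} {Λ : KGraph 2 (StarVertex N) P} (hΛ : IsLambda2N Λ)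

include hΛ

theorem prod_vertexWeight (δ : Fin N → ℕ → ℝ) {n : ℕ} {η : P} (h : Λ.d η = fun _ => n) :
    ∏ l ∈ Finset.range (2 * n + 1), vertexWeight δ l (Λ.vertexAt η (altPos l))
      = productWeight Λ δ n η := by
  have h' : Λ.d η = altPos (2 * n) := h.trans (altPos_two_mul n).symm
  have hv : ∀ {l}, l ≤ 2 * n → (Λ.vertexAt η (altPos l) = .v ↔ (Even l ↔ Λ.r η = .v)) :=
    fun hl => hΛ.vertexAt_eq_v_iff h' hl
  have hodd : ∀ {i}, 1 ≤ i → ¬ Even (2 * i - 1) := fun {i} hi =>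
    Nat.not_even_iff_odd.2 ⟨i - 1, by lia⟩
  rw [prod_range_two_mul_add_one, productWeight]
  split_ifs with hr
  · rw [Finset.prod_eq_one, one_mul]
    · refine Finset.prod_congr rfl fun i hi => ?_
      obtain ⟨hi₁, hin⟩ := Finset.mem_Icc.1 hi
      exact if_neg fun e => hodd hi₁ (((hv (by lia)).1 e).2 hr)
    · intro i hi
      exact if_pos ((hv (Nat.mul_le_mul_left 2 (Finset.mem_Icc.1 hi).2)).2 (by simp [hr]))
  · rw [mul_comm, Finset.prod_eq_one, one_mul]
    · refine Finset.prod_congr rfl fun i hi => ?_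
      exact if_neg fun e =>
        hr (((hv (Nat.mul_le_mul_left 2 (Finset.mem_Icc.1 hi).2)).1 e).1 (even_two_mul i))
    · intro i hi
      obtain ⟨hi₁, hin⟩ := Finset.mem_Icc.1 hi
      exact if_pos ((hv (by lia)).2 (by simp [hr, hodd hi₁]))

theorem prod_vertexProb (δ : Fin N → ℕ → ℝ) (b : ℕ) {n : ℕ} {η : P} (h : Λ.d η = fun _ => n) :
    ∏ l ∈ Finset.range (2 * n + 1), vertexProb δ b l (Λ.vertexAt η (altPos l))
      = if Even b ↔ Λ.r η = .v then productWeight Λ δ n η else 0 := by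
  have h' : Λ.d η = altPos (2 * n) := h.trans (altPos_two_mul n).symm
  have hprob : ∀ l ∈ Finset.range (2 * n + 1), vertexProb δ b l (Λ.vertexAt η (altPos l))
      = if Even b ↔ Λ.r η = .v then vertexWeight δ l (Λ.vertexAt η (altPos l)) else 0 :=
    fun l hl => if_congr (by
      rw [Nat.even_add, hΛ.vertexAt_eq_v_iff h' (Finset.mem_range_succ_iff.1 hl)]
      tauto) rfl rfl
  rw [Finset.prod_congr rfl hprob]
  split_ifs
  · exact hΛ.prod_vertexWeight δ h
  · exact Finset.prod_eq_zero (Finset.mem_range.2 (Nat.succ_pos _)) rfl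

end IsLambda2N

/-- The law, on infinite paths, of the random walk with vertex probabilities `vertexProb δ b`. -/
def KGraph.pathMeasure {N : ℕ} {P : Type u} (Λ : KGraph 2 (StarVertex N) P)
    (δ : Fin N → ℕ → ℝ) (b : ℕ) : Measure Λ.InfPath :=
  (Measure.infinitePi (StarVertex.vertexMeasure δ b)).comap InfPath.vertexSeq

namespace IsLambda2N

open KGraph StarVertex InfPath

variable {N : ℕ} {P : Type u} {Λ : KGraph 2 (StarVertex N) P} (hΛ : IsLambda2N Λ)
  {δ : Fin N → ℕ → ℝ}

include hΛ

theorem pathMeasure_cylinder (hN : 1 ≤ N) (hδ : ∀ j i, |δ j i| < 1) (b : ℕ) {n : ℕ} {η : P}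
    (h : Λ.d η = fun _ => n) :
    Λ.pathMeasure δ b (Λ.cylinder η)
      = if Even b ↔ Λ.r η = .v then ENNReal.ofReal (productWeight Λ δ n η) else 0 := by
  have := isProbabilityMeasure_vertexMeasure hN hδ b
  have himage : vertexSeq '' Λ.cylinder η =ᵐ[Measure.infinitePi (vertexMeasure δ b)]
      Set.pi (Finset.range (2 * n + 1)) fun l => {Λ.vertexAt η (altPos l)} := by
    filter_upwards [ae_isWalk hN hδ b] with y hy
    obtain ⟨x, rfl⟩ := hΛ.range_vertexSeq.ge hy
    exact propext (hΛ.injective_vertexSeq.mem_set_image.trans (hΛ.mem_cylinder_iff_vertexSeq h))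
  rw [pathMeasure, hΛ.measurableEmbedding_vertexSeq.comap_apply, measure_congr himage,
    Measure.infinitePi_pi _ fun l _ => .of_discrete]
  simp only [vertexMeasure_singleton]
  rw [← ENNReal.ofReal_prod_of_nonneg fun l _ => vertexProb_nonneg (fun j => hδ j l) b _,
    hΛ.prod_vertexProb δ b h, apply_ite ENNReal.ofReal, ENNReal.ofReal_zero]

theorem pathMeasure_equivalent (hN : 1 ≤ N) (hδ : ∀ j i, |δ j i| < 1)
    (hsum : ∀ j, Summable fun i => |δ j i|) (b : ℕ) :
    Λ.pathMeasure δ b ≪ Λ.pathMeasure 0 b ∧ Λ.pathMeasure 0 b ≪ Λ.pathMeasure δ b := by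
  obtain ⟨h₁, h₂⟩ := infinitePi_vertexMeasure_equivalent hN hδ hsum b
  constructor <;> intro s hs <;>
    rw [pathMeasure, hΛ.measurableEmbedding_vertexSeq.comap_apply] at hs ⊢
  exacts [h₁ hs, h₂ hs]

theorem isProductMeasure_pathMeasure (hN : 1 ≤ N) (hδ : ∀ j i, |δ j i| < 1) :
    IsProductMeasure Λ δ (Λ.pathMeasure δ 0 + Λ.pathMeasure δ 1) := by
  intro n η h
  rw [Measure.add_apply, hΛ.pathMeasure_cylinder hN hδ 0 h, hΛ.pathMeasure_cylinder hN hδ 1 h]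
  by_cases hr : Λ.r η = .v <;> simp [hr]

end IsLambda2N

namespace IsProductMeasure

variable {N : ℕ} {P : Type u} {Λ : KGraph 2 (StarVertex N) P} {δ : Fin N → ℕ → ℝ}
  {μ ν : Measure Λ.InfPath}

theorem unique (hμ : IsProductMeasure Λ δ μ) (hν : IsProductMeasure Λ δ ν) : μ = ν :=
  KGraph.measure_ext (fun w => (hμ 0 _ (Λ.d_idp w)).trans_ne ENNReal.ofReal_ne_top)
    fun n η h => (hμ n η h).trans (hν n η h).symm

end IsProductMeasure

/-! ### Perron-Frobenius measures -/

section SpectralRadius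

variable {n : Type*} [Fintype n]

theorem nonneg_of_mulVec_eq_smul [Nonempty n] {A : Matrix n n ℝ} (hA : ∀ i j, 0 ≤ A i j)
    {κ : n → ℝ} (hκ : ∀ i, 0 < κ i) {ρ : ℝ} (hρ : A.mulVec κ = ρ • κ) : 0 ≤ ρ := by
  let i := Classical.arbitrary n
  refine nonneg_of_mul_nonneg_left (le_of_le_of_eq ?_ (congrFun hρ i)) (hκ i)
  exact Finset.sum_nonneg fun j _ => mul_nonneg (hA i j) (hκ j).le

theorem norm_le_of_mulVec_eq_smul {A : Matrix n n ℝ} (hA : ∀ i j, 0 ≤ A i j) {κ : n → ℝ}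
    (hκ : ∀ i, 0 < κ i) {ρ : ℝ} (hρ : A.mulVec κ = ρ • κ) {f : n → ℂ} (hf : f ≠ 0) {z : ℂ}
    (hz : (A.map ((↑) : ℝ → ℂ)).mulVec f = z • f) : ‖z‖ ≤ ρ := by
  obtain ⟨j, hj⟩ := Function.ne_iff.1 hf
  have : Nonempty n := ⟨j⟩
  obtain ⟨i, hi⟩ := Finite.exists_max fun i => ‖f i‖ / κ i
  have hpos : 0 < ‖f i‖ / κ i := (div_pos (norm_pos_iff.2 hj) (hκ j)).trans_le (hi j)
  refine le_of_mul_le_mul_right ?_ ((div_pos_iff_of_pos_right (hκ i)).1 hpos)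
  calc ‖z‖ * ‖f i‖ = ‖∑ j, (A i j : ℂ) * f j‖ := by
        rw [← norm_mul]
        exact congrArg _ (congrFun hz i).symm
    _ ≤ ∑ j, A i j * (‖f i‖ / κ i * κ j) := by
        refine (norm_sum_le _ _).trans (Finset.sum_le_sum fun j _ => ?_)
        rw [norm_mul, Complex.norm_of_nonneg (hA i j)]
        exact mul_le_mul_of_nonneg_left ((div_le_iff₀ (hκ j)).1 (hi j)) (hA i j)
    _ = ‖f i‖ / κ i * A.mulVec κ i := by
        rw [Matrix.mulVec, dotProduct, Finset.mul_sum]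
        exact Finset.sum_congr rfl fun j _ => mul_left_comm _ _ _
    _ = ρ * ‖f i‖ := by
        rw [hρ, Pi.smul_apply, smul_eq_mul]
        have := (hκ i).ne'
        field_simp

variable [DecidableEq n]

theorem mem_spectrum_iff_exists_mulVec_eq_smul {A : Matrix n n ℂ} {z : ℂ} :
    z ∈ spectrum ℂ A ↔ ∃ f ≠ 0, A.mulVec f = z • f := by
  rw [← Matrix.spectrum_toLin', ← Module.End.hasEigenvalue_iff_mem_spectrum]
  constructor
  · intro h
    obtain ⟨f, hf⟩ := h.exists_hasEigenvector
    exact ⟨f, hf.2, hf.apply_eq_smul⟩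
  · rintro ⟨f, hf, h⟩
    exact Module.End.hasEigenvalue_of_hasEigenvector
      (Module.End.hasEigenvector_iff.2 ⟨Module.End.mem_eigenspace_iff.2 h, hf⟩)

theorem spectralRadius_map_ofReal_of_mulVec_eq_smul [Nonempty n] {A : Matrix n n ℝ}
    (hA : ∀ i j, 0 ≤ A i j) {κ : n → ℝ} (hκ : ∀ i, 0 < κ i) {ρ : ℝ}
    (hρ : A.mulVec κ = ρ • κ) :
    spectralRadius ℂ (A.map ((↑) : ℝ → ℂ)) = ENNReal.ofReal ρ := by
  have hκ' : (fun i => (κ i : ℂ)) ≠ 0 := fun h =>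
    (hκ (Classical.arbitrary n)).ne' (Complex.ofReal_eq_zero.1 (congrFun h _))
  have heigen : (A.map ((↑) : ℝ → ℂ)).mulVec (fun i => (κ i : ℂ))
      = (ρ : ℂ) • fun i => (κ i : ℂ) := by
    ext i
    have := congrFun hρ i
    simp only [Matrix.mulVec, dotProduct, Matrix.map_apply, Pi.smul_apply, smul_eq_mul] at this ⊢
    exact_mod_cast this
  refine le_antisymm (iSup₂_le fun z hz => ?_) ?_
  · obtain ⟨f, hf, h⟩ := mem_spectrum_iff_exists_mulVec_eq_smul.1 hz
    rw [← enorm_eq_nnnorm, ← ofReal_norm]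
    exact ENNReal.ofReal_le_ofReal (norm_le_of_mulVec_eq_smul hA hκ hρ hf h)
  · refine le_trans ?_ (le_iSup₂ (f := fun z _ => (‖z‖₊ : ℝ≥0∞)) (ρ : ℂ)
      (mem_spectrum_iff_exists_mulVec_eq_smul.2 ⟨_, hκ', heigen⟩))
    rw [← enorm_eq_nnnorm, ← ofReal_norm,
      Complex.norm_of_nonneg (nonneg_of_mulVec_eq_smul hA hκ hρ)]

end SpectralRadius

namespace KGraph

variable {k : ℕ} {V P : Type*} {Λ : KGraph k V P}

theorem measure_cylinder_eq_tsum (M : Measure Λ.InfPath) (a : P) (m : Fin k → ℕ) :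
    M (Λ.cylinder a) = ∑' b : {b : P // Λ.d b = m ∧ Λ.r b = Λ.s a},
      M (Λ.cylinder (Λ.comp a b b.2.2.symm)) := by
  have := Λ.countable
  have hunion : Λ.cylinder a = ⋃ b : {b : P // Λ.d b = m ∧ Λ.r b = Λ.s a},
      Λ.cylinder (Λ.comp a b b.2.2.symm) := by
    ext x
    simp only [mem_iUnion, mem_cylinder_comp]
    refine ⟨fun hx => ?_, fun ⟨_, hx⟩ => hx.1⟩
    refine ⟨⟨(x.shift (Λ.d a)).map 0 m zero_le, InfPath.d_map_zero _ _, ?_⟩, hx,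
      InfPath.mem_cylinder_map _ _⟩
    rw [InfPath.r_map, x.shift_obj_zero, obj_d_of_mem_cylinder hx]
  have hdisj : Pairwise fun b b' : {b : P // Λ.d b = m ∧ Λ.r b = Λ.s a} => Disjoint
      (Λ.cylinder (Λ.comp a b b.2.2.symm)) (Λ.cylinder (Λ.comp a b' b'.2.2.symm)) :=
    fun b b' hbb => disjoint_cylinder (by rw [Λ.d_comp, Λ.d_comp, b.2.1, b'.2.1]) fun h =>
      hbb (Subtype.ext (Λ.comp_inj _ _ h rfl).2)
  rw [hunion, measure_iUnion hdisj fun b => measurableSet_cylinder _]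

theorem isFiniteMeasure_of_cylinder [Finite V] {μ : Measure Λ.InfPath}
    (h : ∀ w, μ (Λ.cylinder (Λ.idp w)) ≠ ∞) : IsFiniteMeasure μ := by
  have := Fintype.ofFinite V
  have hU : (univ : Set Λ.InfPath) = ⋃ w, Λ.cylinder (Λ.idp w) :=
    (eq_univ_of_forall fun x => mem_iUnion.2 ⟨x.obj 0, mem_cylinder_idp.2 rfl⟩).symm
  refine ⟨hU ▸ (measure_iUnion_le _).trans_lt ?_⟩
  rw [tsum_fintype]
  exact ENNReal.sum_lt_top.2 fun w _ => (h w).lt_top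

variable [Fintype V]

theorem tsum_edges_eq_mulVec {i : Fin k}
    (hfin : ∀ v w, Finite {a : P // Λ.d a = Pi.single i 1 ∧ Λ.r a = v ∧ Λ.s a = w})
    {κ : V → ℝ} (hκ : ∀ w, 0 ≤ κ w) (v : V) :
    ∑' b : {b : P // Λ.d b = Pi.single i 1 ∧ Λ.r b = v}, ENNReal.ofReal (κ (Λ.s b))
      = ENNReal.ofReal (((Λ.vertexMatrix i).map (Nat.cast : ℕ → ℝ)).mulVec κ v) := by
  have hmul : ((Λ.vertexMatrix i).map (Nat.cast : ℕ → ℝ)).mulVec κ v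
      = ∑ w, (Λ.vertexMatrix i v w : ℝ) * κ w := rfl
  rw [hmul, ENNReal.ofReal_sum_of_nonneg fun w _ =>
      mul_nonneg (Nat.cast_nonneg _) (hκ w), ← tsum_fintype (L := .unconditional V),
    ← (Equiv.sigmaFiberEquiv fun b : {b : P // Λ.d b = Pi.single i 1 ∧ Λ.r b = v} =>
      Λ.s b).tsum_eq, ENNReal.tsum_sigma']
  refine tsum_congr fun w => ?_
  let e : {b : {b : P // Λ.d b = Pi.single i 1 ∧ Λ.r b = v} // Λ.s b = w}
      ≃ {a : P // Λ.d a = Pi.single i 1 ∧ Λ.r a = v ∧ Λ.s a = w} :=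
    (Equiv.subtypeSubtypeEquivSubtypeInter
      (fun b => Λ.d b = Pi.single i 1 ∧ Λ.r b = v) fun b => Λ.s b = w).trans
      (Equiv.subtypeEquivRight fun _ => and_assoc)
  have := hfin v w
  have hsum : ∀ b : {b : {b : P // Λ.d b = Pi.single i 1 ∧ Λ.r b = v} // Λ.s b = w},
      ENNReal.ofReal (κ (Λ.s (Equiv.sigmaFiberEquiv
        (fun b : {b : P // Λ.d b = Pi.single i 1 ∧ Λ.r b = v} => Λ.s b) ⟨w, b⟩)))
        = ENNReal.ofReal (κ w) :=
    fun b => congrArg (fun w => ENNReal.ofReal (κ w)) b.2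
  rw [tsum_congr hsum, ENNReal.tsum_const, ENat.card_congr e, ENat.card_eq_coe_natCard,
    ENNReal.ofReal_mul (Nat.cast_nonneg _), ENNReal.ofReal_natCast]
  rfl

variable [DecidableEq V]

theorem rho_eq_of_mulVec_eq_smul [Nonempty V] {i : Fin k} {κ : V → ℝ} (hκ : ∀ w, 0 < κ w) {ρ : ℝ}
    (h : ((Λ.vertexMatrix i).map (Nat.cast : ℕ → ℝ)).mulVec κ = ρ • κ) : Λ.rho i = ρ := by
  have hcast : (Λ.vertexMatrix i).map (Nat.cast : ℕ → ℂ)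
      = ((Λ.vertexMatrix i).map (Nat.cast : ℕ → ℝ)).map ((↑) : ℝ → ℂ) := by
    ext v w
    simp
  have hA : ∀ v w, 0 ≤ (Λ.vertexMatrix i).map (Nat.cast : ℕ → ℝ) v w :=
    fun _ _ => Nat.cast_nonneg _
  rw [rho, hcast, spectralRadius_map_ofReal_of_mulVec_eq_smul hA hκ h,
    ENNReal.toReal_ofReal (nonneg_of_mulVec_eq_smul hA hκ h)]

/-- The number `ρ(Λ)^{-m} = ρ₁^{-m₁} ⋯ ρₖ^{-mₖ}`. -/
def rhoPowNeg (Λ : KGraph k V P) (m : Fin k → ℕ) : ℝ := ∏ i, (Λ.rho i)⁻¹ ^ m i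

theorem rhoPowNeg_add (m n : Fin k → ℕ) :
    Λ.rhoPowNeg (m + n) = Λ.rhoPowNeg m * Λ.rhoPowNeg n := by
  simp only [rhoPowNeg, Pi.add_apply, pow_add, Finset.prod_mul_distrib]

theorem rhoPowNeg_single (i : Fin k) : Λ.rhoPowNeg (Pi.single i 1) = (Λ.rho i)⁻¹ := by
  rw [rhoPowNeg, Finset.prod_eq_single i (fun j _ hj => by simp [hj]) (by simp)]
  simp

theorem rhoPowNeg_nonneg (m : Fin k → ℕ) : 0 ≤ Λ.rhoPowNeg m :=
  Finset.prod_nonneg fun _ _ => pow_nonneg (inv_nonneg.2 ENNReal.toReal_nonneg) _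

theorem rhoPowNeg_pos (hρ : ∀ i, 0 < Λ.rho i) (m : Fin k → ℕ) : 0 < Λ.rhoPowNeg m :=
  Finset.prod_pos fun i _ => pow_pos (inv_pos.2 (hρ i)) _

namespace IsPerronFrobeniusVector

variable {κ : V → ℝ} (hκ : Λ.IsPerronFrobeniusVector κ) (hρ : ∀ i, 0 < Λ.rho i)
  (hfin : ∀ i v w, Finite {a : P // Λ.d a = Pi.single i 1 ∧ Λ.r a = v ∧ Λ.s a = w})
  {M : Measure Λ.InfPath}

include hκ hρ hfin

theorem measure_cylinder_of_add_single {p : Fin k → ℕ} (i : Fin k)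
    (h : ∀ a, Λ.d a = p + Pi.single i 1 →
      M (Λ.cylinder a) = ENNReal.ofReal (Λ.rhoPowNeg (Λ.d a) * κ (Λ.s a)))
    {a : P} (ha : Λ.d a = p) :
    M (Λ.cylinder a) = ENNReal.ofReal (Λ.rhoPowNeg (Λ.d a) * κ (Λ.s a)) := by
  have hedge : ∀ b : {b : P // Λ.d b = Pi.single i 1 ∧ Λ.r b = Λ.s a},
      M (Λ.cylinder (Λ.comp a b b.2.2.symm))
        = ENNReal.ofReal (Λ.rhoPowNeg p * (Λ.rho i)⁻¹) * ENNReal.ofReal (κ (Λ.s b)) := fun b => by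
    have hd : Λ.d (Λ.comp a b b.2.2.symm) = p + Pi.single i 1 := by rw [Λ.d_comp, ha, b.2.1]
    rw [h _ hd, hd, Λ.s_comp, rhoPowNeg_add, rhoPowNeg_single, ENNReal.ofReal_mul]
    exact mul_nonneg (rhoPowNeg_nonneg p) (inv_nonneg.2 (hρ i).le)
  rw [measure_cylinder_eq_tsum M a (Pi.single i 1), tsum_congr hedge, ENNReal.tsum_mul_left,
    tsum_edges_eq_mulVec (hfin i) (fun w => (hκ.1 w).le), hκ.2.2 i,
    ← ENNReal.ofReal_mul (mul_nonneg (rhoPowNeg_nonneg p) (inv_nonneg.2 (hρ i).le)),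
    Pi.smul_apply, smul_eq_mul, ha, mul_assoc, inv_mul_cancel_left₀ (hρ i).ne']

theorem measure_cylinder_of_add {p q : Fin k → ℕ}
    (h : ∀ a, Λ.d a = p + q →
      M (Λ.cylinder a) = ENNReal.ofReal (Λ.rhoPowNeg (Λ.d a) * κ (Λ.s a)))
    {a : P} (ha : Λ.d a = p) :
    M (Λ.cylinder a) = ENNReal.ofReal (Λ.rhoPowNeg (Λ.d a) * κ (Λ.s a)) := by
  let Q : AddSubmonoid (Fin k → ℕ) :=
    { carrier := {q | ∀ p, (∀ a, Λ.d a = p + q →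
          M (Λ.cylinder a) = ENNReal.ofReal (Λ.rhoPowNeg (Λ.d a) * κ (Λ.s a))) →
        ∀ a, Λ.d a = p → M (Λ.cylinder a) = ENNReal.ofReal (Λ.rhoPowNeg (Λ.d a) * κ (Λ.s a))}
      zero_mem' := fun p h => by simpa only [add_zero] using h
      add_mem' := fun {q q'} hq hq' p h =>
        hq p (hq' (p + q) (by simpa only [add_assoc] using h)) }
  have hsingle : ∀ i, Pi.single i 1 ∈ Q := fun i p h a ha =>
    hκ.measure_cylinder_of_add_single hρ hfin i h ha
  have hq : q ∈ Q := by
    rw [pi_eq_sum_univ' q]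
    exact sum_mem fun i _ => nsmul_mem (hsingle i) _
  exact hq p h a ha

theorem measure_cylinder_of_diagonal
    (h : ∀ n a, Λ.d a = (fun _ => n) →
      M (Λ.cylinder a) = ENNReal.ofReal (Λ.rhoPowNeg (Λ.d a) * κ (Λ.s a))) (a : P) :
    M (Λ.cylinder a) = ENNReal.ofReal (Λ.rhoPowNeg (Λ.d a) * κ (Λ.s a)) := by
  have hle : Λ.d a ≤ fun _ => ∑ j, Λ.d a j :=
    fun i => Finset.single_le_sum (fun _ _ => Nat.zero_le _) (Finset.mem_univ i)
  exact hκ.measure_cylinder_of_add hρ hfin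
    (fun b hb => h _ b (hb.trans (add_tsub_cancel_of_le hle))) rfl

end IsPerronFrobeniusVector

namespace IsPerronFrobeniusMeasure

variable {M : Measure Λ.InfPath} (hM : Λ.IsPerronFrobeniusMeasure M)

include hM

theorem measure_cylinder_comp {a b : P} (h : Λ.s a = Λ.r b) :
    M (Λ.cylinder (Λ.comp a b h))
      = ENNReal.ofReal (Λ.rhoPowNeg (Λ.d a)) * M (Λ.cylinder b) := by
  obtain ⟨κ, -, hκ⟩ := hM
  rw [hκ, hκ, ← ENNReal.ofReal_mul (rhoPowNeg_nonneg _), ← mul_assoc, Λ.s_comp, Λ.d_comp]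
  exact congrArg (fun c => ENNReal.ofReal (c * κ (Λ.s b))) (rhoPowNeg_add _ _)

theorem isFiniteMeasure : IsFiniteMeasure M := by
  obtain ⟨κ, -, hκ⟩ := hM
  exact isFiniteMeasure_of_cylinder fun w => (hκ _).trans_ne ENNReal.ofReal_ne_top

theorem standardSemibranching (hρ : ∀ i, 0 < Λ.rho i) : Λ.StandardSemibranching M := by
  have := hM.isFiniteMeasure
  refine standardSemibranching_of_isBranch (fun w => ?_) fun a => isBranch_stdPrefix
    (ENNReal.ofReal_pos.2 (rhoPowNeg_pos hρ (Λ.d a))).ne' fun b hab => hM.measure_cylinder_comp hab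
  obtain ⟨κ, hκ, hcyl⟩ := hM
  rw [hcyl]
  exact ENNReal.ofReal_pos.2 (mul_pos (rhoPowNeg_pos hρ _) (hκ.1 _))

end IsPerronFrobeniusMeasure

end KGraph

/-- The common Perron-Frobenius vector of the two vertex matrices of `Λ_{2N}`, normalised to have
sum `1`; the eigenvalue is `√(2N)`. -/
def StarVertex.perronVector (N : ℕ) : StarVertex N → ℝ
  | .v => (1 + √(2 * N))⁻¹
  | _ => (√(2 * N) * (1 + √(2 * N)))⁻¹

/-- The Perron-Frobenius measure on `Λ_{2N}^∞`: a path with range `v` has probability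
`(1 + √(2N))⁻¹`, the entry of the Perron-Frobenius vector at `v`. -/
def KGraph.perronMeasure {N : ℕ} {P : Type u} (Λ : KGraph 2 (StarVertex N) P) :
    Measure Λ.InfPath :=
  ENNReal.ofReal (1 + √(2 * N))⁻¹ • Λ.pathMeasure 0 0
    + ENNReal.ofReal (√(2 * N) * (1 + √(2 * N))⁻¹) • Λ.pathMeasure 0 1

open KGraph StarVertex

namespace StarVertex

variable {N : ℕ}

theorem perronVector_pos (hN : 1 ≤ N) (a : StarVertex N) : 0 < perronVector N a := by
  cases a <;> simp only [perronVector] <;> positivity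

theorem sum_perronVector (hN : 1 ≤ N) : ∑ a, perronVector N a = 1 := by
  have hsq : (2 * N : ℝ) = √(2 * N) * √(2 * N) := (Real.mul_self_sqrt (by positivity)).symm
  calc ∑ a, perronVector N a
      = (1 + √(2 * N))⁻¹ + 2 * N * (√(2 * N) * (1 + √(2 * N)))⁻¹ := by
        rw [sum_eq]
        simp only [perronVector, Finset.sum_const, Finset.card_univ, Fintype.card_fin,
          nsmul_eq_mul]
        ring
    _ = 1 := by
        nth_rewrite 2 [hsq]
        have : 1 + √(2 * N : ℝ) ≠ 0 := by positivity
        field_simp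

theorem prod_one_add_alphaAt_zero {ι : Type*} (s : Finset ι) (l : ι → ℕ)
    (a : ι → StarVertex N) :
    ∏ i ∈ s, (1 + alphaAt 0 (l i) (a i)) / (2 * N) = (2 * N : ℝ)⁻¹ ^ s.card := by
  refine Finset.prod_eq_pow_card fun i _ => ?_
  cases a i <;> simp [alphaAt]

end StarVertex

namespace IsLambda2N

variable {N : ℕ} {P : Type u} {Λ : KGraph 2 (StarVertex N) P} (hΛ : IsLambda2N Λ)

include hΛ

theorem finite_edges (i : Fin 2) (a b : StarVertex N) :
    Finite {e : P // Λ.d e = Pi.single i 1 ∧ Λ.r e = a ∧ Λ.s e = b} :=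
  have : Subsingleton {e : P // Λ.d e = Pi.single i 1 ∧ Λ.r e = a ∧ Λ.s e = b} :=
    ⟨fun e e' => Subtype.ext <| hΛ.edge_unique e.2.1 e'.2.1 (e.2.2.1.trans e'.2.2.1.symm)
      (e.2.2.2.trans e'.2.2.2.symm)⟩
  inferInstance

open Classical in
theorem vertexMatrix_apply (i : Fin 2) (a b : StarVertex N) :
    Λ.vertexMatrix i a b = if Xor (a = .v) (b = .v) then 1 else 0 := by
  rw [vertexMatrix]
  split_ifs with h
  · obtain ⟨e, he, huniq⟩ := (hΛ i a b).1 h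
    rw [Nat.card_eq_one_iff_unique]
    exact ⟨⟨fun x y => Subtype.ext ((huniq _ x.2).trans (huniq _ y.2).symm)⟩, ⟨⟨e, he⟩⟩⟩
  · have : IsEmpty {e : P // Λ.d e = Pi.single i 1 ∧ Λ.r e = a ∧ Λ.s e = b} :=
      ⟨fun e => h ((hΛ i a b).2 ⟨e.1, e.2⟩)⟩
    exact Nat.card_of_isEmpty

theorem mulVec_v (i : Fin 2) (κ : StarVertex N → ℝ) :
    ((Λ.vertexMatrix i).map (Nat.cast : ℕ → ℝ)).mulVec κ .v
      = ∑ j, κ (.u j) + ∑ j, κ (.w j) := by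
  classical
  simp [Matrix.mulVec, dotProduct, hΛ.vertexMatrix_apply, StarVertex.sum_eq]

theorem mulVec_of_ne (i : Fin 2) (κ : StarVertex N → ℝ) {a : StarVertex N} (ha : a ≠ .v) :
    ((Λ.vertexMatrix i).map (Nat.cast : ℕ → ℝ)).mulVec κ a = κ .v := by
  classical
  simp [Matrix.mulVec, dotProduct, hΛ.vertexMatrix_apply, ha]

theorem mulVec_perronVector (hN : 1 ≤ N) (i : Fin 2) :
    ((Λ.vertexMatrix i).map (Nat.cast : ℕ → ℝ)).mulVec (perronVector N)
      = √(2 * N) • perronVector N := by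
  have hρ : √(2 * N : ℝ) ≠ 0 := by positivity
  ext a
  rw [Pi.smul_apply, smul_eq_mul]
  by_cases ha : a = .v
  · have hsum := sum_perronVector hN
    rw [StarVertex.sum_eq] at hsum
    rw [ha, hΛ.mulVec_v, eq_sub_of_add_eq' hsum, perronVector]
    have : 1 + √(2 * N : ℝ) ≠ 0 := by positivity
    field_simp
    ring
  · rw [hΛ.mulVec_of_ne i _ ha]
    cases a <;> first | exact absurd rfl ha | simp only [perronVector]; field_simp

theorem rho_eq (hN : 1 ≤ N) (i : Fin 2) : Λ.rho i = √(2 * N) :=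
  have : Nonempty (StarVertex N) := ⟨.v⟩
  rho_eq_of_mulVec_eq_smul (perronVector_pos hN) (hΛ.mulVec_perronVector hN i)

theorem rho_pos (hN : 1 ≤ N) (i : Fin 2) : 0 < Λ.rho i := by
  rw [hΛ.rho_eq hN]
  positivity

theorem isPerronFrobeniusVector_perronVector (hN : 1 ≤ N) :
    Λ.IsPerronFrobeniusVector (perronVector N) :=
  ⟨perronVector_pos hN, sum_perronVector hN, fun i =>
    (hΛ.mulVec_perronVector hN i).trans (by rw [hΛ.rho_eq hN])⟩

theorem perronFrobeniusVector_unique {κ κ' : StarVertex N → ℝ}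
    (hκ : Λ.IsPerronFrobeniusVector κ) (hκ' : Λ.IsPerronFrobeniusVector κ') : κ = κ' := by
  have hρ : ∀ {κ : StarVertex N → ℝ} (_ : Λ.IsPerronFrobeniusVector κ) {a}, a ≠ .v →
      κ .v = Λ.rho 0 * κ a :=
    fun {κ} h {a} ha => (hΛ.mulVec_of_ne 0 κ ha).symm.trans (congrFun (h.2.2 0) a)
  have hprop : ∀ a, κ' .v * κ a = κ .v * κ' a := fun a => by
    by_cases ha : a = .v
    · rw [ha, mul_comm]
    · rw [hρ hκ ha, hρ hκ' ha]
      ring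
  have hv : κ' .v = κ .v := by
    simpa only [← Finset.mul_sum, hκ.2.1, hκ'.2.1, mul_one] using
      Finset.sum_congr (rfl : Finset.univ = Finset.univ) fun a _ => hprop a
  exact funext fun a => mul_left_cancel₀ (hκ.1 .v).ne' (hv ▸ hprop a)

theorem perronFrobeniusMeasure_unique {M M' : Measure Λ.InfPath}
    (hM : Λ.IsPerronFrobeniusMeasure M) (hM' : Λ.IsPerronFrobeniusMeasure M') : M = M' := by
  obtain ⟨κ, hκ, h⟩ := hM
  obtain ⟨κ', hκ', h'⟩ := hM'
  obtain rfl := hΛ.perronFrobeniusVector_unique hκ hκ'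
  exact measure_ext (fun w => (h _).trans_ne ENNReal.ofReal_ne_top)
    fun n a _ => (h a).trans (h' a).symm

theorem rhoPowNeg_diagonal (hN : 1 ≤ N) (n : ℕ) :
    Λ.rhoPowNeg (fun _ => n) = (2 * N : ℝ)⁻¹ ^ n := by
  rw [rhoPowNeg, Fin.prod_univ_two, hΛ.rho_eq hN, hΛ.rho_eq hN, ← mul_pow, ← mul_inv,
    Real.mul_self_sqrt (by positivity)]

theorem s_eq_v_iff {n : ℕ} {η : P} (h : Λ.d η = fun _ => n) : Λ.s η = .v ↔ Λ.r η = .v := by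
  have h' : Λ.d η = altPos (2 * n) := h.trans (altPos_two_mul n).symm
  rw [← vertexAt_d, h', hΛ.vertexAt_eq_v_iff h' le_rfl]
  simp

theorem perronVector_s {n : ℕ} {η : P} (h : Λ.d η = fun _ => n) :
    perronVector N (Λ.s η)
      = if Λ.r η = .v then (1 + √(2 * N))⁻¹ else (√(2 * N) * (1 + √(2 * N)))⁻¹ := by
  simp only [← hΛ.s_eq_v_iff h]
  cases Λ.s η <;> simp [perronVector]

theorem perronMeasure_cylinder (hN : 1 ≤ N) {n : ℕ} {η : P} (h : Λ.d η = fun _ => n) :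
    Λ.perronMeasure (Λ.cylinder η)
      = ENNReal.ofReal (Λ.rhoPowNeg (Λ.d η) * perronVector N (Λ.s η)) := by
  have hδ : ∀ (j : Fin N) (i : ℕ), |(0 : Fin N → ℕ → ℝ) j i| < 1 := by simp
  rw [perronMeasure, Measure.add_apply, Measure.smul_apply, Measure.smul_apply,
    hΛ.pathMeasure_cylinder hN hδ 0 h, hΛ.pathMeasure_cylinder hN hδ 1 h, productWeight,
    hΛ.perronVector_s h, h, hΛ.rhoPowNeg_diagonal hN]
  simp only [prod_one_add_alphaAt_zero, Nat.card_Icc, Nat.add_sub_cancel, Nat.sub_zero]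
  by_cases hr : Λ.r η = .v
  · simp only [hr, if_true, Even.zero, Nat.not_even_one, if_false, smul_eq_mul, mul_zero,
      add_zero, iff_true]
    rw [← ENNReal.ofReal_mul (by positivity), mul_comm]
  · simp only [hr, if_false, Even.zero, Nat.not_even_one, smul_eq_mul, mul_zero, zero_add,
      iff_false, not_true, if_true]
    rw [← ENNReal.ofReal_mul (by positivity), pow_succ]
    nth_rewrite 4 [← Real.mul_self_sqrt (show (0 : ℝ) ≤ 2 * N by positivity)]
    field_simp

theorem isPerronFrobeniusMeasure_perronMeasure (hN : 1 ≤ N) :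
    Λ.IsPerronFrobeniusMeasure Λ.perronMeasure :=
  have hκ := hΛ.isPerronFrobeniusVector_perronVector hN
  ⟨_, hκ, hκ.measure_cylinder_of_diagonal (hΛ.rho_pos hN) hΛ.finite_edges
    fun _ _ h => hΛ.perronMeasure_cylinder hN h⟩

theorem productMeasure_equivalent_perronMeasure (hN : 1 ≤ N) {δ : Fin N → ℕ → ℝ}
    (hδ : ∀ j i, |δ j i| < 1) (hsum : ∀ j, Summable fun i => |δ j i|) {μ M : Measure Λ.InfPath}
    (hμ : IsProductMeasure Λ δ μ) (hM : Λ.IsPerronFrobeniusMeasure M) : μ ≪ M ∧ M ≪ μ := by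
  rw [hμ.unique (hΛ.isProductMeasure_pathMeasure hN hδ),
    hΛ.perronFrobeniusMeasure_unique hM (hΛ.isPerronFrobeniusMeasure_perronMeasure hN)]
  have hv : ENNReal.ofReal (1 + √(2 * N))⁻¹ ≠ 0 :=
    (ENNReal.ofReal_pos.2 (by positivity)).ne'
  have hne : ENNReal.ofReal (√(2 * N) * (1 + √(2 * N))⁻¹) ≠ 0 :=
    (ENNReal.ofReal_pos.2 (by positivity)).ne'
  obtain ⟨hv₁, hv₂⟩ := hΛ.pathMeasure_equivalent hN hδ hsum 0
  obtain ⟨hne₁, hne₂⟩ := hΛ.pathMeasure_equivalent hN hδ hsum 1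
  exact ⟨(hv₁.trans (Measure.absolutelyContinuous_smul hv)).add
      (hne₁.trans (Measure.absolutelyContinuous_smul hne)),
    (Measure.smul_absolutelyContinuous.trans hv₂).add
      (Measure.smul_absolutelyContinuous.trans hne₂)⟩

end IsLambda2N

theorem IsProductMeasure.isFiniteMeasure {N : ℕ} {P : Type u} {Λ : KGraph 2 (StarVertex N) P}
    {δ : Fin N → ℕ → ℝ} {μ : Measure Λ.InfPath} (hμ : IsProductMeasure Λ δ μ) :
    IsFiniteMeasure μ :=
  isFiniteMeasure_of_cylinder fun w => (hμ 0 _ (Λ.d_idp w)).trans_ne ENNReal.ofReal_ne_top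

end

theorem mainTheorem11 {N : ℕ} (hN : 1 ≤ N) {P : Type*} (Λ : KGraph 2 (StarVertex N) P)
    (hΛ : IsLambda2N Λ) (δ : Fin N → ℕ → ℝ) (hδ : ∀ j i, |δ j i| < 1)
    (hsum : ∀ j, Summable fun i => |δ j i|) :
    (∃! μ : Measure Λ.InfPath, IsProductMeasure Λ δ μ) ∧
    (∃! M : Measure Λ.InfPath, Λ.IsPerronFrobeniusMeasure M) ∧
    ∀ μ M : Measure Λ.InfPath, IsProductMeasure Λ δ μ → Λ.IsPerronFrobeniusMeasure M →
      (μ ≪ M ∧ M ≪ μ) ∧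
      Λ.StandardSemibranching μ ∧
      Λ.StandardSemibranching M ∧
      (∃! π : Λ.cstar →⋆ₙₐ[ℂ] (Lp ℂ 2 μ →L[ℂ] Lp ℂ 2 μ), Λ.IsStandardRep μ π) ∧
      (∃! π : Λ.cstar →⋆ₙₐ[ℂ] (Lp ℂ 2 M →L[ℂ] Lp ℂ 2 M), Λ.IsStandardRep M π) ∧
      ∀ (π : Λ.cstar →⋆ₙₐ[ℂ] (Lp ℂ 2 μ →L[ℂ] Lp ℂ 2 μ))
        (ρ : Λ.cstar →⋆ₙₐ[ℂ] (Lp ℂ 2 M →L[ℂ] Lp ℂ 2 M)),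
        Λ.IsStandardRep μ π → Λ.IsStandardRep M ρ → UnitarilyEquivalent π ρ := by
  refine ⟨⟨_, hΛ.isProductMeasure_pathMeasure hN hδ, fun μ hμ =>
      hμ.unique (hΛ.isProductMeasure_pathMeasure hN hδ)⟩,
    ⟨_, hΛ.isPerronFrobeniusMeasure_perronMeasure hN, fun M hM =>
      hΛ.perronFrobeniusMeasure_unique hM (hΛ.isPerronFrobeniusMeasure_perronMeasure hN)⟩,
    fun μ M hμ hM => ?_⟩
  have := hM.isFiniteMeasure
  have := hμ.isFiniteMeasure
  obtain ⟨hμM, hMμ⟩ := hΛ.productMeasure_equivalent_perronMeasure hN hδ hsum hμ hM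
  have HM : Λ.StandardSemibranching M := hM.standardSemibranching (hΛ.rho_pos hN)
  have Hμ : Λ.StandardSemibranching μ := HM.congr_measure hμM hMμ
  exact ⟨⟨hμM, hMμ⟩, Hμ, HM, Hμ.existsUnique_rep, HM.existsUnique_rep,
    fun π ρ hπ hρ => HM.unitarilyEquivalent hμM hMμ hπ hρ⟩
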